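/- Let $M$ be a contractible (in particular connected) smooth manifold without boundary, Hausdorff and second countable, for example $\mathbb{R}^3$, let $\rho \in \Omega^2(M, \mathrm{i}\mathbb{R})$, and let $\mathcal{I}_\rho$ be the trivial hermitian bundle gerbe on $M$ with curving $\rho$. The category $\Gamma(M,\mathcal{I}_\rho)$ of sections has as objects the 1-morphisms $\mathcal{I}_0 \to \mathcal{I}_\rho$, i.e. triples $(\zeta, E, \alpha)$ of a surjective submersion $\zeta : Z \to M$, a hermitian vector bundle $E$ of finite rank with unitary connection on $Z$, and a unitary parallel isomorphism $\alpha : \mathrm{pr}_0^*E \to \mathrm{pr}_1^*E$ over $Z\times_M Z$ satisfying the cocycle condition; no relation between the curvature of $E$ and $\rho$ is required. Its morphisms are the parallel (not necessarily unitary) 2-morphisms, i.e. the parallel bundle maps $\psi_{z,z'} : E_z \to E'_{z'}$ over $Z\times_M Z'$ that are compatible with $\alpha$ and $\alpha'$. The inner product $\langle S,S'\rangle$ of two sections is the space of parallel sections of the bundle over $M$ obtained by descent from the homomorphism bundle, which is the space of 2-morphisms $S \to S'$, with the pairing $(\psi,\varphi)\mapsto \mathrm{tr}(\psi^*\varphi)$.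 The category $\Omega^1(M,\mathfrak{u})$ has as objects the forms $A \in \Omega^1(M,\mathfrak{u}(n))$, $n \in \mathbb{N}_0$. A morphism from $A\in \Omega^1(M,\mathfrak{u}(n))$ to $A'\in \Omega^1(M,\mathfrak{u}(n'))$ is a smooth function $f$ on $M$ with values in the complex $n'\times n$ matrices such that $A'f = fA + \mathrm{d}f$, and composition is the pointwise product of matrices. The inner product $\langle A,A'\rangle$ is the space of these $f$ with the pairing $(f,g)\mapsto \mathrm{tr}(f^*g)$. Then the following hold. 1. The function $\mathrm{tr}(f^*g)$ is constant on $M$ for all $f,g\in\langle A,A'\rangle$, and makes $\langle A,A'\rangle$ a finite-dimensional complex Hilbert space. Likewise, $\mathrm{tr}(\psi^*\varphi)$ is constant on $Z\times_M Z'$ and makes $\langle S,S'\rangle$ a finite-dimensional complex Hilbert space. 2. The functor $\Omega^1(M,\mathfrak{u})\to\Gamma(M,\mathcal{I}_\rho)$ which sends $A \in \Omega^1(M,\mathfrak{u}(n))$ to the trivial bundle $M\times\mathbb{C}^n$ with connection $\mathrm{d}-A$ (and $\zeta = \mathrm{id}_M$, $\alpha = \mathrm{id}$), and $f$ to fibrewise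 multiplication by $f$, is a $\mathbb{C}$-linear equivalence of categories. 3. This equivalence respects the 2-Hilbert space structures: * it preserves the inner products, $\mathrm{tr}(\psi_f^*\psi_g) = \mathrm{tr}(f^*g)$, where $\psi_f$ denotes the image of $f$; * pointwise adjoints give the conjugate symmetries $\langle A,A'\rangle\cong\overline{\langle A',A\rangle}$ and $\langle S,S'\rangle\cong\overline{\langle S',S\rangle}$, and the functor commutes with adjoints; * the zero form of rank $0$ and the block sum $A\oplus B$ are a zero object and direct sums (biproducts) in $\Omega^1(M,\mathfrak{u})$, and are sent to a zero object and direct sums in $\Gamma(M,\mathcal{I}_\rho)$; * it commutes with the actions $A\mapsto A\otimes 1_V$ and $E\mapsto E\otimes V$ of finite-dimensional Hilbert spaces $V$, up to unitary isomorphisms that are natural in both variables and compatible with the maps $e\mapsto e\otimes v$, $v \in V$; * for all $A$, $B$ and $V$, every linear map $T : V\to\langle A,B\rangle$ comes from exactly one morphism $h : A\otimes 1_V\to B$ in the sense that $h(e\otimes v) = T(v)\,e$ for all $v \in V$. -/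

import Mathlib

open scoped Manifold ContDiff TensorProduct
open CategoryTheory

universe u

set_option linter.unusedSectionVars false
set_option linter.unusedVariables false

noncomputable section

namespace GerbeSections

/-- A smooth 2-form on `M` with values in `iℝ`, the curving of a trivial bundle gerbe. -/
structure ImaginaryTwoForm (d : ℕ) (M : Type u) [TopologicalSpace M]
    [ChartedSpace (EuclideanSpace ℝ (Fin d)) M] [IsManifold (𝓡 d) ∞ M] where
  toFun : ∀ x : M, TangentSpace (𝓡 d) x →L[ℝ] TangentSpace (𝓡 d) x →L[ℝ] ℂ
  alternating : ∀ x v, toFun x v v = 0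
  imaginary : ∀ x v w, (toFun x v w).re = 0
  smooth : ContMDiff (𝓡 d)
    ((𝓡 d).prod 𝓘(ℝ, EuclideanSpace ℝ (Fin d) →L[ℝ] EuclideanSpace ℝ (Fin d) →L[ℝ] ℂ)) ∞
    (fun x ↦ Bundle.TotalSpace.mk'
      (EuclideanSpace ℝ (Fin d) →L[ℝ] EuclideanSpace ℝ (Fin d) →L[ℝ] ℂ)
      (E := fun x : M ↦ TangentSpace (𝓡 d) x →L[ℝ] TangentSpace (𝓡 d) x →L[ℝ] ℂ) x (toFun x))

/-- The differential of a complex-valued function. -/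
def dC {k : ℕ} {N : Type u} [TopologicalSpace N] [ChartedSpace (EuclideanSpace ℝ (Fin k)) N]
    (f : N → ℂ) (x : N) : TangentSpace (𝓡 k) x →L[ℝ] ℂ :=
  mfderiv (𝓡 k) 𝓘(ℝ, ℂ) f x

theorem cmMul {E H N : Type*} [NormedAddCommGroup E] [NormedSpace ℝ E] [TopologicalSpace H]
    {I : ModelWithCorners ℝ E H} [TopologicalSpace N] [ChartedSpace H N] {f g : N → ℂ} {x : N}
    (hf : ContMDiffAt I 𝓘(ℝ, ℂ) ∞ f x) (hg : ContMDiffAt I 𝓘(ℝ, ℂ) ∞ g x) :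
    ContMDiffAt I 𝓘(ℝ, ℂ) ∞ (fun y ↦ f y * g y) x :=
  (contDiff_mul (𝕜 := ℝ) (𝔸 := ℂ)).contMDiff.contMDiffAt.comp x (hf.prodMk_space hg)

theorem dC_mul {k : ℕ} {N : Type u} [TopologicalSpace N] [ChartedSpace (EuclideanSpace ℝ (Fin k)) N]
    {f g : N → ℂ} {x : N} (hf : ContMDiffAt (𝓡 k) 𝓘(ℝ, ℂ) ∞ f x)
    (hg : ContMDiffAt (𝓡 k) 𝓘(ℝ, ℂ) ∞ g x) (v : TangentSpace (𝓡 k) x) :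
    dC (fun y ↦ f y * g y) x v = dC f x v * g x + f x * dC g x v := by
  have hf' := (hf.mdifferentiableAt (by simp)).hasMFDerivAt
  have hg' := (hg.mdifferentiableAt (by simp)).hasMFDerivAt
  have := (hf'.mul hg').mfderiv
  have e : dC (fun y ↦ f y * g y) x v = mfderiv (𝓡 k) 𝓘(ℝ, ℂ) (f * g) x v := rfl
  rw [e, this]
  change f x * dC g x v + g x * dC f x v = _
  ring

theorem dC_sum {k : ℕ} {N : Type u} [TopologicalSpace N] [ChartedSpace (EuclideanSpace ℝ (Fin k)) N]
    {ι : Type} {s : Finset ι} {f : ι → N → ℂ} {x : N}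
    (hf : ∀ i, ContMDiffAt (𝓡 k) 𝓘(ℝ, ℂ) ∞ (f i) x) (v : TangentSpace (𝓡 k) x) :
    dC (fun y ↦ ∑ i ∈ s, f i y) x v = ∑ i ∈ s, dC (f i) x v := by
  have hf' := fun i ↦ ((hf i).mdifferentiableAt (by simp)).hasMFDerivAt
  have e : (fun y ↦ ∑ i ∈ s, f i y) = ∑ i ∈ s, f i := by ext; simp
  have := (HasMFDerivAt.sum (t := s) fun i _ ↦ hf' i).mfderiv
  rw [dC, e, this]
  exact _root_.sum_apply s (fun i ↦ (dC (f i) x : TangentSpace (𝓡 k) x →L[ℝ] ℂ)) v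

/-- A hermitian vector bundle with unitary connection over a manifold `N`: fibres, local unitary
frames with smooth transition functions, and local connection 1-forms. On a domain `dom i` the
connection is `d + form i` in the frame `frame i`; `skew` says that it is unitary and `gauge` that
the local expressions agree on overlaps: with `g = ⟪frame i, frame j⟫` the law is
`dg + form i * g = g * form j`. Values outside `dom i` carry no meaning. The rank may depend on the
component of `N`. -/
structure HermBundle (k : ℕ) (N : Type u) [TopologicalSpace N]
    [ChartedSpace (EuclideanSpace ℝ (Fin k)) N] [IsManifold (𝓡 k) ∞ N] where
  fib : N → Type
  [normed : ∀ x, NormedAddCommGroup (fib x)]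
  [ips : ∀ x, InnerProductSpace ℂ (fib x)]
  [findim : ∀ x, FiniteDimensional ℂ (fib x)]
  ι : Type u
  idx : ι → Type
  [fintype : ∀ i, Fintype (idx i)]
  dom : ι → Set N
  isOpen_dom : ∀ i, IsOpen (dom i)
  cover : ∀ x, ∃ i, x ∈ dom i
  frame : ∀ (i : ι) (x : N), idx i → fib x
  orthonormal : ∀ i, ∀ x ∈ dom i, Orthonormal ℂ (frame i x)
  span : ∀ i, ∀ x ∈ dom i, ⊤ ≤ Submodule.span ℂ (Set.range (frame i x))
  smooth_transition : ∀ i j a b, ∀ x ∈ dom i ∩ dom j,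
    ContMDiffAt (𝓡 k) 𝓘(ℝ, ℂ) ∞ (fun y ↦ inner ℂ (frame i y a) (frame j y b)) x
  form : ∀ i : ι, idx i → idx i → ∀ x : N, TangentSpace (𝓡 k) x →L[ℝ] ℂ
  smooth_form : ∀ i a b, ∀ p : TangentBundle (𝓡 k) N, p.proj ∈ dom i →
    ContMDiffAt (𝓡 k).tangent 𝓘(ℝ, ℂ) ∞
      (fun q : TangentBundle (𝓡 k) N ↦ form i a b q.proj q.snd) p
  skew : ∀ i a b, ∀ x ∈ dom i, ∀ v, form i a b x v = - (starRingEnd ℂ) (form i b a x v)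
  gauge : ∀ i j a b, ∀ x ∈ dom i ∩ dom j, ∀ v : TangentSpace (𝓡 k) x,
    dC (fun y ↦ inner ℂ (frame i y a) (frame j y b)) x v
      + ∑ c, form i a c x v * inner ℂ (frame i x c) (frame j x b)
    = ∑ c, inner ℂ (frame i x a) (frame j x c) * form j c b x v

attribute [instance] HermBundle.normed HermBundle.ips HermBundle.findim HermBundle.fintype


section Parallel

variable {k₀ k₁ k₂ : ℕ} {N₀ N₁ N₂ : Type u}
  [TopologicalSpace N₀] [ChartedSpace (EuclideanSpace ℝ (Fin k₀)) N₀] [IsManifold (𝓡 k₀) ∞ N₀]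
  [TopologicalSpace N₁] [ChartedSpace (EuclideanSpace ℝ (Fin k₁)) N₁] [IsManifold (𝓡 k₁) ∞ N₁]
  [TopologicalSpace N₂] [ChartedSpace (EuclideanSpace ℝ (Fin k₂)) N₂] [IsManifold (𝓡 k₂) ∞ N₂]
  {m : ℕ}

/-- The matrix of a family of fibre maps along a pair of plots, in local frames. -/
def coeff (E₀ : HermBundle k₀ N₀) (E₁ : HermBundle k₁ N₁)
    (g₀ : EuclideanSpace ℝ (Fin m) → N₀) (g₁ : EuclideanSpace ℝ (Fin m) → N₁)
    (φ : ∀ t, E₀.fib (g₀ t) →ₗ[ℂ] E₁.fib (g₁ t)) (i : E₀.ι) (j : E₁.ι)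
    (t : EuclideanSpace ℝ (Fin m)) : Matrix (E₁.idx j) (E₀.idx i) ℂ :=
  Matrix.of fun b a ↦ inner ℂ (E₁.frame j (g₁ t) b) (φ t (E₀.frame i (g₀ t) a))

/-- The pullback of a local connection form along a plot, evaluated on a tangent vector. -/
def pullForm (E : HermBundle k₀ N₀) (g : EuclideanSpace ℝ (Fin m) → N₀) (i : E.ι)
    (t v : EuclideanSpace ℝ (Fin m)) : Matrix (E.idx i) (E.idx i) ℂ :=
  Matrix.of fun a b ↦ E.form i a b (g t) (mfderiv 𝓘(ℝ, EuclideanSpace ℝ (Fin m)) (𝓡 k₀) g t v)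

/-- The entrywise derivative of a matrix-valued function. -/
def matDeriv {α β : Type} (f : EuclideanSpace ℝ (Fin m) → Matrix β α ℂ)
    (t v : EuclideanSpace ℝ (Fin m)) : Matrix β α ℂ :=
  Matrix.of fun b a ↦ fderiv ℝ (fun s ↦ f s b a) t v

/-- A family of linear maps `φ t : E₀ at g₀ t → E₁ at g₁ t` is smooth at `t`, and intertwines the
pulled-back connections there: `dc + ω₁ c = c ω₀` for its matrix `c` in local frames. -/
def IsParallelAt (E₀ : HermBundle k₀ N₀) (E₁ : HermBundle k₁ N₁)
    (g₀ : EuclideanSpace ℝ (Fin m) → N₀) (g₁ : EuclideanSpace ℝ (Fin m) → N₁)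
    (φ : ∀ t, E₀.fib (g₀ t) →ₗ[ℂ] E₁.fib (g₁ t)) (t : EuclideanSpace ℝ (Fin m)) : Prop :=
  ∀ i j, g₀ t ∈ E₀.dom i → g₁ t ∈ E₁.dom j →
    (∀ b a, ContDiffAt ℝ ∞ (fun s ↦ coeff E₀ E₁ g₀ g₁ φ i j s b a) t) ∧
    ∀ v, matDeriv (coeff E₀ E₁ g₀ g₁ φ i j) t v
        + pullForm E₁ g₁ j t v * coeff E₀ E₁ g₀ g₁ φ i j t
      = coeff E₀ E₁ g₀ g₁ φ i j t * pullForm E₀ g₀ i t v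

theorem HermBundle.expand (E : HermBundle k₀ N₀) (i : E.ι) {x : N₀} (hx : x ∈ E.dom i)
    (w : E.fib x) :
    w = ∑ c, inner ℂ (E.frame i x c) w • E.frame i x c := by
  have := (OrthonormalBasis.mk (E.orthonormal i x hx) (E.span i x hx)).sum_repr' w
  simpa using this.symm

theorem matDeriv_mul {α β γ : Type} [Fintype β] {P : EuclideanSpace ℝ (Fin m) → Matrix γ β ℂ}
    {Q : EuclideanSpace ℝ (Fin m) → Matrix β α ℂ} {t : EuclideanSpace ℝ (Fin m)}
    (hP : ∀ c b, DifferentiableAt ℝ (fun s ↦ P s c b) t)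
    (hQ : ∀ b a, DifferentiableAt ℝ (fun s ↦ Q s b a) t) (v : EuclideanSpace ℝ (Fin m)) :
    matDeriv (fun s ↦ P s * Q s) t v = matDeriv P t v * Q t + P t * matDeriv Q t v := by
  ext c a
  have : (fun s ↦ (P s * Q s) c a) = fun s ↦ ∑ b, P s c b * Q s b a := by
    ext s; simp [Matrix.mul_apply]
  simp only [matDeriv, Matrix.of_apply, Matrix.add_apply, this]
  rw [fderiv_fun_sum fun b _ ↦ (hP c b).fun_mul (hQ b a)]
  simp only [fun b ↦ fderiv_fun_mul (hP c b) (hQ b a), sum_apply,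
    add_apply, smul_apply, smul_eq_mul, Matrix.mul_apply,
    Matrix.of_apply, Finset.sum_add_distrib]
  rw [add_comm]
  congr 1
  exact Finset.sum_congr rfl fun b _ ↦ mul_comm _ _

theorem matDeriv_congr {α β : Type} {P Q : EuclideanSpace ℝ (Fin m) → Matrix β α ℂ}
    {t : EuclideanSpace ℝ (Fin m)} (h : P =ᶠ[nhds t] Q) (v : EuclideanSpace ℝ (Fin m)) :
    matDeriv P t v = matDeriv Q t v := by
  ext b a
  have : (fun s ↦ P s b a) =ᶠ[nhds t] fun s ↦ Q s b a := h.mono fun s hs ↦ by simp [hs]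
  simp [matDeriv, this.fderiv_eq]

theorem IsParallelAt.comp {E₀ : HermBundle k₀ N₀} {E₁ : HermBundle k₁ N₁} {E₂ : HermBundle k₂ N₂}
    {g₀ : EuclideanSpace ℝ (Fin m) → N₀} {g₁ : EuclideanSpace ℝ (Fin m) → N₁}
    {g₂ : EuclideanSpace ℝ (Fin m) → N₂}
    {φ : ∀ t, E₀.fib (g₀ t) →ₗ[ℂ] E₁.fib (g₁ t)} {χ : ∀ t, E₁.fib (g₁ t) →ₗ[ℂ] E₂.fib (g₂ t)}
    {t : EuclideanSpace ℝ (Fin m)} (hg : ContinuousAt g₁ t)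
    (hφ : IsParallelAt E₀ E₁ g₀ g₁ φ t) (hχ : IsParallelAt E₁ E₂ g₁ g₂ χ t) :
    IsParallelAt E₀ E₂ g₀ g₂ (fun t ↦ χ t ∘ₗ φ t) t := by
  intro i l hi hl
  obtain ⟨j, hj⟩ := E₁.cover (g₁ t)
  have key : ∀ s, g₁ s ∈ E₁.dom j →
      coeff E₀ E₂ g₀ g₂ (fun t ↦ χ t ∘ₗ φ t) i l s =
      coeff E₁ E₂ g₁ g₂ χ j l s * coeff E₀ E₁ g₀ g₁ φ i j s := by
    intro s hs
    ext b a
    simp only [coeff, LinearMap.comp_apply, Matrix.of_apply, Matrix.mul_apply]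
    conv_lhs => rw [E₁.expand j hs (φ s (E₀.frame i (g₀ s) a))]
    simp [map_sum, mul_comm]
  have hev : coeff E₀ E₂ g₀ g₂ (fun t ↦ χ t ∘ₗ φ t) i l =ᶠ[nhds t]
      fun s ↦ coeff E₁ E₂ g₁ g₂ χ j l s * coeff E₀ E₁ g₀ g₁ φ i j s := by
    filter_upwards [hg.preimage_mem_nhds ((E₁.isOpen_dom j).mem_nhds hj)] with s hs
    exact key s hs
  obtain ⟨h1, e1⟩ := hφ i j hi hj
  obtain ⟨h2, e2⟩ := hχ j l hj hl
  refine ⟨fun b a ↦ ?_, fun v ↦ ?_⟩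
  · refine ContDiffAt.congr_of_eventuallyEq
      (ContDiffAt.sum (s := Finset.univ) fun c _ ↦ (h2 b c).mul (h1 c a)) ?_
    exact hev.mono fun s hs ↦ by simp [hs, Matrix.mul_apply]
  · rw [matDeriv_congr hev, matDeriv_mul (fun c b ↦ (h2 c b).differentiableAt (by simp))
      (fun c b ↦ (h1 c b).differentiableAt (by simp)), key t hj, Matrix.mul_assoc, ← e1 v,
      Matrix.mul_add, ← Matrix.mul_assoc, ← Matrix.mul_assoc, ← e2 v, Matrix.add_mul]
    abel

theorem IsParallelAt.add {E₀ : HermBundle k₀ N₀} {E₁ : HermBundle k₁ N₁}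
    {g₀ : EuclideanSpace ℝ (Fin m) → N₀} {g₁ : EuclideanSpace ℝ (Fin m) → N₁}
    {φ χ : ∀ t, E₀.fib (g₀ t) →ₗ[ℂ] E₁.fib (g₁ t)} {t : EuclideanSpace ℝ (Fin m)}
    (hφ : IsParallelAt E₀ E₁ g₀ g₁ φ t) (hχ : IsParallelAt E₀ E₁ g₀ g₁ χ t) :
    IsParallelAt E₀ E₁ g₀ g₁ (fun t ↦ φ t + χ t) t := by
  intro i j hi hj
  obtain ⟨h1, e1⟩ := hφ i j hi hj
  obtain ⟨h2, e2⟩ := hχ i j hi hj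
  have key : ∀ s, coeff E₀ E₁ g₀ g₁ (fun t ↦ φ t + χ t) i j s =
      coeff E₀ E₁ g₀ g₁ φ i j s + coeff E₀ E₁ g₀ g₁ χ i j s := by
    intro s; ext b a; simp [coeff]
  refine ⟨fun b a ↦ ?_, fun v ↦ ?_⟩
  · simp only [key, Matrix.add_apply]
    exact (h1 b a).add (h2 b a)
  · have : matDeriv (coeff E₀ E₁ g₀ g₁ (fun t ↦ φ t + χ t) i j) t v =
        matDeriv (coeff E₀ E₁ g₀ g₁ φ i j) t v + matDeriv (coeff E₀ E₁ g₀ g₁ χ i j) t v := by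
      ext b a
      simp only [matDeriv, key, Matrix.add_apply, Matrix.of_apply]
      rw [fderiv_fun_add ((h1 b a).differentiableAt (by simp))
        ((h2 b a).differentiableAt (by simp))]
      rfl
    rw [this, key, Matrix.add_mul, Matrix.mul_add, ← e1, ← e2]
    abel

theorem IsParallelAt.smul {E₀ : HermBundle k₀ N₀} {E₁ : HermBundle k₁ N₁}
    {g₀ : EuclideanSpace ℝ (Fin m) → N₀} {g₁ : EuclideanSpace ℝ (Fin m) → N₁}
    {φ : ∀ t, E₀.fib (g₀ t) →ₗ[ℂ] E₁.fib (g₁ t)} {t : EuclideanSpace ℝ (Fin m)} (r : ℂ)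
    (hφ : IsParallelAt E₀ E₁ g₀ g₁ φ t) :
    IsParallelAt E₀ E₁ g₀ g₁ (fun t ↦ r • φ t) t := by
  intro i j hi hj
  obtain ⟨h1, e1⟩ := hφ i j hi hj
  have key : ∀ s, coeff E₀ E₁ g₀ g₁ (fun t ↦ r • φ t) i j s =
      r • coeff E₀ E₁ g₀ g₁ φ i j s := by
    intro s; ext b a; simp [coeff]
  refine ⟨fun b a ↦ ?_, fun v ↦ ?_⟩
  · simp only [key, Matrix.smul_apply, smul_eq_mul]
    exact contDiffAt_const.mul (h1 b a)
  · have : matDeriv (coeff E₀ E₁ g₀ g₁ (fun t ↦ r • φ t) i j) t v =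
        r • matDeriv (coeff E₀ E₁ g₀ g₁ φ i j) t v := by
      ext b a
      simp only [matDeriv, key, Matrix.smul_apply, Matrix.of_apply, smul_eq_mul]
      rw [fderiv_const_mul ((h1 b a).differentiableAt (by simp))]
      rfl
    rw [this, key, Matrix.smul_mul, Matrix.mul_smul, ← e1, smul_add]

theorem IsParallelAt.zero (E₀ : HermBundle k₀ N₀) (E₁ : HermBundle k₁ N₁)
    (g₀ : EuclideanSpace ℝ (Fin m) → N₀) (g₁ : EuclideanSpace ℝ (Fin m) → N₁)
    (t : EuclideanSpace ℝ (Fin m)) : IsParallelAt E₀ E₁ g₀ g₁ (fun _ ↦ 0) t := by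
  intro i j _ _
  have key : coeff E₀ E₁ g₀ g₁ (fun _ ↦ 0) i j = fun _ ↦ 0 := by
    ext s b a; simp [coeff]
  refine ⟨fun b a ↦ ?_, fun v ↦ ?_⟩
  · simpa [key] using contDiffAt_const
  · have : matDeriv (fun _ ↦ (0 : Matrix (E₁.idx j) (E₀.idx i) ℂ)) t v = 0 := by
      ext b a; simp [matDeriv]
    simp [key, this]

/-- Parallelism of a family of fibre maps depends only on the germ of the plot. -/
theorem IsParallelAt.congr {E₀ : HermBundle k₀ N₀} {E₁ : HermBundle k₁ N₁}
    {g₀ g₀' : EuclideanSpace ℝ (Fin m) → N₀} {g₁ g₁' : EuclideanSpace ℝ (Fin m) → N₁}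
    {φ : ∀ t, E₀.fib (g₀ t) →ₗ[ℂ] E₁.fib (g₁ t)}
    {φ' : ∀ t, E₀.fib (g₀' t) →ₗ[ℂ] E₁.fib (g₁' t)} {t : EuclideanSpace ℝ (Fin m)}
    (h₀ : g₀ =ᶠ[nhds t] g₀') (h₁ : g₁ =ᶠ[nhds t] g₁')
    (h : ∀ᶠ s in nhds t, ∀ i j, coeff E₀ E₁ g₀ g₁ φ i j s = coeff E₀ E₁ g₀' g₁' φ' i j s)
    (hφ : IsParallelAt E₀ E₁ g₀ g₁ φ t) : IsParallelAt E₀ E₁ g₀' g₁' φ' t := by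
  intro i j hi hj
  obtain ⟨h1, e1⟩ := hφ i j (h₀.eq_of_nhds ▸ hi) (h₁.eq_of_nhds ▸ hj)
  have hev : coeff E₀ E₁ g₀' g₁' φ' i j =ᶠ[nhds t] coeff E₀ E₁ g₀ g₁ φ i j :=
    h.mono fun s hs ↦ (hs i j).symm
  refine ⟨fun b a ↦ (h1 b a).congr_of_eventuallyEq (hev.mono fun s hs ↦ by simp [hs]),
    fun v ↦ ?_⟩
  have p0 : pullForm E₀ g₀' i t v = pullForm E₀ g₀ i t v := by
    ext a b
    simp only [pullForm, Matrix.of_apply, h₀.mfderiv_eq]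
    rw [h₀.eq_of_nhds]
  have p1 : pullForm E₁ g₁' j t v = pullForm E₁ g₁ j t v := by
    ext a b
    simp only [pullForm, Matrix.of_apply, h₁.mfderiv_eq]
    rw [h₁.eq_of_nhds]
  rw [matDeriv_congr hev, p0, p1, hev.eq_of_nhds, e1]

end Parallel

theorem exists_local_lift {k d m : ℕ} {Z M : Type u}
    [TopologicalSpace Z] [ChartedSpace (EuclideanSpace ℝ (Fin k)) Z] [IsManifold (𝓡 k) ∞ Z]
    [TopologicalSpace M] [ChartedSpace (EuclideanSpace ℝ (Fin d)) M] [IsManifold (𝓡 d) ∞ M]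
    {ζ : Z → M} (hζ : Manifold.IsSubmersion (𝓡 k) (𝓡 d) ∞ ζ)
    {g : EuclideanSpace ℝ (Fin m) → M} (hg : ContMDiff 𝓘(ℝ, EuclideanSpace ℝ (Fin m)) (𝓡 d) ∞ g)
    (t : EuclideanSpace ℝ (Fin m)) (z : Z) (hz : ζ z = g t) :
    ∃ (h : EuclideanSpace ℝ (Fin m) → EuclideanSpace ℝ (Fin m))
      (l : EuclideanSpace ℝ (Fin m) → Z),
      ContDiff ℝ ∞ h ∧ h =ᶠ[nhds t] id ∧
      ContMDiff 𝓘(ℝ, EuclideanSpace ℝ (Fin m)) (𝓡 k) ∞ l ∧ ∀ s, ζ (l s) = g (h s) := by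
  obtain ⟨F, _, _, hF⟩ := hζ
  have H := hF z
  set φ := H.domChart
  set ψ := H.codChart
  set L := H.equiv
  have hw : ∀ x ∈ φ.target, ψ (ζ (φ.symm x)) = (L x).1 := fun x hx ↦ by
    have := H.writtenInCharts
      (show x ∈ (H.domChart.extend (𝓡 k)).target by simpa [φ] using hx)
    simpa using this
  have hz1 : z ∈ φ.source := H.mem_domChart_source
  have hz2 : ζ z ∈ ψ.source := H.mem_codChart_source
  have hφ := H.domChart_mem_maximalAtlas
  have hψ := H.codChart_mem_maximalAtlas
  have hss := H.source_subset_preimage_source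
  let σ : M → EuclideanSpace ℝ (Fin k) := fun x ↦ L.symm (ψ x, (L (φ z)).2)
  have hψz : ψ (ζ z) = (L (φ z)).1 := by
    have := hw (φ z) (φ.map_source hz1)
    rwa [φ.left_inv hz1] at this
  have hσz : σ (ζ z) = φ z := by simp [σ, hψz]
  let V : Set M := ψ.source ∩ σ ⁻¹' φ.target
  have hσc : ContinuousOn σ ψ.source := by
    refine L.symm.continuous.comp_continuousOn ?_
    exact ψ.continuousOn.prodMk continuousOn_const
  have hVo : IsOpen V := hσc.isOpen_inter_preimage ψ.open_source φ.open_target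
  have hzV : g t ∈ V := by
    rw [← hz]
    exact ⟨hz2, by simpa [hσz] using φ.map_source hz1⟩
  have hσm : ContMDiffOn (𝓡 d) 𝓘(ℝ, EuclideanSpace ℝ (Fin k)) ∞ σ ψ.source := by
    have h1 : ContMDiffOn (𝓡 d) 𝓘(ℝ, EuclideanSpace ℝ (Fin d)) ∞ ψ ψ.source :=
      contMDiffOn_of_mem_maximalAtlas hψ
    exact L.symm.contDiff.contMDiff.comp_contMDiffOn (h1.prodMk_space contMDiffOn_const)
  have hsm : ContMDiffOn (𝓡 d) (𝓡 k) ∞ (fun x ↦ φ.symm (σ x)) V :=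
    (contMDiffOn_symm_of_mem_maximalAtlas hφ).comp (hσm.mono Set.inter_subset_left)
      fun x hx ↦ hx.2
  have hsec : ∀ x ∈ V, ζ (φ.symm (σ x)) = x := by
    intro x hx
    have h2 : ψ (ζ (φ.symm (σ x))) = ψ x := by
      rw [hw (σ x) hx.2]
      simp [σ]
    exact ψ.injOn (hss (φ.map_target hx.2)) hx.1 h2
  obtain ⟨r, hr, hball⟩ := Metric.isOpen_iff.1 (hVo.preimage hg.continuous) t hzV
  let χ : ContDiffBump t := ⟨r / 2, r, by positivity, by linarith⟩
  let h : EuclideanSpace ℝ (Fin m) → EuclideanSpace ℝ (Fin m) := fun s ↦ t + χ s • (s - t)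
  have hh : ContDiff ℝ ∞ h := contDiff_const.add (χ.contDiff.smul (contDiff_id.sub contDiff_const))
  have hhb : ∀ s, g (h s) ∈ V := by
    intro s
    apply hball
    by_cases hs : s ∈ Metric.ball t r
    · rw [Metric.mem_ball, dist_eq_norm] at hs ⊢
      simp only [h, add_sub_cancel_left, norm_smul, Real.norm_eq_abs, abs_of_nonneg χ.nonneg]
      calc χ s * ‖s - t‖ ≤ 1 * ‖s - t‖ := by gcongr; exact χ.le_one
        _ < r := by simpa using hs
    · have : χ s = 0 := χ.zero_of_le_dist (by simpa using hs)
      simp [h, this, hr]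
  refine ⟨h, fun s ↦ φ.symm (σ (g (h s))), hh, ?_, ?_, fun s ↦ hsec _ (hhb s)⟩
  · filter_upwards [χ.eventuallyEq_one] with s hs
    simp [h, hs]
  · exact contMDiffOn_univ.1 <|
      hsm.comp (hg.comp hh.contMDiff).contMDiffOn fun s _ ↦ hhb s

/-- A finite-dimensional complex Hilbert space. -/
structure FdHilb where
  carrier : Type
  [normed : NormedAddCommGroup carrier]
  [ips : InnerProductSpace ℂ carrier]
  [findim : FiniteDimensional ℂ carrier]

attribute [instance] FdHilb.normed FdHilb.ips FdHilb.findim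

instance : CoeSort FdHilb Type := ⟨FdHilb.carrier⟩

/-- The dimension. -/
def FdHilb.dim (V : FdHilb) : ℕ := Module.finrank ℂ V

/-- A chosen orthonormal basis. -/
def FdHilb.basis (V : FdHilb) : OrthonormalBasis (Fin V.dim) ℂ V := stdOrthonormalBasis ℂ V

/-- The matrix of a linear map in the chosen orthonormal bases. -/
def FdHilb.matrix {V W : FdHilb} (T : V →ₗ[ℂ] W) : Matrix (Fin W.dim) (Fin V.dim) ℂ :=
  Matrix.of fun d c ↦ inner ℂ (W.basis d) (T (V.basis c))

section Tensor

variable {k : ℕ} {N : Type u} [TopologicalSpace N] [ChartedSpace (EuclideanSpace ℝ (Fin k)) N]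
  [IsManifold (𝓡 k) ∞ N]

/-- The tensor product of a bundle with the trivial flat bundle with fibre `V`. -/
@[reducible] def HermBundle.tensor (E : HermBundle k N) (V : FdHilb) : HermBundle k N where
  fib x := E.fib x ⊗[ℂ] V
  ι := E.ι
  idx i := E.idx i × Fin V.dim
  dom := E.dom
  isOpen_dom := E.isOpen_dom
  cover := E.cover
  frame i x p := E.frame i x p.1 ⊗ₜ V.basis p.2
  orthonormal i x hx := (E.orthonormal i x hx).tmul V.basis.orthonormal
  span i x hx := by
    have := ((OrthonormalBasis.mk (E.orthonormal i x hx) (E.span i x hx)).tensorProduct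
      V.basis).toBasis.span_eq
    rw [← this]
    refine Submodule.span_mono ?_
    rintro _ ⟨p, rfl⟩
    refine ⟨p, ?_⟩
    rw [OrthonormalBasis.coe_toBasis]
    exact ((OrthonormalBasis.tensorProduct_apply' _ _ p).trans (by simp)).symm
  smooth_transition i j a b x hx := by
    simp only [TensorProduct.inner_tmul]
    exact cmMul (E.smooth_transition i j a.1 b.1 x hx) contMDiffAt_const
  form i a b x := if a.2 = b.2 then E.form i a.1 b.1 x else 0
  smooth_form i a b p hp := by
    by_cases h : a.2 = b.2
    · simpa [h] using E.smooth_form i a.1 b.1 p hp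
    · simpa [h] using contMDiffAt_const
  skew i a b x hx v := by
    by_cases h : a.2 = b.2
    · simpa [h] using E.skew i a.1 b.1 x hx v
    · simp [h, Ne.symm h]
  gauge i j a b x hx v := by
    have h1 : ∀ c d : Fin V.dim, inner ℂ (V.basis c) (V.basis d) = if c = d then (1 : ℂ) else 0 :=
      fun c d ↦ V.basis.inner_eq_ite c d
    have key := E.gauge i j a.1 b.1 x hx v
    simp only [TensorProduct.inner_tmul, h1, Fintype.sum_prod_type]
    by_cases h : a.2 = b.2
    · simpa [h, ite_apply, apply_ite] using key
    · have h0 : dC (fun _ : N ↦ (0 : ℂ)) x v = 0 := by simp [dC]; rfl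
      simp [h, h0]


end Tensor

section TensorParallel

variable {k₀ k₁ : ℕ} {N₀ N₁ : Type u}
  [TopologicalSpace N₀] [ChartedSpace (EuclideanSpace ℝ (Fin k₀)) N₀] [IsManifold (𝓡 k₀) ∞ N₀]
  [TopologicalSpace N₁] [ChartedSpace (EuclideanSpace ℝ (Fin k₁)) N₁] [IsManifold (𝓡 k₁) ∞ N₁]
  {m : ℕ}

open scoped Kronecker

theorem pullForm_tensor (E : HermBundle k₀ N₀) (V : FdHilb) (g : EuclideanSpace ℝ (Fin m) → N₀)
    (i : E.ι) (t v : EuclideanSpace ℝ (Fin m)) :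
    pullForm (E.tensor V) g i t v = pullForm E g i t v ⊗ₖ (1 : Matrix (Fin V.dim) (Fin V.dim) ℂ) := by
  ext a b
  change (if a.2 = b.2 then E.form i a.1 b.1 (g t) else 0) _ =
    pullForm E g i t v a.1 b.1 * (1 : Matrix (Fin V.dim) (Fin V.dim) ℂ) a.2 b.2
  rw [Matrix.one_apply]
  split_ifs with h
  · rw [mul_one]; rfl
  · simp

theorem IsParallelAt.tensorMap {E₀ : HermBundle k₀ N₀} {E₁ : HermBundle k₁ N₁}
    {g₀ : EuclideanSpace ℝ (Fin m) → N₀} {g₁ : EuclideanSpace ℝ (Fin m) → N₁}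
    {φ : ∀ t, E₀.fib (g₀ t) →ₗ[ℂ] E₁.fib (g₁ t)} {t : EuclideanSpace ℝ (Fin m)}
    {V W : FdHilb} (T : V →ₗ[ℂ] W) (hφ : IsParallelAt E₀ E₁ g₀ g₁ φ t) :
    IsParallelAt (E₀.tensor V) (E₁.tensor W) g₀ g₁ (fun t ↦ TensorProduct.map (φ t) T) t := by
  intro i j hi hj
  obtain ⟨h1, e1⟩ := hφ i j hi hj
  have key : coeff (E₀.tensor V) (E₁.tensor W) g₀ g₁ (fun t ↦ TensorProduct.map (φ t) T) i j =
      fun s ↦ coeff E₀ E₁ g₀ g₁ φ i j s ⊗ₖ FdHilb.matrix T := by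
    ext s b a
    exact TensorProduct.inner_tmul (𝕜 := ℂ) _ _ _ _
  refine ⟨fun b a ↦ ?_, fun v ↦ ?_⟩
  · rw [key]
    exact (h1 b.1 a.1).mul contDiffAt_const
  · have : matDeriv (fun s ↦ coeff E₀ E₁ g₀ g₁ φ i j s ⊗ₖ FdHilb.matrix T) t v =
        matDeriv (coeff E₀ E₁ g₀ g₁ φ i j) t v ⊗ₖ FdHilb.matrix T := by
      ext b a
      change fderiv ℝ (fun s ↦ coeff E₀ E₁ g₀ g₁ φ i j s b.1 a.1 * FdHilb.matrix T b.2 a.2) t v =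
        fderiv ℝ (fun s ↦ coeff E₀ E₁ g₀ g₁ φ i j s b.1 a.1) t v * FdHilb.matrix T b.2 a.2
      rw [fderiv_mul_const ((h1 b.1 a.1).differentiableAt (by simp))]
      simp [mul_comm]
    rw [key, this, pullForm_tensor, pullForm_tensor]
    change _ + (_ ⊗ₖ _) * (_ ⊗ₖ _) = (_ ⊗ₖ _) * (_ ⊗ₖ _)
    rw [← Matrix.mul_kronecker_mul, ← Matrix.mul_kronecker_mul, Matrix.one_mul, Matrix.mul_one,
      ← Matrix.add_kronecker, e1]

theorem IsParallelAt.tensorVec {E₀ : HermBundle k₀ N₀} {E₁ : HermBundle k₁ N₁}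
    {g₀ : EuclideanSpace ℝ (Fin m) → N₀} {g₁ : EuclideanSpace ℝ (Fin m) → N₁}
    {φ : ∀ t, E₀.fib (g₀ t) →ₗ[ℂ] E₁.fib (g₁ t)} {t : EuclideanSpace ℝ (Fin m)}
    {V : FdHilb} (w : V) (hφ : IsParallelAt E₀ E₁ g₀ g₁ φ t) :
    IsParallelAt E₀ (E₁.tensor V) g₀ g₁
      (fun t ↦ (TensorProduct.mk ℂ (E₁.fib (g₁ t)) V).flip w ∘ₗ φ t) t := by
  intro i j hi hj
  obtain ⟨h1, e1⟩ := hφ i j hi hj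
  have key : ∀ s b a, coeff E₀ (E₁.tensor V) g₀ g₁
      (fun t ↦ (TensorProduct.mk ℂ (E₁.fib (g₁ t)) V).flip w ∘ₗ φ t) i j s b a =
      coeff E₀ E₁ g₀ g₁ φ i j s b.1 a * inner ℂ (V.basis b.2) w := by
    intro s b a
    exact TensorProduct.inner_tmul (𝕜 := ℂ) _ _ _ _
  refine ⟨fun b a ↦ ?_, fun v ↦ ?_⟩
  · simp only [key]
    exact (h1 b.1 a).mul contDiffAt_const
  · ext b a
    have e := congrFun (congrFun (e1 v) b.1) a
    simp only [Matrix.add_apply, matDeriv, Matrix.of_apply] at e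
    simp only [Matrix.add_apply, matDeriv, Matrix.of_apply, key]
    rw [fderiv_mul_const ((h1 b.1 a).differentiableAt (by simp)), pullForm_tensor]
    have l1 : ((pullForm E₁ g₁ j t v ⊗ₖ (1 : Matrix (Fin V.dim) (Fin V.dim) ℂ)) *
        coeff E₀ (E₁.tensor V) g₀ g₁
          (fun t ↦ (TensorProduct.mk ℂ (E₁.fib (g₁ t)) V).flip w ∘ₗ φ t) i j t) b a =
        (pullForm E₁ g₁ j t v * coeff E₀ E₁ g₀ g₁ φ i j t) b.1 a * inner ℂ (V.basis b.2) w := by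
      rw [Matrix.mul_apply, Matrix.mul_apply, Finset.sum_mul]
      refine (Fintype.sum_prod_type _).trans (Finset.sum_congr rfl fun c _ ↦ ?_)
      simp only [key]
      change ∑ d : Fin V.dim, (pullForm E₁ g₁ j t v b.1 c *
        (1 : Matrix (Fin V.dim) (Fin V.dim) ℂ) b.2 d) * _ = _
      rw [Finset.sum_eq_single b.2 (fun d _ hd ↦ by simp [hd.symm]) (by simp)]
      simp [mul_assoc]
    have l2 : (coeff E₀ (E₁.tensor V) g₀ g₁
          (fun t ↦ (TensorProduct.mk ℂ (E₁.fib (g₁ t)) V).flip w ∘ₗ φ t) i j t *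
          pullForm E₀ g₀ i t v) b a =
        (coeff E₀ E₁ g₀ g₁ φ i j t * pullForm E₀ g₀ i t v) b.1 a * inner ℂ (V.basis b.2) w := by
      rw [Matrix.mul_apply, Matrix.mul_apply, Finset.sum_mul]
      refine Finset.sum_congr rfl fun c _ ↦ ?_
      rw [key]; ring
    rw [l2, ← e, add_mul, ← l1]
    simp [mul_comm]

end TensorParallel

section Sections

variable {d : ℕ} {M : Type u} [TopologicalSpace M] [ChartedSpace (EuclideanSpace ℝ (Fin d)) M]
  [IsManifold (𝓡 d) ∞ M]

/-- A section of the trivial bundle gerbe with curving `ρ`, that is, a 1-morphism from the trivial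
gerbe with curving `0` to the one with curving `ρ`: a surjective submersion `ζ : Z → M`, a hermitian
bundle `E` with unitary connection on `Z`, and a parallel unitary isomorphism `α : pr₀* E → pr₁* E`
over `Z ×_M Z` with `α₁₂ ∘ α₀₁ = α₀₂` (the line bundles of trivial gerbes are trivial with trivial
connection and multiplication). No relation between the curvature of `E` and `ρ` is imposed.
Smoothness and parallelism over `Z ×_M Z` are tested on its smooth plots. -/
structure Sec (ρ : ImaginaryTwoForm d M) : Type (u + 1) where
  k : ℕ
  Z : Type u
  [top : TopologicalSpace Z]
  [charted : ChartedSpace (EuclideanSpace ℝ (Fin k)) Z]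
  [mfd : IsManifold (𝓡 k) ∞ Z]
  [t2 : T2Space Z]
  [sigma : SecondCountableTopology Z]
  ζ : Z → M
  submersion : Manifold.IsSubmersion (𝓡 k) (𝓡 d) ∞ ζ
  surjective : Function.Surjective ζ
  E : HermBundle k Z
  α : ∀ z₀ z₁ : Z, ζ z₀ = ζ z₁ → (E.fib z₀ ≃ₗᵢ[ℂ] E.fib z₁)
  α_parallel : ∀ (m : ℕ) (g₀ g₁ : EuclideanSpace ℝ (Fin m) → Z),
    ContMDiff 𝓘(ℝ, EuclideanSpace ℝ (Fin m)) (𝓡 k) ∞ g₀ →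
    ContMDiff 𝓘(ℝ, EuclideanSpace ℝ (Fin m)) (𝓡 k) ∞ g₁ →
    ∀ (h : ∀ t, ζ (g₀ t) = ζ (g₁ t)) (t),
      IsParallelAt E E g₀ g₁ (fun t ↦ (α _ _ (h t)).toLinearEquiv.toLinearMap) t
  α_cocycle : ∀ z₀ z₁ z₂ (h₀ : ζ z₀ = ζ z₁) (h₁ : ζ z₁ = ζ z₂) (e : E.fib z₀),
    α z₁ z₂ h₁ (α z₀ z₁ h₀ e) = α z₀ z₂ (h₀.trans h₁) e

attribute [instance] Sec.top Sec.charted Sec.mfd Sec.t2 Sec.sigma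

namespace Sec

variable {ρ : ImaginaryTwoForm d M}

theorem α_self (S : Sec ρ) (z : S.Z) (h : S.ζ z = S.ζ z) (e : S.E.fib z) : S.α z z h e = e :=
  (S.α z z h).injective (S.α_cocycle z z z h h e)

/-- The fibre product `Z ×_M Z'`. -/
abbrev FibProd (S S' : Sec ρ) : Type u := {p : S.Z × S'.Z // S.ζ p.1 = S'.ζ p.2}

/-- The 2-morphisms from `S` to `S'`: parallel, not necessarily isometric bundle maps `ψ` over
`Z ×_M Z'` which commute with the descent isomorphisms `α`. These are also the parallel sections of
the bundle over `M` to which the hermitian bundle of homomorphisms from `E` to `E'` descends. -/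
def homSubmodule (S S' : Sec ρ) : Submodule ℂ
    (∀ p : FibProd S S', S.E.fib p.1.1 →ₗ[ℂ] S'.E.fib p.1.2) where
  carrier := {ψ |
    (∀ (m : ℕ) (g : EuclideanSpace ℝ (Fin m) → S.Z) (g' : EuclideanSpace ℝ (Fin m) → S'.Z),
      ContMDiff 𝓘(ℝ, EuclideanSpace ℝ (Fin m)) (𝓡 S.k) ∞ g →
      ContMDiff 𝓘(ℝ, EuclideanSpace ℝ (Fin m)) (𝓡 S'.k) ∞ g' →
      ∀ (h : ∀ t, S.ζ (g t) = S'.ζ (g' t)) (t),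
        IsParallelAt S.E S'.E g g' (fun t ↦ ψ ⟨(g t, g' t), h t⟩) t) ∧
    (∀ z₀ z₁ z₀' z₁' (h : S.ζ z₀ = S.ζ z₁) (h' : S'.ζ z₀' = S'.ζ z₁') (h₀ : S.ζ z₀ = S'.ζ z₀')
      (h₁ : S.ζ z₁ = S'.ζ z₁') (e : S.E.fib z₀),
      S'.α z₀' z₁' h' (ψ ⟨(z₀, z₀'), h₀⟩ e) = ψ ⟨(z₁, z₁'), h₁⟩ (S.α z₀ z₁ h e))}
  add_mem' := by
    rintro ψ χ ⟨h1, h2⟩ ⟨h3, h4⟩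
    refine ⟨fun m g g' hg hg' h t ↦ (h1 m g g' hg hg' h t).add (h3 m g g' hg hg' h t), ?_⟩
    intro z₀ z₁ z₀' z₁' h h' h₀ h₁ e
    simp [h2 z₀ z₁ z₀' z₁' h h' h₀ h₁, h4 z₀ z₁ z₀' z₁' h h' h₀ h₁]
  zero_mem' := by
    refine ⟨fun m g g' hg hg' h t ↦ IsParallelAt.zero _ _ _ _ _, ?_⟩
    intros; simp
  smul_mem' := by
    rintro r ψ ⟨h1, h2⟩
    refine ⟨fun m g g' hg hg' h t ↦ (h1 m g g' hg hg' h t).smul r, ?_⟩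
    intro z₀ z₁ z₀' z₁' h h' h₀ h₁ e
    simp [h2 z₀ z₁ z₀' z₁' h h' h₀ h₁]

/-- The space `⟨S, S'⟩` of 2-morphisms from `S` to `S'`. -/
def Hom (S S' : Sec ρ) : Type u := homSubmodule S S'

instance (S S' : Sec ρ) : AddCommGroup (Hom S S') := inferInstanceAs (AddCommGroup (homSubmodule S S'))

instance (S S' : Sec ρ) : Module ℂ (Hom S S') := inferInstanceAs (Module ℂ (homSubmodule S S'))

/-- The value of a 2-morphism at a point of `Z ×_M Z'`. -/
def Hom.app {S S' : Sec ρ} (ψ : Hom S S') (z : S.Z) (z' : S'.Z) (h : S.ζ z = S'.ζ z') :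
    S.E.fib z →ₗ[ℂ] S'.E.fib z' :=
  ψ.1 ⟨(z, z'), h⟩

@[ext] theorem Hom.ext {S S' : Sec ρ} {ψ χ : Hom S S'}
    (h : ∀ z z' (hz : S.ζ z = S'.ζ z') e, ψ.app z z' hz e = χ.app z z' hz e) : ψ = χ :=
  Subtype.ext (by funext p; exact LinearMap.ext (h p.1.1 p.1.2 p.2))

theorem Hom.α_comp {S S' : Sec ρ} (ψ : Hom S S') {z : S.Z} {z₀ z₁ : S'.Z} (h : S.ζ z = S'.ζ z₀)
    (h' : S'.ζ z₀ = S'.ζ z₁) (e : S.E.fib z) :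
    S'.α z₀ z₁ h' (ψ.app z z₀ h e) = ψ.app z z₁ (h.trans h') e := by
  simpa [α_self, Hom.app] using ψ.2.2 z z z₀ z₁ rfl h' h (h.trans h') e

theorem Hom.comp_α {S S' : Sec ρ} (ψ : Hom S S') {z₀ z₁ : S.Z} {z : S'.Z} (h : S.ζ z₀ = S.ζ z₁)
    (h' : S.ζ z₁ = S'.ζ z) (e : S.E.fib z₀) :
    ψ.app z₁ z h' (S.α z₀ z₁ h e) = ψ.app z₀ z (h.trans h') e := by
  simpa [α_self, Hom.app] using (ψ.2.2 z₀ z₁ z z h rfl (h.trans h') h' e).symm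

/-- The identity of a section is `α`. -/
def id (S : Sec ρ) : Hom S S :=
  ⟨fun p ↦ (S.α p.1.1 p.1.2 p.2).toLinearEquiv.toLinearMap,
    fun m g g' hg hg' h t ↦ S.α_parallel m g g' hg hg' h t,
    fun z₀ z₁ z₀' z₁' h h' h₀ h₁ e ↦ by simp [S.α_cocycle]⟩

/-- A preimage of a point of `M`. -/
def lift (S' : Sec ρ) (x : M) : S'.Z := Function.surjInv S'.surjective x

theorem ζ_lift (S' : Sec ρ) (x : M) : S'.ζ (S'.lift x) = x := Function.surjInv_eq _ x

theorem comp_indep {S S' S'' : Sec ρ} (ψ : Hom S S') (χ : Hom S' S'') {z : S.Z} {z'' : S''.Z}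
    {z₀ z₁ : S'.Z} (h₀ : S.ζ z = S'.ζ z₀) (h₀' : S'.ζ z₀ = S''.ζ z'')
    (h₁ : S.ζ z = S'.ζ z₁) (h₁' : S'.ζ z₁ = S''.ζ z'') (e : S.E.fib z) :
    χ.app z₀ z'' h₀' (ψ.app z z₀ h₀ e) = χ.app z₁ z'' h₁' (ψ.app z z₁ h₁ e) := by
  rw [← ψ.α_comp h₀ (h₀.symm.trans h₁), χ.comp_α]

/-- Composition: over `(z, z'')` it is `χ ∘ ψ` through any point `z'` of `Z'` in the same fibre over
`M`; the choice does not matter. -/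
def comp {S S' S'' : Sec ρ} (ψ : Hom S S') (χ : Hom S' S'') : Hom S S'' :=
  ⟨fun p ↦ χ.app (S'.lift (S.ζ p.1.1)) p.1.2 ((S'.ζ_lift _).trans p.2) ∘ₗ
      ψ.app p.1.1 (S'.lift (S.ζ p.1.1)) (S'.ζ_lift _).symm, by
    refine ⟨fun m g g'' hg hg'' h t ↦ ?_, fun z₀ z₁ z₀' z₁' h h' h₀ h₁ e ↦ ?_⟩
    · have hζ : ContMDiff 𝓘(ℝ, EuclideanSpace ℝ (Fin m)) (𝓡 d) ∞ (fun t ↦ S.ζ (g t)) :=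
        S.submersion.contMDiff.comp hg
      obtain ⟨r, l, hr, hrt, hl, hlr⟩ := exists_local_lift S'.submersion hζ t
        (S'.lift (S.ζ (g t))) (S'.ζ_lift _)
      have hgr := hg.comp hr.contMDiff
      have hgr'' := hg''.comp hr.contMDiff
      have p1 := ψ.2.1 m _ _ hgr hl (fun s ↦ (hlr s).symm) t
      have p2 := χ.2.1 m _ _ hl hgr'' (fun s ↦ (hlr s).trans (h (r s))) t
      have p3 := IsParallelAt.comp hl.continuous.continuousAt p1 p2
      refine p3.congr (hrt.fun_comp g) (hrt.fun_comp g'') ?_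
      filter_upwards [hrt] with s hs i j
      ext b a
      change inner ℂ (S''.E.frame j (g'' (r s)) b) (χ.app (l s) (g'' (r s)) _
        (ψ.app (g (r s)) (l s) _ (S.E.frame i (g (r s)) a))) = _
      rw [comp_indep ψ χ (z₁ := S'.lift (S.ζ (g (r s)))) (h₁ := (S'.ζ_lift _).symm)
        (h₁' := (S'.ζ_lift _).trans (h (r s)))]
      have hs' : r s = s := hs
      rw [hs']
      rfl
    · simp only [LinearMap.comp_apply]
      rw [χ.α_comp, comp_indep ψ χ (z₁ := S'.lift (S.ζ z₁)) (h₁ := h.trans (S'.ζ_lift _).symm)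
        (h₁' := (S'.ζ_lift _).trans h₁), ← ψ.comp_α h (S'.ζ_lift _).symm]⟩

theorem comp_app {S S' S'' : Sec ρ} (ψ : Hom S S') (χ : Hom S' S'') {z : S.Z} {z'' : S''.Z}
    (h : S.ζ z = S''.ζ z'') (z' : S'.Z) (h' : S.ζ z = S'.ζ z') (e : S.E.fib z) :
    (comp ψ χ).app z z'' h e = χ.app z' z'' (h'.symm.trans h) (ψ.app z z' h' e) :=
  comp_indep ψ χ _ _ _ _ e

instance : Category.{u} (Sec ρ) where
  Hom := Hom
  id := id
  comp := comp
  id_comp {S S'} ψ := by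
    ext z z' hz e
    rw [comp_app _ _ _ z rfl]
    exact ψ.comp_α rfl hz e
  comp_id {S S'} ψ := by
    ext z z' hz e
    rw [comp_app _ _ _ z' hz]
    exact ψ.α_comp hz rfl e
  assoc {S₀ S₁ S₂ S₃} ψ χ κ := by
    ext z z' hz e
    have h1 := (S₁.ζ_lift (S₀.ζ z)).symm
    have h2 := (S₂.ζ_lift (S₀.ζ z)).symm
    rw [comp_app _ _ _ _ h2, comp_app _ _ _ _ h1, comp_app _ _ _ _ h1,
      comp_app _ _ _ (S₂.lift (S₀.ζ z)) (h1.symm.trans h2)]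

instance : Preadditive (Sec ρ) where
  homGroup S S' := inferInstanceAs (AddCommGroup (Hom S S'))
  add_comp S S' S'' ψ ψ' χ := by
    apply Hom.ext
    intro z z' hz e
    exact map_add (χ.app _ _ _) _ _
  comp_add S S' S'' ψ χ χ' := by
    apply Hom.ext
    intro z z' hz e
    rfl

instance : Linear ℂ (Sec ρ) where
  homModule S S' := inferInstanceAs (Module ℂ (Hom S S'))
  smul_comp S S' S'' r ψ χ := by
    apply Hom.ext
    intro z z' hz e
    exact map_smul (χ.app _ _ _) _ _
  comp_smul S S' S'' ψ r χ := by
    apply Hom.ext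
    intro z z' hz e
    rfl

/-- The action of a Hilbert space `V` on sections: tensor with the trivial bundle with fibre `V`. -/
@[reducible] def tensor (S : Sec ρ) (V : FdHilb) : Sec ρ where
  k := S.k
  Z := S.Z
  ζ := S.ζ
  submersion := S.submersion
  surjective := S.surjective
  E := S.E.tensor V
  α z₀ z₁ h := TensorProduct.congrIsometry (S.α z₀ z₁ h) (LinearIsometryEquiv.refl ℂ V)
  α_parallel m g₀ g₁ h₀ h₁ h t := (S.α_parallel m g₀ g₁ h₀ h₁ h t).tensorMap LinearMap.id
  α_cocycle z₀ z₁ z₂ h₀ h₁ e := by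
    change S.E.fib z₀ ⊗[ℂ] V at e
    induction e using TensorProduct.induction_on with
    | zero => simp
    | tmul x y => simp [S.α_cocycle]
    | add x y hx hy => simp only [map_add, hx, hy]

/-- The 2-morphism `ψ ⊗ T`. -/
def tensorMap {S S' : Sec ρ} (ψ : S ⟶ S') {V W : FdHilb} (T : V →ₗ[ℂ] W) :
    S.tensor V ⟶ S'.tensor W :=
  ⟨fun (p : FibProd S S') ↦ TensorProduct.map (Hom.app ψ p.1.1 p.1.2 p.2) T,
    fun m g g' hg hg' h t ↦ (ψ.2.1 m g g' hg hg' h t).tensorMap T,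
    fun (z₀ z₁ : S.Z) (z₀' z₁' : S'.Z) h h' h₀ h₁ e ↦ by
      have key := ψ.2.2 z₀ z₁ z₀' z₁' h h' h₀ h₁
      change S.E.fib z₀ ⊗[ℂ] V at e
      induction e using TensorProduct.induction_on with
      | zero => simp
      | tmul x y =>
        change _ ⊗ₜ _ = _ ⊗ₜ _
        exact congrArg (· ⊗ₜ[ℂ] T y) (key x)
      | add x y hx hy => simp only [map_add, hx, hy]⟩

/-- The 2-morphism `η_v : S ⟶ S ⊗ V`, `e ↦ e ⊗ v`. -/
def tensorVec (S : Sec ρ) (V : FdHilb) (v : V) : S ⟶ S.tensor V :=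
  ⟨fun (p : FibProd S S) ↦ (TensorProduct.mk ℂ (S.E.fib p.1.2) V).flip v ∘ₗ
      (S.α p.1.1 p.1.2 p.2).toLinearEquiv.toLinearMap,
    fun m g g' hg hg' h t ↦ (S.α_parallel m g g' hg hg' h t).tensorVec v,
    fun (z₀ z₁ z₀' z₁' : S.Z) h h' h₀ h₁ e ↦ by
      change _ ⊗ₜ _ = _ ⊗ₜ _
      exact congrArg (· ⊗ₜ[ℂ] v)
        ((S.α_cocycle z₀ z₀' z₁' h₀ h' e).trans (S.α_cocycle z₀ z₁ z₁' h h₁ e).symm)⟩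

end Sec

/-- An object of `Ω¹(M, 𝔲)`: a natural number `n` and a smooth 1-form `A` on `M` with values in
the skew-hermitian `n × n` matrices. -/
structure UForm (d : ℕ) (M : Type u) [TopologicalSpace M] [ChartedSpace (EuclideanSpace ℝ (Fin d)) M]
    [IsManifold (𝓡 d) ∞ M] : Type u where
  n : ℕ
  form : Matrix (Fin n) (Fin n) (∀ x : M, TangentSpace (𝓡 d) x →L[ℝ] ℂ)
  smooth : ∀ a b, ContMDiff (𝓡 d).tangent 𝓘(ℝ, ℂ) ∞
    (fun q : TangentBundle (𝓡 d) M ↦ form a b q.proj q.snd)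
  skew : ∀ a b x v, form a b x v = - (starRingEnd ℂ) (form b a x v)

namespace UForm

/-- The value of the form on a tangent vector, a matrix. -/
def mat (A : UForm d M) (x : M) (v : TangentSpace (𝓡 d) x) : Matrix (Fin A.n) (Fin A.n) ℂ :=
  A.form.map fun κ ↦ κ x v

/-- The entrywise differential of a matrix-valued function. -/
def dMat {α β : Type} (f : M → Matrix α β ℂ) (x : M) (v : TangentSpace (𝓡 d) x) : Matrix α β ℂ :=
  Matrix.of fun i j ↦ dC (fun y ↦ f y i j) x v

/-- Smoothness of a matrix-valued function. -/
def SmoothMat (d : ℕ) {M : Type u} [TopologicalSpace M] [ChartedSpace (EuclideanSpace ℝ (Fin d)) M]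
    {α β : Type} (f : M → Matrix α β ℂ) : Prop :=
  ∀ i j, ContMDiff (𝓡 d) 𝓘(ℝ, ℂ) ∞ (fun y ↦ f y i j)

theorem dMat_mul {α β γ : Type} [Fintype β] {f : M → Matrix α β ℂ} {g : M → Matrix β γ ℂ}
    (hf : SmoothMat d f) (hg : SmoothMat d g) (x : M) (v : TangentSpace (𝓡 d) x) :
    dMat (fun y ↦ f y * g y) x v = dMat f x v * g x + f x * dMat g x v := by
  ext a c
  have : (fun y ↦ (f y * g y) a c) = fun y ↦ ∑ b, f y a b * g y b c := by
    ext y; simp [Matrix.mul_apply]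
  simp only [dMat, Matrix.of_apply, Matrix.add_apply, Matrix.mul_apply]
  rw [dC_sum fun b ↦ cmMul (hf a b x) (hg b c x), ← Finset.sum_add_distrib]
  exact Finset.sum_congr rfl fun b _ ↦ dC_mul (hf a b x) (hg b c x) v

theorem SmoothMat.mul {α β γ : Type} [Fintype β] {f : M → Matrix α β ℂ} {g : M → Matrix β γ ℂ}
    (hf : SmoothMat d f) (hg : SmoothMat d g) : SmoothMat d (fun y ↦ f y * g y) := by
  intro a c x
  simp only [Matrix.mul_apply]
  exact ContMDiffAt.sum fun b _ ↦ cmMul (hf a b x) (hg b c x)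

theorem dMat_const {α β : Type} (f : Matrix α β ℂ) (x : M) (v : TangentSpace (𝓡 d) x) :
    dMat (fun _ ↦ f) x v = 0 := by
  ext i j
  simp [dMat, dC]
  rfl

theorem dMat_add {α β : Type} {f g : M → Matrix α β ℂ}
    (hf : SmoothMat d f) (hg : SmoothMat d g) (x : M) (v : TangentSpace (𝓡 d) x) :
    dMat (f + g) x v = dMat f x v + dMat g x v := by
  ext i j
  have h1 := ((hf i j x).mdifferentiableAt (by simp)).hasMFDerivAt
  have h2 := ((hg i j x).mdifferentiableAt (by simp)).hasMFDerivAt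
  exact congrArg (fun L ↦ L v) (h1.add h2).mfderiv

theorem dMat_smul {α β : Type} {f : M → Matrix α β ℂ} (r : ℂ)
    (hf : SmoothMat d f) (x : M) (v : TangentSpace (𝓡 d) x) :
    dMat (r • f) x v = r • dMat f x v := by
  ext i j
  have h := dC_mul (contMDiffAt_const (c := r)) (hf i j x) v
  have h0 : dC (fun _ : M ↦ r) x v = 0 := by simp [dC]; rfl
  rw [h0, zero_mul, zero_add] at h
  exact h

/-- The smooth matrix-valued functions `f` with `B f = f A + df`. -/
def homSubmodule (A B : UForm d M) : Submodule ℂ (M → Matrix (Fin B.n) (Fin A.n) ℂ) where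
  carrier := {f | SmoothMat d f ∧
    ∀ (x : M) (v : TangentSpace (𝓡 d) x), B.mat x v * f x = f x * A.mat x v + dMat f x v}
  add_mem' := by
    rintro f g ⟨hf, hf'⟩ ⟨hg, hg'⟩
    refine ⟨fun i j x ↦ (hf i j x).add (hg i j x), fun x v ↦ ?_⟩
    rw [dMat_add hf hg, Pi.add_apply, Matrix.mul_add, Matrix.add_mul, hf', hg']
    abel
  zero_mem' := by
    refine ⟨fun i j x ↦ contMDiffAt_const, fun x v ↦ ?_⟩
    have : dMat (0 : M → Matrix (Fin B.n) (Fin A.n) ℂ) x v = 0 := dMat_const 0 x v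
    simp [this]
  smul_mem' := by
    rintro r f ⟨hf, hf'⟩
    refine ⟨fun i j x ↦ cmMul contMDiffAt_const (hf i j x), fun x v ↦ ?_⟩
    rw [dMat_smul r hf, Pi.smul_apply, Matrix.mul_smul, hf', Matrix.smul_mul, smul_add]

/-- The morphisms of `Ω¹(M, 𝔲)`. -/
def Hom (A B : UForm d M) : Type u := homSubmodule A B

instance (A B : UForm d M) : AddCommGroup (Hom A B) :=
  inferInstanceAs (AddCommGroup (homSubmodule A B))

instance (A B : UForm d M) : Module ℂ (Hom A B) := inferInstanceAs (Module ℂ (homSubmodule A B))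

/-- The matrix-valued function underlying a morphism. -/
def Hom.fn {A B : UForm d M} (f : Hom A B) : M → Matrix (Fin B.n) (Fin A.n) ℂ := f.1

@[ext] theorem Hom.ext {A B : UForm d M} {f g : Hom A B} (h : ∀ x, f.fn x = g.fn x) : f = g :=
  Subtype.ext (funext h)

theorem smoothMat_const {α β : Type} (f : Matrix α β ℂ) : SmoothMat d (fun _ : M ↦ f) :=
  fun _ _ _ ↦ contMDiffAt_const

/-- Composition in `Ω¹(M, 𝔲)` is multiplication of matrix-valued functions. -/
instance : Category.{u} (UForm d M) where
  Hom := Hom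
  id A := ⟨fun _ ↦ 1, smoothMat_const 1, fun x v ↦ by rw [dMat_const]; simp⟩
  comp {A B C} f g := ⟨fun x ↦ g.fn x * f.fn x, g.2.1.mul f.2.1, fun x v ↦ by
    have hf := f.2.2 x v
    have hg := g.2.2 x v
    have := dMat_mul g.2.1 f.2.1 x v
    rw [Hom.fn, Hom.fn, this, ← Matrix.mul_assoc, hg, Matrix.add_mul, Matrix.mul_assoc, hf,
      Matrix.mul_add, Matrix.mul_assoc]
    abel⟩
  id_comp f := Hom.ext fun x ↦ Matrix.mul_one _
  comp_id f := Hom.ext fun x ↦ Matrix.one_mul _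
  assoc f g h := Hom.ext fun x ↦ (Matrix.mul_assoc _ _ _).symm

instance : Preadditive (UForm d M) where
  homGroup A B := inferInstanceAs (AddCommGroup (Hom A B))
  add_comp A B C f f' g := Hom.ext fun x ↦ Matrix.mul_add _ _ _
  comp_add A B C f g g' := Hom.ext fun x ↦ Matrix.add_mul _ _ _

instance : Linear ℂ (UForm d M) where
  homModule A B := inferInstanceAs (Module ℂ (Hom A B))
  smul_comp A B C r f g := Hom.ext fun x ↦ by
    change Hom.fn g x * (r • Hom.fn f x) = r • (Hom.fn g x * Hom.fn f x)
    exact Matrix.mul_smul _ _ _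
  comp_smul A B C f r g := Hom.ext fun x ↦ by
    change (r • Hom.fn g x) * Hom.fn f x = r • (Hom.fn g x * Hom.fn f x)
    exact Matrix.smul_mul _ _ _

end UForm

end Sections

section Structures

variable {d : ℕ} {M : Type u} [TopologicalSpace M] [ChartedSpace (EuclideanSpace ℝ (Fin d)) M]
  [IsManifold (𝓡 d) ∞ M]

/-- The pairing `tr(ψ* φ)` of two elements of `⟨S, S'⟩`, at a point of the fibre product. -/
def Sec.pairing {ρ : ImaginaryTwoForm d M} {S S' : Sec ρ} (ψ φ : S ⟶ S') (z : S.Z) (z' : S'.Z)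
    (h : S.ζ z = S'.ζ z') : ℂ :=
  LinearMap.trace ℂ (S.E.fib z)
    (LinearMap.adjoint (Sec.Hom.app ψ z z' h) ∘ₗ Sec.Hom.app φ z z' h)

/-- The pairing `tr(f* g)` of two elements of `⟨A, A'⟩`, at a point of `M`. -/
def UForm.pairing {A A' : UForm d M} (f g : A ⟶ A') (x : M) : ℂ :=
  Matrix.trace ((UForm.Hom.fn f x).conjTranspose * UForm.Hom.fn g x)

namespace UForm

open scoped Kronecker

theorem comp_fn {A B C : UForm d M} (f : A ⟶ B) (g : B ⟶ C) (x : M) :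
    Hom.fn (f ≫ g) x = Hom.fn g x * Hom.fn f x := rfl

theorem id_fn (A : UForm d M) (x : M) : Hom.fn (𝟙 A) x = 1 := rfl

theorem dMat_mul_const {α β γ : Type} [Fintype β] {f : M → Matrix α β ℂ} (hf : SmoothMat d f)
    (c : Matrix β γ ℂ) (x : M) (v : TangentSpace (𝓡 d) x) :
    dMat (fun y ↦ f y * c) x v = dMat f x v * c := by
  rw [dMat_mul hf (smoothMat_const c), dMat_const, Matrix.mul_zero, add_zero]

/-- The form `A ⊗ 1` on `ℂⁿ ⊗ V`, written in the orthonormal basis `e_a ⊗ V.basis c`. -/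
@[reducible] def tensor (A : UForm d M) (V : FdHilb) : UForm d M where
  n := A.n * V.dim
  form := Matrix.of fun a b ↦
    if (finProdFinEquiv.symm a).2 = (finProdFinEquiv.symm b).2 then
      A.form (finProdFinEquiv.symm a).1 (finProdFinEquiv.symm b).1 else 0
  smooth a b := by
    by_cases h : (finProdFinEquiv.symm a).2 = (finProdFinEquiv.symm b).2
    · simpa only [Matrix.of_apply, if_pos h] using A.smooth _ _
    · simp only [Matrix.of_apply, if_neg h]
      exact contMDiff_const (c := (0 : ℂ))
  skew a b x v := by
    by_cases h : (finProdFinEquiv.symm a).2 = (finProdFinEquiv.symm b).2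
    · simpa only [Matrix.of_apply, if_pos h, if_pos h.symm] using A.skew _ _ x v
    · simp only [Matrix.of_apply, if_neg h, if_neg (Ne.symm h)]
      simp

theorem tensor_mat (A : UForm d M) (V : FdHilb) (x : M) (v : TangentSpace (𝓡 d) x) :
    (A.tensor V).mat x v = (A.mat x v ⊗ₖ (1 : Matrix (Fin V.dim) (Fin V.dim) ℂ)).submatrix
      finProdFinEquiv.symm finProdFinEquiv.symm := by
  ext a b
  change (if (finProdFinEquiv.symm a).2 = (finProdFinEquiv.symm b).2 then
      A.form (finProdFinEquiv.symm a).1 (finProdFinEquiv.symm b).1 else 0) x v =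
    A.form (finProdFinEquiv.symm a).1 (finProdFinEquiv.symm b).1 x v *
      (1 : Matrix (Fin V.dim) (Fin V.dim) ℂ) (finProdFinEquiv.symm a).2 (finProdFinEquiv.symm b).2
  rw [Matrix.one_apply]
  split_ifs <;> simp

theorem kron_aux {a b p q : ℕ} (B : Matrix (Fin b) (Fin b) ℂ) (A : Matrix (Fin a) (Fin a) ℂ)
    (f f' : Matrix (Fin b) (Fin a) ℂ) (T : Matrix (Fin q) (Fin p) ℂ) (h : B * f = f * A + f') :
    (B ⊗ₖ (1 : Matrix (Fin q) (Fin q) ℂ)).submatrix finProdFinEquiv.symm finProdFinEquiv.symm *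
      (f ⊗ₖ T).submatrix finProdFinEquiv.symm finProdFinEquiv.symm =
    (f ⊗ₖ T).submatrix finProdFinEquiv.symm finProdFinEquiv.symm *
      (A ⊗ₖ (1 : Matrix (Fin p) (Fin p) ℂ)).submatrix finProdFinEquiv.symm finProdFinEquiv.symm +
      (f' ⊗ₖ T).submatrix finProdFinEquiv.symm finProdFinEquiv.symm := by
  rw [Matrix.submatrix_mul_equiv, Matrix.submatrix_mul_equiv,
    ← Matrix.mul_kronecker_mul, ← Matrix.mul_kronecker_mul, Matrix.one_mul, Matrix.mul_one, h,
    Matrix.add_kronecker]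
  rfl

/-- The matrix of `e ↦ e ⊗ v`. -/
def vecMat (n : ℕ) (V : FdHilb) (v : V) : Matrix (Fin (n * V.dim)) (Fin n) ℂ :=
  Matrix.of fun a i ↦ if (finProdFinEquiv.symm a).1 = i then
    inner ℂ (V.basis (finProdFinEquiv.symm a).2) v else 0

theorem mul_vecMat {n : ℕ} (A : Matrix (Fin n) (Fin n) ℂ) (V : FdHilb) (v : V) :
    (A ⊗ₖ (1 : Matrix (Fin V.dim) (Fin V.dim) ℂ)).submatrix finProdFinEquiv.symm
      finProdFinEquiv.symm * vecMat n V v = vecMat n V v * A := by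
  ext a i
  simp only [Matrix.mul_apply, vecMat, Matrix.of_apply]
  rw [← finProdFinEquiv.sum_comp, Fintype.sum_prod_type]
  simp [Matrix.kroneckerMap_apply, Matrix.one_apply, mul_comm]

/-- The morphism `f ⊗ T`. -/
def tensorMap {A B : UForm d M} (f : A ⟶ B) {V W : FdHilb} (T : V →ₗ[ℂ] W) :
    A.tensor V ⟶ B.tensor W :=
  ⟨fun x ↦ (Hom.fn f x ⊗ₖ FdHilb.matrix T).submatrix finProdFinEquiv.symm finProdFinEquiv.symm,
    fun i j x ↦ cmMul (f.2.1 _ _ x) contMDiffAt_const, fun x v ↦ by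
      have h1 := f.2.2 x v
      have h2 : dMat (fun x ↦ (Hom.fn f x ⊗ₖ FdHilb.matrix T).submatrix finProdFinEquiv.symm
          finProdFinEquiv.symm) x v = (dMat (Hom.fn f) x v ⊗ₖ FdHilb.matrix T).submatrix
          finProdFinEquiv.symm finProdFinEquiv.symm := by
        ext a b
        have h := dC_mul (f.2.1 (finProdFinEquiv.symm a).1 (finProdFinEquiv.symm b).1 x)
          (contMDiffAt_const (c := FdHilb.matrix T (finProdFinEquiv.symm a).2
            (finProdFinEquiv.symm b).2)) v
        have h0 : dC (fun _ : M ↦ FdHilb.matrix T (finProdFinEquiv.symm a).2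
            (finProdFinEquiv.symm b).2) x v = 0 := by simp [dC]; rfl
        rw [h0, mul_zero, add_zero] at h
        exact h
      rw [tensor_mat, tensor_mat]
      refine Eq.trans ?_ (congrArg (_ + ·) h2.symm)
      exact kron_aux _ _ _ _ _ h1⟩

/-- The morphism `η_v : A ⟶ A ⊗ V`, `e ↦ e ⊗ v`. -/
def tensorVec (A : UForm d M) (V : FdHilb) (v : V) : A ⟶ A.tensor V :=
  ⟨fun _ ↦ vecMat A.n V v, smoothMat_const _, fun x w ↦ by
    rw [dMat_const, add_zero, tensor_mat]
    exact mul_vecMat _ _ _⟩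

/-- The zero form of rank zero. -/
def zeroForm (d : ℕ) (M : Type u) [TopologicalSpace M]
    [ChartedSpace (EuclideanSpace ℝ (Fin d)) M] [IsManifold (𝓡 d) ∞ M] : UForm d M where
  n := 0
  form := 0
  smooth a := a.elim0
  skew a := a.elim0

/-- The block sum of two forms. -/
@[reducible] def sum (A B : UForm d M) : UForm d M where
  n := A.n + B.n
  form := (Matrix.fromBlocks A.form 0 0 B.form).submatrix finSumFinEquiv.symm finSumFinEquiv.symm
  smooth a b := by
    rcases ha : finSumFinEquiv.symm a with a' | a' <;>
    rcases hb : finSumFinEquiv.symm b with b' | b' <;>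
    simp only [Matrix.submatrix_apply, ha, hb]
    · exact A.smooth a' b'
    · exact contMDiff_const (c := (0 : ℂ))
    · exact contMDiff_const (c := (0 : ℂ))
    · exact B.smooth a' b'
  skew a b x v := by
    rcases ha : finSumFinEquiv.symm a with a' | a' <;>
    rcases hb : finSumFinEquiv.symm b with b' | b' <;>
    simp only [Matrix.submatrix_apply, ha, hb]
    · exact A.skew a' b' x v
    · simp
    · simp
    · exact B.skew a' b' x v

theorem sum_mat (A B : UForm d M) (x : M) (v : TangentSpace (𝓡 d) x) :
    (A.sum B).mat x v = (Matrix.fromBlocks (A.mat x v) 0 0 (B.mat x v)).submatrix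
      finSumFinEquiv.symm finSumFinEquiv.symm := by
  ext a b
  change (Matrix.fromBlocks A.form 0 0 B.form (finSumFinEquiv.symm a) (finSumFinEquiv.symm b)) x v
    = Matrix.fromBlocks (A.mat x v) 0 0 (B.mat x v) (finSumFinEquiv.symm a) (finSumFinEquiv.symm b)
  rcases finSumFinEquiv.symm a with a' | a' <;> rcases finSumFinEquiv.symm b with b' | b' <;> rfl

section Block

variable {n n' : ℕ} (P : Matrix (Fin n) (Fin n) ℂ) (Q : Matrix (Fin n') (Fin n') ℂ)

/-- The inclusion of the first block. -/
def blockInl (n n' : ℕ) : Matrix (Fin (n + n')) (Fin n) ℂ :=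
  (Matrix.fromRows 1 0).submatrix finSumFinEquiv.symm _root_.id

/-- The inclusion of the second block. -/
def blockInr (n n' : ℕ) : Matrix (Fin (n + n')) (Fin n') ℂ :=
  (Matrix.fromRows 0 1).submatrix finSumFinEquiv.symm _root_.id

/-- The projection to the first block. -/
def blockFst (n n' : ℕ) : Matrix (Fin n) (Fin (n + n')) ℂ :=
  (Matrix.fromCols 1 0).submatrix _root_.id finSumFinEquiv.symm

/-- The projection to the second block. -/
def blockSnd (n n' : ℕ) : Matrix (Fin n') (Fin (n + n')) ℂ :=
  (Matrix.fromCols 0 1).submatrix _root_.id finSumFinEquiv.symm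

/-- The block diagonal matrix. -/
def block : Matrix (Fin (n + n')) (Fin (n + n')) ℂ :=
  (Matrix.fromBlocks P 0 0 Q).submatrix finSumFinEquiv.symm finSumFinEquiv.symm

theorem block_mul_inl : block P Q * blockInl n n' = blockInl n n' * P := by
  change _ = ((Matrix.fromRows 1 0 : Matrix (Fin n ⊕ Fin n') (Fin n) ℂ) * P).submatrix _ _
  rw [block, blockInl, Matrix.submatrix_mul_equiv, Matrix.fromBlocks_mul_fromRows,
    Matrix.fromRows_mul]
  simp
  rfl

theorem block_mul_inr : block P Q * blockInr n n' = blockInr n n' * Q := by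
  change _ = ((Matrix.fromRows 0 1 : Matrix (Fin n ⊕ Fin n') (Fin n') ℂ) * Q).submatrix _ _
  rw [block, blockInr, Matrix.submatrix_mul_equiv, Matrix.fromBlocks_mul_fromRows,
    Matrix.fromRows_mul]
  simp
  rfl

theorem mul_fst : P * blockFst n n' = blockFst n n' * block P Q := by
  change (P * (Matrix.fromCols 1 0 : Matrix (Fin n) (Fin n ⊕ Fin n') ℂ)).submatrix _ _ = _
  rw [block, blockFst, Matrix.submatrix_mul_equiv, Matrix.fromCols_mul_fromBlocks,
    Matrix.mul_fromCols]
  simp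
  rfl

theorem mul_snd : Q * blockSnd n n' = blockSnd n n' * block P Q := by
  change (Q * (Matrix.fromCols 0 1 : Matrix (Fin n') (Fin n ⊕ Fin n') ℂ)).submatrix _ _ = _
  rw [block, blockSnd, Matrix.submatrix_mul_equiv, Matrix.fromCols_mul_fromBlocks,
    Matrix.mul_fromCols]
  simp
  rfl

theorem fst_mul_inl : blockFst n n' * blockInl n n' = 1 := by
  rw [blockFst, blockInl, Matrix.submatrix_mul_equiv, Matrix.fromCols_mul_fromRows]
  simp

theorem snd_mul_inr : blockSnd n n' * blockInr n n' = 1 := by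
  rw [blockSnd, blockInr, Matrix.submatrix_mul_equiv, Matrix.fromCols_mul_fromRows]
  simp

theorem snd_mul_inl : blockSnd n n' * blockInl n n' = 0 := by
  rw [blockSnd, blockInl, Matrix.submatrix_mul_equiv, Matrix.fromCols_mul_fromRows]
  simp

theorem fst_mul_inr : blockFst n n' * blockInr n n' = 0 := by
  rw [blockFst, blockInr, Matrix.submatrix_mul_equiv, Matrix.fromCols_mul_fromRows]
  simp

end Block

/-- A constant matrix intertwining two forms is a morphism between them. -/
def constHom {A B : UForm d M} (c : Matrix (Fin B.n) (Fin A.n) ℂ)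
    (h : ∀ x (v : TangentSpace (𝓡 d) x), B.mat x v * c = c * A.mat x v) : A ⟶ B :=
  ⟨fun _ ↦ c, smoothMat_const c, fun x v ↦ by rw [dMat_const, add_zero]; exact h x v⟩

/-- The block sum with its block inclusions and projections. -/
def sumBicone (A B : UForm d M) : Limits.BinaryBicone A B where
  pt := A.sum B
  fst := constHom (blockFst A.n B.n) fun x v ↦ by rw [sum_mat]; exact mul_fst _ _
  snd := constHom (blockSnd A.n B.n) fun x v ↦ by rw [sum_mat]; exact mul_snd _ _
  inl := constHom (blockInl A.n B.n) fun x v ↦ by rw [sum_mat]; exact block_mul_inl _ _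
  inr := constHom (blockInr A.n B.n) fun x v ↦ by rw [sum_mat]; exact block_mul_inr _ _
  inl_fst := Hom.ext fun x ↦ fst_mul_inl
  inl_snd := Hom.ext fun x ↦ snd_mul_inl
  inr_fst := Hom.ext fun x ↦ fst_mul_inr
  inr_snd := Hom.ext fun x ↦ snd_mul_inr

end UForm

namespace UForm

/-- The trivial hermitian bundle `M × ℂⁿ` with the connection `d - A`. -/
@[reducible] def bundle (A : UForm d M) : HermBundle d M where
  fib _ := EuclideanSpace ℂ (Fin A.n)
  ι := PUnit
  idx _ := Fin A.n
  dom _ := Set.univ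
  isOpen_dom _ := isOpen_univ
  cover _ := ⟨PUnit.unit, trivial⟩
  frame _ _ a := EuclideanSpace.single a 1
  orthonormal _ _ _ := EuclideanSpace.orthonormal_single
  span _ _ _ := by
    have := (EuclideanSpace.basisFun (Fin A.n) ℂ).toBasis.span_eq
    rw [← this]
    refine Submodule.span_mono ?_
    rintro _ ⟨a, rfl⟩
    exact ⟨a, by simp⟩
  smooth_transition _ _ _ _ _ _ := contMDiffAt_const
  form _ a b x := - A.form a b x
  smooth_form _ a b p _ := (A.smooth a b p).neg
  skew _ a b x _ v := by
    have := A.skew a b x v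
    simp [this]
  gauge i j a b x _ v := by
    have h0 : ∀ c : ℂ, dC (fun _ : M ↦ c) x v = 0 := fun c ↦ by simp [dC]; rfl
    rw [h0]
    simp [EuclideanSpace.inner_single_left, PiLp.single_apply]

theorem toEuclideanLin_coeff {p q : ℕ} (f : Matrix (Fin p) (Fin q) ℂ) (b : Fin p) (a : Fin q) :
    inner ℂ (EuclideanSpace.single b (1 : ℂ))
      (Matrix.toEuclideanLin f (EuclideanSpace.single a 1)) = f b a := by
  simp [EuclideanSpace.inner_single_left, Matrix.toEuclideanLin]

theorem isParallelAt {A B : UForm d M} (f : A ⟶ B) {m : ℕ} {g g' : EuclideanSpace ℝ (Fin m) → M}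
    (hg : ContMDiff 𝓘(ℝ, EuclideanSpace ℝ (Fin m)) (𝓡 d) ∞ g) (h : g = g')
    (t : EuclideanSpace ℝ (Fin m)) :
    IsParallelAt A.bundle B.bundle g g' (fun s ↦ Matrix.toEuclideanLin (Hom.fn f (g s))) t := by
  subst h
  intro i j _ _
  have key : coeff A.bundle B.bundle g g (fun s ↦ Matrix.toEuclideanLin (Hom.fn f (g s))) i j =
      fun s ↦ Hom.fn f (g s) := by
    ext s b a
    exact toEuclideanLin_coeff _ b a
  rw [key]
  have hs : ∀ b a, ContMDiff 𝓘(ℝ, EuclideanSpace ℝ (Fin m)) 𝓘(ℝ, ℂ) ∞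
      (fun s ↦ Hom.fn f (g s) b a) := fun b a ↦ (f.2.1 b a).comp hg
  refine ⟨fun b a ↦ (hs b a t).contDiffAt, fun v ↦ ?_⟩
  set w := mfderiv 𝓘(ℝ, EuclideanSpace ℝ (Fin m)) (𝓡 d) g t v with hw
  have hd : matDeriv (fun s ↦ Hom.fn f (g s)) t v = dMat (Hom.fn f) (g t) w := by
    ext b a
    have h1 := (((f.2.1 b a) (g t)).mdifferentiableAt (by simp))
    have h2 := (hg t).mdifferentiableAt (by simp)
    have h3 := mfderiv_comp t h1 h2
    have h4 := congrArg (fun L ↦ L v) h3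
    rw [mfderiv_eq_fderiv] at h4
    exact h4
  have hA : pullForm A.bundle g i t v = - A.mat (g t) w := rfl
  have hB : pullForm B.bundle g j t v = - B.mat (g t) w := rfl
  have h1 := f.2.2 (g t) w
  have h2 : dMat (Hom.fn f) (g t) w + (- B.mat (g t) w) * Hom.fn f (g t) =
      Hom.fn f (g t) * (- A.mat (g t) w) := by
    have h3 : B.mat (g t) w * Hom.fn f (g t) =
      Hom.fn f (g t) * A.mat (g t) w + dMat (Hom.fn f) (g t) w := h1
    rw [Matrix.neg_mul, Matrix.mul_neg, h3]
    abel
  rw [← hd, ← hA, ← hB] at h2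
  exact h2

end UForm

variable [T2Space M] [SecondCountableTopology M]

/-- The section of the trivial gerbe given by the identity cover of `M` and the trivial bundle
with connection `d - A`. -/
@[reducible] def connObj (ρ : ImaginaryTwoForm d M) (A : UForm d M) : Sec ρ where
  k := d
  Z := M
  ζ := fun x ↦ x
  submersion := Manifold.IsSubmersion.id
  surjective := Function.surjective_id
  E := A.bundle
  α _ _ _ := LinearIsometryEquiv.refl ℂ (EuclideanSpace ℂ (Fin A.n))
  α_parallel m g₀ g₁ h₀ _ h t := by
    have := UForm.isParallelAt (𝟙 A) h₀ (funext h) t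
    simpa [UForm.id_fn] using this
  α_cocycle _ _ _ _ _ _ := rfl

/-- The 2-morphism which is, on the fibre over `x`, multiplication by the matrix `f x`. -/
def connMap (ρ : ImaginaryTwoForm d M) {A B : UForm d M} (f : A ⟶ B) :
    connObj ρ A ⟶ connObj ρ B :=
  ⟨fun p ↦ Matrix.toEuclideanLin (UForm.Hom.fn f p.1.1),
    fun m g g' hg hg' h t ↦ UForm.isParallelAt f hg (funext h) t,
    fun z₀ z₁ z₀' z₁' h h' h₀ h₁ e ↦ by
      have h : z₀ = z₁ := h
      subst h
      rfl⟩

/-- The functor sending a `𝔲(n)`-valued form `A` to the trivial bundle with connection `d - A`. -/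
def conn (ρ : ImaginaryTwoForm d M) : UForm d M ⥤ Sec ρ where
  obj := connObj ρ
  map := connMap ρ
  map_id A := by
    apply Sec.Hom.ext
    intro z z' h e
    change Matrix.toEuclideanLin (1 : Matrix (Fin A.n) (Fin A.n) ℂ) e = e
    simp
  map_comp {A B C} f g := by
    apply Sec.Hom.ext
    intro z z' h e
    refine Eq.trans ?_ (Sec.comp_app (connMap ρ f) (connMap ρ g) h z rfl e).symm
    change Matrix.toEuclideanLin (UForm.Hom.fn g z * UForm.Hom.fn f z) e =
      Matrix.toEuclideanLin (UForm.Hom.fn g z) (Matrix.toEuclideanLin (UForm.Hom.fn f z) e)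
    simp [Matrix.toEuclideanLin]

instance (ρ : ImaginaryTwoForm d M) : (conn ρ).Additive where
  map_add {A B f g} := by
    apply Sec.Hom.ext
    intro z z' h e
    exact congrArg (fun L ↦ L e) (map_add Matrix.toEuclideanLin (UForm.Hom.fn f z) (UForm.Hom.fn g z))

instance (ρ : ImaginaryTwoForm d M) : (conn ρ).Linear ℂ where
  map_smul {A B} f r := by
    apply Sec.Hom.ext
    intro z z' h e
    exact congrArg (fun L ↦ L e) (map_smul Matrix.toEuclideanLin r (UForm.Hom.fn f z))

end Structures

end GerbeSections

end

open GerbeSections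

noncomputable section

namespace GerbeSections

/-! ### Smooth frames over a contractible manifold -/

section Trivialization

open Topology Set Filter

variable {d : ℕ} {M : Type u} [TopologicalSpace M] [ChartedSpace (EuclideanSpace ℝ (Fin d)) M]
  [IsManifold (𝓡 d) ∞ M]
  {L : Type*} [NormedRing L] [NormedAlgebra ℝ L]

/-! A section of a trivial gerbe is descent data for a hermitian bundle with connection on `M`: the
unitary parallel `α` identifies all fibres of `E` over one point of `M`, so metric and connection
descend. Over a contractible `M` the descended bundle has a global unitary frame, in which the
connection is `d - A` with `A` skew-hermitian. This gives essential surjectivity (`exists_frame`,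
`GlobalFrame.uform`, `GlobalFrame.iso`). Full faithfulness is nearly tautological: for identity
covers the fibre product is the diagonal, so a 2-morphism is a matrix-valued function, and being
parallel from `d - A` to `d - A'` means `df - A' f = -f A`.

The analytic core is the frame (`LocalFrames.exists_smooth_frame`). The descended bundle is treated
as a mere family of vector spaces with local frames whose transition functions are smooth. A
partition of unity gives a kernel `N y x` from the fibre at `x` to the fibre at `y`, equal to the
identity on the diagonal and hence invertible near it. Products of kernels along small steps of a
contraction carry a frame at the base point to every other point; this yields a continuous frame.
Averaging makes it smooth, and Gram–Schmidt makes it unitary.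

For the Hilbert space structure, let `f, g : A ⟶ A'`. Then `f* g` is an endomorphism of `A`, so its
differential is a commutator with `A` and has trace zero; hence `tr(f* g)` is constant
(`UForm.pairing_const`). A morphism is therefore determined by its value at one point, which gives
finite dimension and definiteness. Unitary global frames carry all of this over to sections
(`GlobalFrame.pairing_eq`). Biproducts survive because the functor is additive, and the actions of
`V` are compared by the constant unitary map that reindexes the basis of `ℂⁿ ⊗ V`. -/

theorem contMDiffAt_mul_normedRing {f g : M → L} {x : M}
    (hf : ContMDiffAt (𝓡 d) 𝓘(ℝ, L) ∞ f x) (hg : ContMDiffAt (𝓡 d) 𝓘(ℝ, L) ∞ g x) :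
    ContMDiffAt (𝓡 d) 𝓘(ℝ, L) ∞ (fun y ↦ f y * g y) x :=
  (contDiff_mul (𝕜 := ℝ) (𝔸 := L)).contMDiff.contMDiffAt.comp x (hf.prodMk_space hg)

/-- Smooth local coordinates for a family of modules over `M` whose fibres are all identified with a
fixed one, without any continuity of these identifications: `toFrame p x` is the passage from the
fixed model to the `p`-th local frame and `ofFrame p x` is its inverse. -/
structure LocalFrames (d : ℕ) (M : Type u) [TopologicalSpace M]
    [ChartedSpace (EuclideanSpace ℝ (Fin d)) M] (L : Type*) [NormedRing L] [NormedAlgebra ℝ L] where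
  ι : Type u
  dom : ι → Set M
  isOpen_dom : ∀ p, IsOpen (dom p)
  cover : ∀ x, ∃ p, x ∈ dom p
  toFrame : ι → M → L
  ofFrame : ι → M → L
  toFrame_mul_ofFrame : ∀ p, ∀ x ∈ dom p, toFrame p x * ofFrame p x = 1
  ofFrame_mul_toFrame : ∀ p, ∀ x ∈ dom p, ofFrame p x * toFrame p x = 1
  smooth : ∀ p q, ∀ x ∈ dom p ∩ dom q,
    ContMDiffAt (𝓡 d) 𝓘(ℝ, L) ∞ (fun y ↦ toFrame p y * ofFrame q y) x

namespace LocalFrames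

variable (F : LocalFrames d M L)

theorem isUnit_toFrame {p : F.ι} {x : M} (hx : x ∈ F.dom p) : IsUnit (F.toFrame p x) :=
  ⟨⟨_, _, F.toFrame_mul_ofFrame p x hx, F.ofFrame_mul_toFrame p x hx⟩, rfl⟩

theorem isUnit_ofFrame {p : F.ι} {x : M} (hx : x ∈ F.dom p) : IsUnit (F.ofFrame p x) :=
  ⟨⟨_, _, F.ofFrame_mul_toFrame p x hx, F.toFrame_mul_ofFrame p x hx⟩, rfl⟩

theorem dom_mem_nhds {p : F.ι} {x : M} (hx : x ∈ F.dom p) : F.dom p ∈ 𝓝 x :=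
  (F.isOpen_dom p).mem_nhds hx

/-- A family of maps between the fibres which is the identity on the diagonal, jointly continuous,
and smooth in the target variable. -/
structure IsKernel (N : M → M → L) : Prop where
  diag : ∀ x, N x x = 1
  continuousAt : ∀ p q, ∀ y ∈ F.dom p, ∀ x ∈ F.dom q,
    ContinuousAt (fun z : M × M ↦ F.toFrame p z.1 * N z.1 z.2 * F.ofFrame q z.2) (y, x)
  smooth : ∀ p x, ∀ y ∈ F.dom p,
    ContMDiffAt (𝓡 d) 𝓘(ℝ, L) ∞ (fun y ↦ F.toFrame p y * N y x) y

/-- The kernel goes from `x` to `y` through each local frame `i`, with weight `ρ i y * ρ i x`, so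
that a frame counts only when both points lie in its domain. On the diagonal the sum is `∑ (ρ i
x)²`, which is positive and is divided out. -/
theorem exists_isKernel [T2Space M] [SigmaCompactSpace M] : ∃ N, F.IsKernel N := by
  obtain ⟨ρ, hρ⟩ := SmoothPartitionOfUnity.exists_isSubordinate (𝓡 d) (s := (univ : Set M))
    isClosed_univ F.dom F.isOpen_dom fun x _ ↦ mem_iUnion.2 (F.cover x)
  set c : M → ℝ := fun x ↦ ∑ᶠ i, ρ i x • ρ i x with hc
  have hcs : ContMDiff (𝓡 d) 𝓘(ℝ, ℝ) ∞ c :=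
    ρ.contMDiff_finsum_smul fun i x _ ↦ (ρ i).contMDiff x
  have hsum : ∀ y x : M, ∀ I : Finset F.ι, ρ.finsupport y ⊆ I →
      (∑ᶠ i, ρ i y • ρ i x • (F.ofFrame i y * F.toFrame i x)) =
        ∑ i ∈ I, ρ i y • ρ i x • (F.ofFrame i y * F.toFrame i x) := by
    intro y x I hI
    refine finsum_eq_sum_of_support_subset _ fun i hi ↦ hI ?_
    rw [ρ.mem_finsupport]
    intro h0
    exact hi (by simp [h0])
  have hcpos : ∀ x, 0 < c x := by
    intro x
    obtain ⟨i, hi⟩ := ρ.exists_pos_of_mem (mem_univ x)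
    refine finsum_pos (fun i ↦ mul_self_nonneg _) ⟨i, mul_pos hi hi⟩ ?_
    exact (ρ.locallyFinite.point_finite x).subset fun j hj h0 ↦ hj (by simp [h0])
  set K : M → M → L := fun y x ↦ ∑ᶠ i, ρ i y • ρ i x • (F.ofFrame i y * F.toFrame i x) with hK
  have hKdiag : ∀ x, K x x = c x • 1 := by
    intro x
    rw [hc, finsum_smul]
    · refine finsum_congr fun i ↦ ?_
      by_cases hi : x ∈ F.dom i
      · rw [F.ofFrame_mul_toFrame i x hi, smul_assoc]
      · have : ρ i x = 0 := by
          by_contra h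
          exact hi (hρ i (subset_tsupport _ h))
        simp [this]
  -- The transition function is smooth only where the two domains overlap; near any point outside
  -- the support of `ρ i` the product is zero.
  have hleft : ∀ p i, ∀ y ∈ F.dom p, ContMDiffAt (𝓡 d) 𝓘(ℝ, L) ∞
      (fun y ↦ ρ i y • (F.toFrame p y * F.ofFrame i y)) y := by
    intro p i y hy
    by_cases hi : y ∈ tsupport (ρ i)
    · exact (ρ i).contMDiff.contMDiffAt.smul (F.smooth p i y ⟨hy, hρ i hi⟩)
    · exact contMDiffAt_of_notMem (fun h ↦ hi (tsupport_smul_subset_left (ρ i) _ h)) _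
  have hright : ∀ q i, ∀ y ∈ F.dom q, ContMDiffAt (𝓡 d) 𝓘(ℝ, L) ∞
      (fun y ↦ ρ i y • (F.toFrame i y * F.ofFrame q y)) y := by
    intro p i y hy
    by_cases hi : y ∈ tsupport (ρ i)
    · exact (ρ i).contMDiff.contMDiffAt.smul (F.smooth i p y ⟨hρ i hi, hy⟩)
    · exact contMDiffAt_of_notMem (fun h ↦ hi (tsupport_smul_subset_left (ρ i) _ h)) _
  refine ⟨fun y x ↦ (c x)⁻¹ • K y x, fun x ↦ ?_, fun p q y hy x hx ↦ ?_, fun p x y hy ↦ ?_⟩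
  · rw [hKdiag, smul_smul, inv_mul_cancel₀ (hcpos x).ne', one_smul]
  · have h1 : ContinuousAt (fun z : M × M ↦ (c z.2)⁻¹ • ∑ i ∈ ρ.fintsupport y,
        (ρ i z.1 • (F.toFrame p z.1 * F.ofFrame i z.1)) *
          (ρ i z.2 • (F.toFrame i z.2 * F.ofFrame q z.2))) (y, x) := by
      have h2 : ContinuousAt (fun z : M × M ↦ (c z.2)⁻¹) (y, x) :=
        ((hcs.continuous.comp continuous_snd).continuousAt).inv₀ (hcpos x).ne'
      refine h2.smul (tendsto_finsetSum _ fun i _ ↦ ContinuousAt.mul ?_ ?_)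
      · exact ContinuousAt.comp (f := Prod.fst) (x := (y, x)) (hleft p i y hy).continuousAt
          continuousAt_fst
      · exact ContinuousAt.comp (f := Prod.snd) (x := (y, x)) (hright q i x hx).continuousAt
          continuousAt_snd
    refine h1.congr ?_
    filter_upwards [(continuousAt_fst (p := (y, x))).eventually (ρ.eventually_finsupport_subset y)]
      with z hz
    rw [hK]
    simp only [hsum _ _ _ hz, Finset.mul_sum, Finset.sum_mul, mul_smul_comm, smul_mul_assoc,
      mul_assoc]
    simp only [Finset.smul_sum, smul_smul]
    refine Finset.sum_congr rfl fun i _ ↦ ?_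
    ring_nf
  -- With `x` fixed, `toFrame i x` is a constant, so its possibly irregular dependence on `x` does
  -- no harm.
  · have h1 : ContMDiffAt (𝓡 d) 𝓘(ℝ, L) ∞ (fun y' ↦ ∑ i ∈ ρ.fintsupport y,
        (ρ i y' • (F.toFrame p y' * F.ofFrame i y')) *
          ((c x)⁻¹ • ρ i x • F.toFrame i x)) y :=
      ContMDiffAt.sum fun i _ ↦ contMDiffAt_mul_normedRing (hleft p i y hy) contMDiffAt_const
    refine h1.congr_of_eventuallyEq ?_
    filter_upwards [ρ.eventually_finsupport_subset y] with z hz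
    rw [hK]
    simp only [hsum _ _ _ hz, Finset.mul_sum, mul_smul_comm, smul_mul_assoc, mul_assoc]
    simp only [Finset.smul_sum]
    refine Finset.sum_congr rfl fun i _ ↦ ?_
    simp only [smul_smul]
    ring_nf

section Transport

variable {F} {N : M → M → L}

/-- Continuity of a family of frames along a map into `M`. -/
def ContAlong (F : LocalFrames d M L) {X : Type*} [TopologicalSpace X] (γ : X → M) (T : X → L)
    (x : X) : Prop :=
  ∀ p, γ x ∈ F.dom p → ContinuousAt (fun y ↦ F.toFrame p (γ y) * T y) x

theorem ContAlong.congr {X : Type*} [TopologicalSpace X] {γ γ' : X → M} {T T' : X → L} {x : X}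
    (h : F.ContAlong γ T x) (hγ : γ =ᶠ[𝓝 x] γ') (hT : T =ᶠ[𝓝 x] T') : F.ContAlong γ' T' x := by
  intro p hp
  refine (h p (hγ.eq_of_nhds ▸ hp)).congr ?_
  filter_upwards [hγ, hT] with y h1 h2
  rw [h1, h2]

/-- Inserting `ofFrame q * toFrame q = 1` between the kernel and `T` writes the product as two
factors that are continuous in local frames. -/
theorem IsKernel.contAlong (hN : F.IsKernel N) {X : Type*} [TopologicalSpace X] {γ γ' : X → M}
    {T : X → L} {x : X} (hγ : ContinuousAt γ x) (hγ' : ContinuousAt γ' x)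
    (h : F.ContAlong γ T x) : F.ContAlong γ' (fun y ↦ N (γ' y) (γ y) * T y) x := by
  intro p hp
  obtain ⟨q, hq⟩ := F.cover (γ x)
  have h1 : ContinuousAt (fun y ↦ F.toFrame p (γ' y) * N (γ' y) (γ y) * F.ofFrame q (γ y)) x :=
    ContinuousAt.comp (f := fun y ↦ (γ' y, γ y)) (hN.continuousAt p q _ hp _ hq) (hγ'.prodMk hγ)
  refine (h1.mul (h q hq)).congr ?_
  filter_upwards [hγ (F.dom_mem_nhds hq)] with y hy
  simp only [Pi.mul_apply, mul_assoc]
  rw [← mul_assoc (F.ofFrame q (γ y)), F.ofFrame_mul_toFrame q _ hy, one_mul]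

variable [CompleteSpace L]

/-- In a local frame the kernel is continuous with value `1` at `(x, x)`, and the units of a
complete normed ring form an open set. -/
theorem IsKernel.eventually_isUnit (hN : F.IsKernel N) (x : M) :
    ∀ᶠ z in 𝓝 (x, x), IsUnit (N z.1 z.2) := by
  obtain ⟨p, hp⟩ := F.cover x
  have h1 := hN.continuousAt p p x hp x hp
  have h2 : IsUnit (F.toFrame p x * N x x * F.ofFrame p x) := by
    rw [hN.diag, mul_one, F.toFrame_mul_ofFrame p x hp]
    exact isUnit_one
  have h3 := h1.eventually (Units.isOpen.mem_nhds h2)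
  have h4 : ∀ᶠ z : M × M in 𝓝 (x, x), z.1 ∈ F.dom p ∧ z.2 ∈ F.dom p :=
    prod_mem_nhds (F.dom_mem_nhds hp) (F.dom_mem_nhds hp)
  filter_upwards [h3, h4] with z hz hz'
  have h5 : N z.1 z.2 = F.ofFrame p z.1 * (F.toFrame p z.1 * N z.1 z.2 * F.ofFrame p z.2) *
      F.toFrame p z.2 := by
    simp only [mul_assoc]
    rw [F.ofFrame_mul_toFrame p _ hz'.2, mul_one, ← mul_assoc, F.ofFrame_mul_toFrame p _ hz'.1,
      one_mul]
  rw [h5]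
  exact ((F.isUnit_ofFrame hz'.1).mul hz).mul (F.isUnit_toFrame hz'.2)

/-- Over a contractible manifold a family of fibres with smooth local frames has a global continuous
frame. -/
theorem exists_contAlong [T2Space M] [SigmaCompactSpace M] [ContractibleSpace M]
    (hN : F.IsKernel N) : ∃ T : M → L, (∀ x, IsUnit (T x)) ∧ ∀ x, F.ContAlong _root_.id T x := by
  obtain ⟨x₀, ⟨H₀⟩⟩ := id_nullhomotopic M
  -- The contraction is reversed, so that it starts at `x₀` and ends at `x`, and time is clamped to
  -- `[0, 1]`, so that a step beyond time `1` is harmless.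
  let H : M → ℝ → M := fun x t ↦ H₀.symm (projIcc (0 : ℝ) 1 zero_le_one t, x)
  have hH : Continuous fun z : M × ℝ ↦ H z.1 z.2 := by
    refine (map_continuous H₀.symm).comp ?_
    exact (continuous_projIcc.comp continuous_snd).prodMk continuous_fst
  have hH0 : ∀ x, H x 0 = x₀ := fun x ↦ by
    simp only [H, projIcc_left]
    exact H₀.symm.apply_zero x
  have hH1 : ∀ x, H x 1 = x := fun x ↦ by
    simp only [H, projIcc_right]
    exact H₀.symm.apply_one x
  -- Admissible step lengths along the path to `x`. A smaller positive step is again admissible, so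
  -- the set is convex, and locally constant choices glue to one function `δ`.
  let good : M → Set ℝ := fun x ↦ {ε | 0 < ε ∧ ∀ r ∈ Icc 0 ε, ∀ s ∈ Icc (0 : ℝ) 1,
    IsUnit (N (H x (s + r)) (H x s))}
  have hgood : ∀ x, Convex ℝ (good x) := by
    intro x
    refine OrdConnected.convex ⟨fun a ha b hb c hc ↦ ⟨ha.1.trans_le hc.1, fun r hr ↦ ?_⟩⟩
    exact hb.2 r ⟨hr.1, hr.2.trans hc.2⟩
  obtain ⟨δ, hδ⟩ := exists_contMDiffMap_forall_mem_convex_of_local_const (n := ⊤) (𝓡 d) hgood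
    fun x ↦ by
      -- Compactness of the time interval makes invertibility near the diagonal uniform in `s`.
      have h1 : ∀ᶠ z : M × ℝ in 𝓝 (x, 0), ∀ s ∈ Icc (0 : ℝ) 1,
          IsUnit (N (H z.1 (s + z.2)) (H z.1 s)) := by
        refine isCompact_Icc.eventually_forall_of_forall_eventually fun s _ ↦ ?_
        have hc : Continuous fun w : (M × ℝ) × ℝ ↦ (H w.1.1 (w.2 + w.1.2), H w.1.1 w.2) :=
          (hH.comp (by fun_prop : Continuous fun w : (M × ℝ) × ℝ ↦ (w.1.1, w.2 + w.1.2))).prodMk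
            (hH.comp (by fun_prop : Continuous fun w : (M × ℝ) × ℝ ↦ (w.1.1, w.2)))
        have h2 := hc.tendsto ((x, 0), s)
        simp only [add_zero] at h2
        exact h2.eventually (hN.eventually_isUnit (H x s))
      rw [nhds_prod_eq] at h1
      obtain ⟨P, hP, Q, hQ, hPQ⟩ := eventually_prod_iff.1 h1
      obtain ⟨ε, hε, hb⟩ := Metric.eventually_nhds_iff.1 hQ
      refine ⟨ε / 2, hP.mono fun y hy ↦ ⟨by positivity, fun r hr s hs ↦ ?_⟩⟩
      refine hPQ hy (hb ?_) s hs
      rw [Real.dist_eq, sub_zero, abs_of_nonneg hr.1]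
      linarith [hr.2]
  have hδc : Continuous δ := δ.contMDiff.continuous
  have hδpos : ∀ x, 0 < δ x := fun x ↦ (hδ x).1
  let τ : ℕ → M → ℝ := fun k x ↦ min 1 (k * δ x)
  have hτc : ∀ k, Continuous (τ k) := fun k ↦ by fun_prop
  have hτ0 : ∀ k x, τ k x ∈ Icc (0 : ℝ) 1 := fun k x ↦
    ⟨le_min zero_le_one (mul_nonneg (Nat.cast_nonneg k) (hδpos x).le), min_le_left _ _⟩
  let γ : ℕ → M → M := fun k x ↦ H x (τ k x)
  have hγc : ∀ k, Continuous (γ k) := fun k ↦ hH.comp (continuous_id.prodMk (hτc k))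
  -- Discrete transport: the frame at `x₀` is pushed by kernels along the contraction, in steps of
  -- length at most `δ x`.
  let T : ℕ → M → L := fun k ↦ Nat.rec (fun _ ↦ 1) (fun k T x ↦ N (γ (k + 1) x) (γ k x) * T x) k
  have hTs : ∀ k x, T (k + 1) x = N (γ (k + 1) x) (γ k x) * T k x := fun k x ↦ rfl
  have hTu : ∀ k x, IsUnit (T k x) := by
    intro k x
    induction k with
    | zero => exact isUnit_one
    | succ k ih =>
      rw [hTs]
      refine IsUnit.mul ?_ ih
      have h1 := (hδ x).2 (τ (k + 1) x - τ k x) ⟨?_, ?_⟩ (τ k x) (hτ0 k x)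
      · rwa [add_sub_cancel] at h1
      · have := hδpos x
        simp only [τ, sub_nonneg]
        push_cast
        gcongr
        linarith
      · have := hδpos x
        simp only [τ]
        push_cast
        rcases le_total 1 ((k : ℝ) * δ x) with h | h
        · rw [min_eq_left h, min_eq_left (by nlinarith)]
          simpa using this.le
        · rw [min_eq_right h]
          have := min_le_right 1 (((k : ℝ) + 1) * δ x)
          linarith
  have hTc : ∀ k x, F.ContAlong (γ k) (T k) x := by
    intro k x
    induction k with
    | zero =>
      intro p hp
      have : (fun y ↦ F.toFrame p (γ 0 y) * T 0 y) = fun _ ↦ F.toFrame p x₀ * 1 := by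
        funext y
        simp [γ, τ, hH0, T]
      rw [this]
      exact continuousAt_const
    | succ k ih => exact hN.contAlong (hγc k).continuousAt (hγc (k + 1)).continuousAt ih
  have hstab : ∀ (x) (k : ℕ), 1 ≤ k * δ x → γ k x = x := fun x k hk ↦ by
    simp only [γ, τ, min_eq_left hk, hH1]
  have hstabT : ∀ (x) (k : ℕ), 1 ≤ k * δ x → ∀ m, k ≤ m → T m x = T k x := by
    intro x k hk m hm
    induction m, hm using Nat.le_induction with
    | base => rfl
    | succ m hm ih =>
      have h1 : 1 ≤ m * δ x := hk.trans (by have := hδpos x; gcongr)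
      have h2 : 1 ≤ (m + 1 : ℕ) * δ x := h1.trans (by have := hδpos x; gcongr; simp)
      rw [hTs, hstab x _ h1, hstab x _ h2, hN.diag, one_mul, ih]
  have hceil : ∀ x, 1 ≤ (⌈(δ x)⁻¹⌉₊ : ℝ) * δ x := fun x ↦ by
    rw [← div_le_iff₀ (hδpos x), one_div]
    exact Nat.le_ceil _
  -- The number of steps jumps with `x`, but every step after arrival multiplies by `N x x = 1`.
  -- Near a given point the result thus agrees with `T k` for one fixed `k`, whose continuity is
  -- known.
  refine ⟨fun x ↦ T ⌈(δ x)⁻¹⌉₊ x, fun x ↦ hTu _ _, fun x ↦ ?_⟩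
  obtain ⟨k, hk⟩ := exists_nat_gt (δ x)⁻¹
  have hk' : 1 < k * δ x := by
    rwa [← div_lt_iff₀ (hδpos x), one_div]
  have hev : ∀ᶠ y in 𝓝 x, 1 < k * δ y :=
    (continuous_const.mul hδc).continuousAt.eventually (lt_mem_nhds hk')
  refine (hTc k x).congr ?_ ?_
  · filter_upwards [hev] with y hy
    exact hstab y k hy.le
  · filter_upwards [hev] with y hy
    rcases le_total k ⌈(δ y)⁻¹⌉₊ with h | h
    · exact (hstabT y k hy.le _ h).symm
    · exact hstabT y _ (hceil y) _ h

/-- Over a contractible manifold a family of fibres with smooth local frames has a global smooth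
frame. -/
theorem exists_smooth_frame [T2Space M] [SigmaCompactSpace M] [ContractibleSpace M]
    (F : LocalFrames d M L) : ∃ v : M → L, (∀ x, IsUnit (v x)) ∧ ∀ p, ∀ x ∈ F.dom p,
      ContMDiffAt (𝓡 d) 𝓘(ℝ, L) ∞ (fun y ↦ F.toFrame p y * v y) x := by
  obtain ⟨N, hN⟩ := F.exists_isKernel
  obtain ⟨T, hTu, hTc⟩ := exists_contAlong hN
  -- The frame `T j` moved from `j` to `x` by the kernel is close to `T x`: the ratio is continuous
  -- at `j` with value `1`. Continuity is checked in a local frame, which cancels from the ratio.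
  have hnear : ∀ j, ∀ᶠ x in 𝓝 j, ‖1 - Ring.inverse (T x) * (N x j * T j)‖ < 1 := by
    intro j
    obtain ⟨p, hp⟩ := F.cover j
    have h1 : ContinuousAt (fun x ↦ 1 - Ring.inverse (F.toFrame p x * T x) *
        (F.toFrame p x * N x j * F.ofFrame p j * (F.toFrame p j * T j))) j := by
      have hu : IsUnit (F.toFrame p j * T j) := (F.isUnit_toFrame hp).mul (hTu j)
      have h2 : ContinuousAt (fun x ↦ Ring.inverse (F.toFrame p x * T x)) j :=
        ContinuousAt.comp (g := Ring.inverse) (f := fun x ↦ F.toFrame p x * T x)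
          (by obtain ⟨w, hw⟩ := hu; simp only [← hw]; exact NormedRing.inverse_continuousAt w)
          (hTc j p hp)
      have h3 : ContinuousAt (fun x ↦ F.toFrame p x * N x j * F.ofFrame p j) j :=
        ContinuousAt.comp (f := fun x ↦ (x, j)) (hN.continuousAt p p j hp j hp)
          (continuousAt_id.prodMk continuousAt_const)
      exact continuousAt_const.sub (h2.mul (h3.mul continuousAt_const))
    have h0 : ‖1 - Ring.inverse (F.toFrame p j * T j) *
        (F.toFrame p j * N j j * F.ofFrame p j * (F.toFrame p j * T j))‖ < 1 := by
      rw [hN.diag, mul_one, F.toFrame_mul_ofFrame p j hp, one_mul,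
        Ring.inverse_mul_cancel _ ((F.isUnit_toFrame hp).mul (hTu j))]
      simp
    filter_upwards [h1.norm.eventually (gt_mem_nhds h0), F.dom_mem_nhds hp] with x hx hxp
    obtain ⟨a, ha⟩ := F.isUnit_toFrame hxp
    obtain ⟨b, hb⟩ := hTu x
    have key : Ring.inverse (F.toFrame p x * T x) *
        (F.toFrame p x * N x j * F.ofFrame p j * (F.toFrame p j * T j)) =
        Ring.inverse (T x) * (N x j * T j) := by
      simp only [mul_assoc]
      rw [← mul_assoc (F.ofFrame p j), F.ofFrame_mul_toFrame p j hp, one_mul, ← ha, ← hb,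
        ← Units.val_mul, Ring.inverse_unit, Ring.inverse_unit, mul_inv_rev, Units.val_mul,
        mul_assoc, Units.inv_mul_cancel_left]
    rwa [key] at hx
  choose O hO hOo hOj using fun j ↦ eventually_nhds_iff.1 (hnear j)
  obtain ⟨ρ, hρ⟩ := SmoothPartitionOfUnity.exists_isSubordinate (𝓡 d) (s := (univ : Set M))
    isClosed_univ O hOo fun x _ ↦ mem_iUnion.2 ⟨x, hOj x⟩
  -- Each summand is smooth because the kernel is smooth in its target. After multiplication by the
  -- inverse of `T x` the average stays in the unit ball about `1`, which is convex and consists of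
  -- units.
  refine ⟨fun x ↦ ∑ᶠ j, ρ j x • (N x j * T j), fun x ↦ ?_, fun p x hx ↦ ?_⟩
  · have hmem : (∑ᶠ j, ρ j x • (N x j * T j)) ∈ {w | ‖1 - Ring.inverse (T x) * w‖ < 1} := by
      refine ρ.finsum_smul_mem_convex (g := fun j x ↦ N x j * T j) (mem_univ x)
        (fun j hj ↦ hO j x (hρ j (subset_tsupport _ hj))) ?_
      · have : {w | ‖1 - Ring.inverse (T x) * w‖ < 1} =
            (LinearMap.mulLeft ℝ (Ring.inverse (T x))) ⁻¹' Metric.ball 1 1 := by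
          ext w
          simp [dist_eq_norm, norm_sub_rev]
        rw [this]
        exact (convex_ball _ _).linear_preimage _
    have h1 : IsUnit (Ring.inverse (T x) * ∑ᶠ j, ρ j x • (N x j * T j)) := by
      have := (Units.oneSub _ hmem).isUnit
      rwa [Units.val_oneSub, sub_sub_cancel] at this
    have h2 := (hTu x).mul h1
    rwa [← mul_assoc, Ring.mul_inverse_cancel _ (hTu x), one_mul] at h2
  · have h1 : ContMDiffAt (𝓡 d) 𝓘(ℝ, L) ∞
        (fun y ↦ ∑ᶠ j, ρ j y • (F.toFrame p y * N y j * T j)) x :=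
      ρ.contMDiffAt_finsum fun j _ ↦
        contMDiffAt_mul_normedRing (hN.smooth p j x hx) contMDiffAt_const
    refine h1.congr_of_eventuallyEq (Eventually.of_forall fun y ↦ ?_)
    change F.toFrame p y * (∑ᶠ j, ρ j y • (N y j * T j)) = _
    rw [mul_finsum']
    · exact finsum_congr fun j ↦ by rw [mul_smul_comm, mul_assoc]
    · exact (ρ.locallyFinite.point_finite y).subset fun j hj h0 ↦ hj (by simp [h0])

end Transport

end LocalFrames

end Trivialization

/-! ### Smooth Gram–Schmidt orthonormalisation -/

section OrthonormalFrame

open Topology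

variable {d : ℕ} {M : Type u} [TopologicalSpace M] [ChartedSpace (EuclideanSpace ℝ (Fin d)) M]

theorem contMDiffAt_conj {f : M → ℂ} {x : M} (hf : ContMDiffAt (𝓡 d) 𝓘(ℝ, ℂ) ∞ f x) :
    ContMDiffAt (𝓡 d) 𝓘(ℝ, ℂ) ∞ (fun y ↦ starRingEnd ℂ (f y)) x :=
  Complex.conjCLE.contDiff.contMDiff.contMDiffAt.comp x hf

theorem dC_conj {f : M → ℂ} {x : M} (hf : ContMDiffAt (𝓡 d) 𝓘(ℝ, ℂ) ∞ f x)
    (v : TangentSpace (𝓡 d) x) :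
    dC (fun y ↦ starRingEnd ℂ (f y)) x v = starRingEnd ℂ (dC f x v) := by
  have h1 := (hf.mdifferentiableAt (by simp)).hasMFDerivAt
  have h2 : HasMFDerivAt 𝓘(ℝ, ℂ) 𝓘(ℝ, ℂ) (fun c : ℂ ↦ starRingEnd ℂ c) (f x)
      (Complex.conjCLE : ℂ →L[ℝ] ℂ) := Complex.conjCLE.hasFDerivAt.hasMFDerivAt
  exact congrArg (fun L ↦ L v) (h2.comp x h1).mfderiv

theorem contMDiffAt_inv_complex {f : M → ℂ} {x : M} (hf : ContMDiffAt (𝓡 d) 𝓘(ℝ, ℂ) ∞ f x)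
    (h0 : f x ≠ 0) : ContMDiffAt (𝓡 d) 𝓘(ℝ, ℂ) ∞ (fun y ↦ (f y)⁻¹) x :=
  (contDiffAt_inv ℝ h0).contMDiffAt.comp x hf

theorem contMDiffAt_ofReal_sqrt_re {f : M → ℂ} {x : M} (hf : ContMDiffAt (𝓡 d) 𝓘(ℝ, ℂ) ∞ f x)
    (h0 : (f x).re ≠ 0) :
    ContMDiffAt (𝓡 d) 𝓘(ℝ, ℂ) ∞ (fun y ↦ ((√(f y).re : ℝ) : ℂ)) x :=
  Complex.ofRealCLM.contDiff.contMDiff.contMDiffAt.comp x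
    ((Real.contDiffAt_sqrt h0).contMDiffAt.comp x
      (Complex.reCLM.contDiff.contMDiff.contMDiffAt.comp x hf))

variable {G : M → Type} [∀ x, NormedAddCommGroup (G x)] [∀ x, InnerProductSpace ℂ (G x)] {n : ℕ}

theorem contMDiffAt_inner_of_coeff {φ : ∀ x, OrthonormalBasis (Fin n) ℂ (G x)}
    {x : M} {y z : ∀ x, G x}
    (hy : ∀ a, ContMDiffAt (𝓡 d) 𝓘(ℝ, ℂ) ∞ (fun t ↦ inner ℂ (φ t a) (y t)) x)
    (hz : ∀ a, ContMDiffAt (𝓡 d) 𝓘(ℝ, ℂ) ∞ (fun t ↦ inner ℂ (φ t a) (z t)) x) :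
    ContMDiffAt (𝓡 d) 𝓘(ℝ, ℂ) ∞ (fun t ↦ inner ℂ (y t) (z t)) x := by
  simp only [← fun t ↦ (φ t).sum_inner_mul_inner (y t) (z t)]
  refine ContMDiffAt.sum fun a _ ↦ cmMul ?_ (hz a)
  simpa using contMDiffAt_conj (hy a)

theorem contMDiffAt_norm_of_coeff {φ : ∀ x, OrthonormalBasis (Fin n) ℂ (G x)} {x : M} {y : ∀ x, G x}
    (hy : ∀ a, ContMDiffAt (𝓡 d) 𝓘(ℝ, ℂ) ∞ (fun t ↦ inner ℂ (φ t a) (y t)) x) (h0 : y x ≠ 0) :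
    ContMDiffAt (𝓡 d) 𝓘(ℝ, ℂ) ∞ (fun t ↦ (‖y t‖ : ℂ)) x := by
  have h1 : ∀ t, ‖y t‖ = √(inner ℂ (y t) (y t)).re := fun t ↦
    norm_eq_sqrt_re_inner (𝕜 := ℂ) (y t)
  simp only [h1]
  refine contMDiffAt_ofReal_sqrt_re (contMDiffAt_inner_of_coeff hy hy) ?_
  have := inner_self_eq_norm_sq (𝕜 := ℂ) (y x)
  change RCLike.re (inner ℂ (y x) (y x)) ≠ 0
  rw [this]
  positivity

/-- Each Gram–Schmidt vector is a rational expression in inner products with the earlier vectors and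
in their norms. The denominators do not vanish at `x` by linear independence there, which suffices
for smoothness at `x`. -/
theorem contMDiffAt_gramSchmidt {φ : ∀ x, OrthonormalBasis (Fin n) ℂ (G x)}
    {y : ∀ x, Fin n → G x} {x : M}
    (hy : ∀ a b, ContMDiffAt (𝓡 d) 𝓘(ℝ, ℂ) ∞ (fun t ↦ inner ℂ (φ t a) (y t b)) x)
    (hli : LinearIndependent ℂ (y x)) (b a : Fin n) :
    ContMDiffAt (𝓡 d) 𝓘(ℝ, ℂ) ∞
      (fun t ↦ inner ℂ (φ t a) (InnerProductSpace.gramSchmidt ℂ (y t) b)) x := by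
  induction b using WellFoundedLT.induction generalizing a with
  | _ b ih =>
    have h1 : ∀ t, inner ℂ (φ t a) (InnerProductSpace.gramSchmidt ℂ (y t) b) =
        inner ℂ (φ t a) (y t b) - ∑ i ∈ Finset.Iio b,
          inner ℂ (InnerProductSpace.gramSchmidt ℂ (y t) i) (y t b) *
            ((‖InnerProductSpace.gramSchmidt ℂ (y t) i‖ : ℂ) *
              (‖InnerProductSpace.gramSchmidt ℂ (y t) i‖ : ℂ))⁻¹ *
            inner ℂ (φ t a) (InnerProductSpace.gramSchmidt ℂ (y t) i) := by
      intro t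
      rw [eq_sub_iff_add_eq]
      conv_rhs => rw [InnerProductSpace.gramSchmidt_def'' ℂ (y t) b]
      simp only [inner_add_right, inner_sum, inner_smul_right, div_eq_mul_inv, pow_two]
      rfl
    simp only [h1]
    refine (hy a b).sub (ContMDiffAt.sum fun i hi ↦ ?_)
    have hi' := Finset.mem_Iio.1 hi
    have hne := InnerProductSpace.gramSchmidt_ne_zero i hli
    have hn := contMDiffAt_norm_of_coeff (φ := φ) (ih i hi') hne
    refine cmMul (cmMul (contMDiffAt_inner_of_coeff (φ := φ) (ih i hi') fun a ↦ hy a b) ?_)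
      (ih i hi' a)
    refine contMDiffAt_inv_complex (cmMul hn hn) ?_
    simpa using hne

theorem contMDiffAt_gramSchmidtNormed {φ : ∀ x, OrthonormalBasis (Fin n) ℂ (G x)}
    {y : ∀ x, Fin n → G x} {x : M}
    (hy : ∀ a b, ContMDiffAt (𝓡 d) 𝓘(ℝ, ℂ) ∞ (fun t ↦ inner ℂ (φ t a) (y t b)) x)
    (hli : LinearIndependent ℂ (y x)) (b a : Fin n) :
    ContMDiffAt (𝓡 d) 𝓘(ℝ, ℂ) ∞
      (fun t ↦ inner ℂ (φ t a) (InnerProductSpace.gramSchmidtNormed ℂ (y t) b)) x := by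
  simp only [InnerProductSpace.gramSchmidtNormed, inner_smul_right]
  have hne := InnerProductSpace.gramSchmidt_ne_zero b hli
  have h1 := contMDiffAt_gramSchmidt hy hli b
  refine cmMul (contMDiffAt_inv_complex (contMDiffAt_norm_of_coeff (φ := φ) h1 hne) ?_) (h1 a)
  simpa using hne

/-- Over a contractible manifold, a family of hermitian vector spaces with local orthonormal frames
that are related by smooth transition functions has a global smooth orthonormal frame. -/
theorem exists_smooth_orthonormalBasis [IsManifold (𝓡 d) ∞ M] [T2Space M] [SigmaCompactSpace M]
    [ContractibleSpace M] [∀ x, FiniteDimensional ℂ (G x)] {ι : Type u} (dom : ι → Set M)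
    (isOpen_dom : ∀ p, IsOpen (dom p)) (cover : ∀ x, ∃ p, x ∈ dom p)
    (φ : ι → ∀ x, OrthonormalBasis (Fin n) ℂ (G x))
    (smooth : ∀ p q, ∀ x ∈ dom p ∩ dom q, ∀ a b,
      ContMDiffAt (𝓡 d) 𝓘(ℝ, ℂ) ∞ (fun y ↦ inner ℂ (φ p y a) (φ q y b)) x) :
    ∃ u : ∀ x, OrthonormalBasis (Fin n) ℂ (G x), ∀ p, ∀ x ∈ dom p, ∀ a b,
      ContMDiffAt (𝓡 d) 𝓘(ℝ, ℂ) ∞ (fun y ↦ inner ℂ (φ p y a) (u y b)) x := by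
  let : NormedRing (Matrix (Fin n) (Fin n) ℂ) := Matrix.linftyOpNormedRing
  let : NormedAlgebra ℝ (Matrix (Fin n) (Fin n) ℂ) := Matrix.linftyOpNormedAlgebra
  have : CompleteSpace (Matrix (Fin n) (Fin n) ℂ) := FiniteDimensional.complete ℝ _
  -- A basis chosen point by point, without continuity, identifies every fibre with the model `ℂⁿ`
  -- of `LocalFrames`.
  let β : ∀ x, OrthonormalBasis (Fin n) ℂ (G x) := fun x ↦ φ (cover x).choose x
  have hmul : ∀ (P Q R : ∀ x, OrthonormalBasis (Fin n) ℂ (G x)) (x : M),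
      (Matrix.of fun a b ↦ inner ℂ (P x a) (Q x b)) * (Matrix.of fun a b ↦ inner ℂ (Q x a) (R x b)) =
        (Matrix.of fun a b ↦ inner ℂ (P x a) (R x b)) := by
    intro P Q R x
    ext a b
    simp [Matrix.mul_apply, (Q x).sum_inner_mul_inner]
  have hone : ∀ (P : ∀ x, OrthonormalBasis (Fin n) ℂ (G x)) (x : M),
      (Matrix.of fun a b ↦ inner ℂ (P x a) (P x b)) = (1 : Matrix (Fin n) (Fin n) ℂ) := by
    intro P x
    ext a b
    simp [Matrix.one_apply, (P x).inner_eq_ite]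
  let F : LocalFrames d M (Matrix (Fin n) (Fin n) ℂ) :=
    { ι := ι
      dom := dom
      isOpen_dom := isOpen_dom
      cover := cover
      toFrame := fun p x ↦ Matrix.of fun a b ↦ inner ℂ (φ p x a) (β x b)
      ofFrame := fun p x ↦ Matrix.of fun a b ↦ inner ℂ (β x a) (φ p x b)
      toFrame_mul_ofFrame := fun p x _ ↦ by rw [hmul, hone]
      ofFrame_mul_toFrame := fun p x _ ↦ by rw [hmul, hone]
      smooth := fun p q x hx ↦ by
        simp only [hmul]
        have : ∀ y, (Matrix.of fun a b ↦ inner ℂ (φ p y a) (φ q y b)) =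
            ∑ a, ∑ b, (inner ℂ (φ p y a) (φ q y b) : ℂ) • Matrix.single a b (1 : ℂ) := by
          intro y
          conv_lhs => rw [Matrix.matrix_eq_sum_single
            (Matrix.of fun a b ↦ inner ℂ (φ p y a) (φ q y b))]
          simp [Matrix.smul_single]
        simp only [this]
        refine ContMDiffAt.sum fun a _ ↦ ContMDiffAt.sum fun b _ ↦ ?_
        let l : ℂ →ₗ[ℝ] Matrix (Fin n) (Fin n) ℂ :=
          (LinearMap.toSpanSingleton ℂ _ (Matrix.single a b (1 : ℂ))).restrictScalars ℝ
        exact (LinearMap.toContinuousLinearMap l).contDiff.contMDiff.contMDiffAt.comp x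
          (smooth p q x hx a b) }
  obtain ⟨v, hvu, hvs⟩ := LocalFrames.exists_smooth_frame F
  -- The columns of `v x`, read in the basis `β x`, form a frame; its coefficients in the local
  -- frame `p` are the smooth entries of `toFrame p * v`.
  let y : ∀ x, Fin n → G x := fun x b ↦ (β x).toBasis.equivFun.symm ((v x).col b)
  have hli : ∀ x, LinearIndependent ℂ (y x) := fun x ↦
    (Matrix.linearIndependent_cols_iff_isUnit.2 (hvu x)).map' _
      (LinearEquiv.ker (β x).toBasis.equivFun.symm)
  have hcard : ∀ x, Module.finrank ℂ (G x) = Fintype.card (Fin n) := fun x ↦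
    Module.finrank_eq_card_basis (β x).toBasis
  refine ⟨fun x ↦ InnerProductSpace.gramSchmidtOrthonormalBasis (hcard x) (y x),
    fun p x hx a b ↦ ?_⟩
  have hgs : ∀ x, InnerProductSpace.gramSchmidtOrthonormalBasis (hcard x) (y x) b =
      InnerProductSpace.gramSchmidtNormed ℂ (y x) b := fun x ↦ by
    refine InnerProductSpace.gramSchmidtOrthonormalBasis_apply _ fun h0 ↦ ?_
    have := InnerProductSpace.gramSchmidtNormed_unit_length b (hli x)
    rw [h0] at this
    simp at this
  simp only [hgs]
  refine contMDiffAt_gramSchmidtNormed (φ := φ p) (fun a b ↦ ?_) (hli x) b a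
  have h1 : ∀ t, inner ℂ (φ p t a) (y t b) = (F.toFrame p t * v t) a b := fun t ↦ by
    simp only [y, Module.Basis.equivFun_symm_apply, inner_sum, inner_smul_right, Matrix.mul_apply]
    refine Finset.sum_congr rfl fun c _ ↦ ?_
    rw [mul_comm]
    rfl
  simp only [h1]
  let l : Matrix (Fin n) (Fin n) ℂ →ₗ[ℝ] ℂ := Matrix.entryLinearMap ℝ ℂ a b
  exact (LinearMap.toContinuousLinearMap l).contDiff.contMDiff.contMDiffAt.comp x (hvs p x hx)

end OrthonormalFrame

/-! ### Plots of manifolds and their local inverses -/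

section Plots

open Topology

variable {d : ℕ} {M : Type u} [TopologicalSpace M] [ChartedSpace (EuclideanSpace ℝ (Fin d)) M]
  [IsManifold (𝓡 d) ∞ M]

/-- Every neighbourhood of a point contains the image of a smooth self-map of the whole space which
is the identity near that point. -/
theorem exists_shrink {m : ℕ} {P : Set (EuclideanSpace ℝ (Fin m))} (t : EuclideanSpace ℝ (Fin m))
    (hP : P ∈ 𝓝 t) : ∃ h : EuclideanSpace ℝ (Fin m) → EuclideanSpace ℝ (Fin m),
      ContDiff ℝ ∞ h ∧ (h =ᶠ[𝓝 t] fun s ↦ s) ∧ ∀ s, h s ∈ P := by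
  obtain ⟨r, hr, hball⟩ := Metric.mem_nhds_iff.1 hP
  let χ : ContDiffBump t := ⟨r / 2, r, by positivity, by linarith⟩
  let h : EuclideanSpace ℝ (Fin m) → EuclideanSpace ℝ (Fin m) := fun s ↦ t + χ s • (s - t)
  refine ⟨h, contDiff_const.add (χ.contDiff.smul (contDiff_id.sub contDiff_const)), ?_,
    fun s ↦ hball ?_⟩
  · filter_upwards [χ.eventuallyEq_one] with s hs
    simp [h, hs]
  · by_cases hs : s ∈ Metric.ball t r
    · rw [Metric.mem_ball, dist_eq_norm] at hs ⊢
      simp only [h, add_sub_cancel_left, norm_smul, Real.norm_eq_abs, abs_of_nonneg χ.nonneg]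
      calc χ s * ‖s - t‖ ≤ 1 * ‖s - t‖ := by gcongr; exact χ.le_one
        _ < r := by simpa using hs
    · have : χ s = 0 := χ.zero_of_le_dist (by simpa using hs)
      simp [h, this, hr]

/-- Every neighbourhood of a point of a manifold contains the image of a global plot which has a
smooth inverse near that point. -/
theorem exists_plot {O : Set M} {x : M} (hO : O ∈ 𝓝 x) :
    ∃ (g : EuclideanSpace ℝ (Fin d) → M) (c : M → EuclideanSpace ℝ (Fin d)),
      ContMDiff 𝓘(ℝ, EuclideanSpace ℝ (Fin d)) (𝓡 d) ∞ g ∧ (∀ s, g s ∈ O) ∧ g (c x) = x ∧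
      ∀ᶠ y in 𝓝 x, ContMDiffAt (𝓡 d) 𝓘(ℝ, EuclideanSpace ℝ (Fin d)) ∞ c y ∧ g (c y) = y := by
  set φ := chartAt (EuclideanSpace ℝ (Fin d)) x
  have hx : x ∈ φ.source := mem_chart_source _ x
  have hP : φ.target ∩ φ.symm ⁻¹' O ∈ 𝓝 (φ x) := by
    refine Filter.inter_mem (φ.open_target.mem_nhds (φ.map_source hx)) ?_
    refine (φ.symm.continuousAt (φ.map_source hx)).preimage_mem_nhds ?_
    rwa [φ.left_inv hx]
  obtain ⟨h, hh, hid, hhP⟩ := exists_shrink (φ x) hP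
  refine ⟨fun s ↦ φ.symm (h s), φ, ?_, fun s ↦ (hhP s).2, ?_, ?_⟩
  · exact contMDiffOn_univ.1 <| (contMDiffOn_chart_symm (I := 𝓡 d) (n := ∞) (x := x)).comp
      hh.contMDiff.contMDiffOn fun s _ ↦ (hhP s).1
  · change φ.symm (h (φ x)) = x
    rw [hid.eq_of_nhds, φ.left_inv hx]
  · filter_upwards [φ.open_source.mem_nhds hx, (φ.continuousAt hx).eventually hid] with y hy hy'
    refine ⟨(contMDiffOn_chart (I := 𝓡 d) (n := ∞)).contMDiffAt (φ.open_source.mem_nhds hy), ?_⟩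
    rw [hy', φ.left_inv hy]

/-- The derivative of a plot. -/
def plotDeriv {m : ℕ} (g : EuclideanSpace ℝ (Fin m) → M) (t v : EuclideanSpace ℝ (Fin m)) :
    EuclideanSpace ℝ (Fin d) :=
  mfderiv 𝓘(ℝ, EuclideanSpace ℝ (Fin m)) (𝓡 d) g t v

theorem plotDeriv_congr {m : ℕ} {g g' : EuclideanSpace ℝ (Fin m) → M} {t : EuclideanSpace ℝ (Fin m)}
    (h : g =ᶠ[𝓝 t] g') (v : EuclideanSpace ℝ (Fin m)) :
    plotDeriv (d := d) g t v = plotDeriv g' t v := by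
  simp only [plotDeriv, h.mfderiv_eq]
  rfl

/-- The chain rule for `g ∘ c = id` near `x`. Every tangent vector is thus the velocity of a plot,
so identities known along plots hold for all tangent vectors. -/
theorem plotDeriv_mfderiv {g : EuclideanSpace ℝ (Fin d) → M} {c : M → EuclideanSpace ℝ (Fin d)} {x : M}
    (hg : ContMDiff 𝓘(ℝ, EuclideanSpace ℝ (Fin d)) (𝓡 d) ∞ g)
    (hc : ∀ᶠ y in 𝓝 x, ContMDiffAt (𝓡 d) 𝓘(ℝ, EuclideanSpace ℝ (Fin d)) ∞ c y ∧ g (c y) = y)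
    (v : EuclideanSpace ℝ (Fin d)) :
    plotDeriv g (c x) (mfderiv (𝓡 d) 𝓘(ℝ, EuclideanSpace ℝ (Fin d)) c x v) = v := by
  have h5 := mfderiv_comp x ((hg (c x)).mdifferentiableAt (by simp))
    (hc.self_of_nhds.1.mdifferentiableAt (by simp))
  have h6 : g ∘ c =ᶠ[𝓝 x] _root_.id := hc.mono fun y hy ↦ hy.2
  rw [h6.mfderiv_eq, mfderiv_id] at h5
  exact (congrArg (fun L ↦ L v) h5).symm

end Plots

/-! ### Local sections of the submersion and the global unitary frame -/

section LocalSections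

open Topology

variable {d : ℕ} {M : Type u} [TopologicalSpace M] [ChartedSpace (EuclideanSpace ℝ (Fin d)) M]
  [IsManifold (𝓡 d) ∞ M] {ρ : ImaginaryTwoForm d M}

/-- A smooth local section of the submersion of `S`, whose image lies in the domain of a local frame. -/
structure LocalSection (S : Sec ρ) where
  dom : Set M
  isOpen_dom : IsOpen dom
  toFun : M → S.Z
  contMDiffAt : ∀ x ∈ dom, ContMDiffAt (𝓡 d) (𝓡 S.k) ∞ toFun x
  ζ_toFun : ∀ x ∈ dom, S.ζ (toFun x) = x
  i : S.E.ι
  mem_dom : ∀ x ∈ dom, toFun x ∈ S.E.dom i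

/-- A plot through `x` is lifted through the submersion and precomposed with its local inverse. -/
theorem exists_localSection (S : Sec ρ) (x : M) : ∃ σ : LocalSection S, x ∈ σ.dom := by
  obtain ⟨g, c, hg, -, hgx, hc⟩ := exists_plot (d := d) (x := x) Filter.univ_mem
  obtain ⟨h, l, hh, hid, hl, hlr⟩ := exists_local_lift S.submersion hg (c x) (S.lift x)
    ((S.ζ_lift x).trans hgx.symm)
  obtain ⟨i, hi⟩ := S.E.cover (l (c x))
  have hcx : ContinuousAt c x := hc.self_of_nhds.1.continuousAt
  have h1 : ∀ᶠ y in 𝓝 x, ContMDiffAt (𝓡 d) (𝓡 S.k) ∞ (fun y ↦ l (c y)) y ∧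
      S.ζ (l (c y)) = y ∧ l (c y) ∈ S.E.dom i := by
    filter_upwards [hc, hcx.eventually hid,
      (hl.continuous.continuousAt.comp hcx).preimage_mem_nhds ((S.E.isOpen_dom i).mem_nhds hi)]
      with y hy hy' hy''
    refine ⟨(hl (c y)).comp y hy.1, ?_, hy''⟩
    rw [hlr, hy', _root_.id, hy.2]
  obtain ⟨V, hV, hVo, hxV⟩ := eventually_nhds_iff.1 h1
  exact ⟨⟨V, hVo, fun y ↦ l (c y), fun y hy ↦ (hV y hy).1, fun y hy ↦ (hV y hy).2.1, i,
    fun y hy ↦ (hV y hy).2.2⟩, hxV⟩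

/-- A chosen local section through the fibre over `x`. -/
def Sec.locSec (S : Sec ρ) (x : M) : LocalSection S := (exists_localSection S x).choose

theorem Sec.mem_locSec (S : Sec ρ) (x : M) : x ∈ (S.locSec x).dom :=
  (exists_localSection S x).choose_spec

/-- A local frame as an orthonormal basis. -/
def HermBundle.basisAt {k : ℕ} {N : Type u} [TopologicalSpace N]
    [ChartedSpace (EuclideanSpace ℝ (Fin k)) N] [IsManifold (𝓡 k) ∞ N] (E : HermBundle k N) (i : E.ι)
    {x : N} (hx : x ∈ E.dom i) : OrthonormalBasis (E.idx i) ℂ (E.fib x) :=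
  OrthonormalBasis.mk (E.orthonormal i x hx) (E.span i x hx)

theorem HermBundle.basisAt_apply {k : ℕ} {N : Type u} [TopologicalSpace N]
    [ChartedSpace (EuclideanSpace ℝ (Fin k)) N] [IsManifold (𝓡 k) ∞ N] (E : HermBundle k N) (i : E.ι)
    {x : N} (hx : x ∈ E.dom i) (a : E.idx i) : E.basisAt i hx a = E.frame i x a := by
  simp [basisAt]

/-- The transition functions between local sections are smooth. -/
theorem contMDiffAt_inner_α (S : Sec ρ) (σ τ : LocalSection S) {x : M} (hσ : x ∈ σ.dom)
    (hτ : x ∈ τ.dom) (f : M → ℂ) (b : S.E.idx τ.i) (a : S.E.idx σ.i)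
    (hf : ∀ y (hy : y ∈ σ.dom) (hy' : y ∈ τ.dom), f y = inner ℂ (S.E.frame τ.i (τ.toFun y) b)
      (S.α (σ.toFun y) (τ.toFun y) ((σ.ζ_toFun y hy).trans (τ.ζ_toFun y hy').symm)
        (S.E.frame σ.i (σ.toFun y) a))) :
    ContMDiffAt (𝓡 d) 𝓘(ℝ, ℂ) ∞ f x := by
  have hO : σ.dom ∩ τ.dom ∈ 𝓝 x := (σ.isOpen_dom.inter τ.isOpen_dom).mem_nhds ⟨hσ, hτ⟩
  -- Smoothness of `α` is given only along plots, so both sections are composed with a plot inside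
  -- the overlap, and the result is brought back to `M` by the local inverse `c`.
  obtain ⟨g, c, hg, hgO, hgx, hc⟩ := exists_plot (d := d) hO
  have hp := S.α_parallel d (fun s ↦ σ.toFun (g s)) (fun s ↦ τ.toFun (g s))
    (fun s ↦ (σ.contMDiffAt _ (hgO s).1).comp s (hg s))
    (fun s ↦ (τ.contMDiffAt _ (hgO s).2).comp s (hg s))
    (fun s ↦ (σ.ζ_toFun _ (hgO s).1).trans (τ.ζ_toFun _ (hgO s).2).symm) (c x) σ.i τ.i
    (σ.mem_dom _ (hgO _).1) (τ.mem_dom _ (hgO _).2)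
  have h1 := (hp.1 b a).contMDiffAt.comp x hc.self_of_nhds.1
  refine h1.congr_of_eventuallyEq ?_
  filter_upwards [hc] with y hy
  have hy' := hgO (c y)
  exact (congrArg f hy.2.symm).trans (hf _ hy'.1 hy'.2)

variable [T2Space M] [SigmaCompactSpace M] [ContractibleSpace M]

/-- `Z` may be disconnected, but `α` identifies the fibres over one point of `M`. The rank is
therefore a function on the connected `M`, locally constant because of the local frames. -/
theorem finrank_fib_const (S : Sec ρ) : ∃ n : ℕ, ∀ z, Module.finrank ℂ (S.E.fib z) = n := by
  have h1 : IsLocallyConstant fun x ↦ Module.finrank ℂ (S.E.fib (S.lift x)) := by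
    rw [IsLocallyConstant.iff_eventually_eq]
    have key : ∀ x, ∀ y ∈ (S.locSec x).dom, Module.finrank ℂ (S.E.fib (S.lift y)) =
        Fintype.card (S.E.idx (S.locSec x).i) := by
      intro x y hy
      rw [(S.α (S.lift y) ((S.locSec x).toFun y)
        ((S.ζ_lift y).trans ((S.locSec x).ζ_toFun y hy).symm)).toLinearEquiv.finrank_eq]
      exact Module.finrank_eq_card_basis (S.E.basisAt _ ((S.locSec x).mem_dom y hy)).toBasis
    intro x
    filter_upwards [(S.locSec x).isOpen_dom.mem_nhds (S.mem_locSec x)] with y hy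
    rw [key x y hy, key x x (S.mem_locSec x)]
  obtain ⟨x₀⟩ : Nonempty M := inferInstance
  refine ⟨Module.finrank ℂ (S.E.fib (S.lift x₀)), fun z ↦ ?_⟩
  rw [(S.α z (S.lift (S.ζ z)) (S.ζ_lift _).symm).toLinearEquiv.finrank_eq]
  exact h1.apply_eq_of_preconnectedSpace _ _

/-- The matrix of a frame in a local frame. -/
def frameCoeff (S : Sec ρ) {n : ℕ} (w : ∀ z, EuclideanSpace ℂ (Fin n) ≃ₗᵢ[ℂ] S.E.fib z) (i : S.E.ι)
    (z : S.Z) : Matrix (S.E.idx i) (Fin n) ℂ :=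
  Matrix.of fun b a ↦ inner ℂ (S.E.frame i z b) (w z (EuclideanSpace.single a 1))

/-- Every section of a gerbe over a contractible manifold has a smooth global unitary frame which is
compatible with descent. -/
theorem exists_frame (S : Sec ρ) : ∃ (n : ℕ)
    (w : ∀ z, EuclideanSpace ℂ (Fin n) ≃ₗᵢ[ℂ] S.E.fib z),
    (∀ z z' (h : S.ζ z = S.ζ z') e, S.α z z' h (w z e) = w z' e) ∧
    ∀ (σ : LocalSection S), ∀ x ∈ σ.dom, ∀ b a,
      ContMDiffAt (𝓡 d) 𝓘(ℝ, ℂ) ∞ (fun y ↦ frameCoeff S w σ.i (σ.toFun y) b a) x := by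
  obtain ⟨n, hn⟩ := finrank_fib_const S
  have hcard : ∀ σ : LocalSection S, ∀ x ∈ σ.dom, Fintype.card (S.E.idx σ.i) = n := fun σ x hx ↦
    (Module.finrank_eq_card_basis (S.E.basisAt _ (σ.mem_dom x hx)).toBasis).symm.trans (hn _)
  let e : ∀ σ : LocalSection S, ∀ x ∈ σ.dom, S.E.idx σ.i ≃ Fin n := fun σ x hx ↦
    Fintype.equivFinOfCardEq (hcard σ x hx)
  classical
  let φ : LocalSection S → ∀ x, OrthonormalBasis (Fin n) ℂ (S.E.fib (S.lift x)) := fun σ x ↦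
    if hx : x ∈ σ.dom then
      ((S.E.basisAt _ (σ.mem_dom x hx)).map
        (S.α (σ.toFun x) (S.lift x) ((σ.ζ_toFun x hx).trans (S.ζ_lift x).symm))).reindex (e σ x hx)
    else (stdOrthonormalBasis ℂ _).reindex (finCongr (hn _))
  have hφ : ∀ (σ : LocalSection S) (x) (hx : x ∈ σ.dom) (a), φ σ x a =
      S.α (σ.toFun x) (S.lift x) ((σ.ζ_toFun x hx).trans (S.ζ_lift x).symm)
        (S.E.frame σ.i (σ.toFun x) ((e σ x hx).symm a)) := by
    intro σ x hx a
    simp only [φ, dif_pos hx, OrthonormalBasis.reindex_apply, OrthonormalBasis.map_apply,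
      HermBundle.basisAt_apply]
  obtain ⟨u, hu⟩ := exists_smooth_orthonormalBasis (d := d) (fun σ : LocalSection S ↦ σ.dom)
    (fun σ ↦ σ.isOpen_dom) (fun x ↦ ⟨_, S.mem_locSec x⟩) φ fun σ τ x hx a b ↦ by
      refine contMDiffAt_inner_α S τ σ hx.2 hx.1 _ ((e σ x hx.1).symm a) ((e τ x hx.2).symm b)
        fun y hy hy' ↦ ?_
      rw [hφ σ y hy', hφ τ y hy, ← S.α_cocycle (τ.toFun y) (σ.toFun y) (S.lift y)
        ((τ.ζ_toFun y hy).trans (σ.ζ_toFun y hy').symm)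
        ((σ.ζ_toFun y hy').trans (S.ζ_lift y).symm), LinearIsometryEquiv.inner_map_map]
  -- Stated for variable base points, so that their equality can be removed by substitution inside
  -- the dependent fibres.
  have hα : ∀ (x x' : M) (z : S.Z) (h : S.ζ z = x) (h' : x = x') (v : EuclideanSpace ℂ (Fin n)),
      S.α (S.lift x) z ((S.ζ_lift x).trans h.symm) ((u x).repr.symm v) =
        S.α (S.lift x') z ((S.ζ_lift x').trans (h.trans h').symm) ((u x').repr.symm v) := by
    rintro x _ z h rfl v
    rfl
  refine ⟨n, fun z ↦ (u (S.ζ z)).repr.symm.trans (S.α (S.lift (S.ζ z)) z (S.ζ_lift _)),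
    fun z z' h v ↦ ?_, fun σ x hx b a ↦ ?_⟩
  · exact (S.α_cocycle _ _ _ _ _ _).trans (hα _ _ z' h.symm h v)
  · refine (hu σ x hx (e σ x hx b) a).congr_of_eventuallyEq ?_
    filter_upwards [σ.isOpen_dom.mem_nhds hx] with y hy
    rw [hφ σ y hy, Equiv.symm_apply_apply]
    refine Eq.trans ?_ (LinearIsometryEquiv.inner_map_map (S.α (σ.toFun y) (S.lift y)
      ((σ.ζ_toFun y hy).trans (S.ζ_lift y).symm)).symm _ _)
    rw [LinearIsometryEquiv.symm_apply_apply]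
    change inner ℂ _ (S.α _ _ _ ((u (S.ζ (σ.toFun y))).repr.symm (EuclideanSpace.single a 1))) = _
    rw [← hα y _ (σ.toFun y) (σ.ζ_toFun y hy) (σ.ζ_toFun y hy).symm,
      OrthonormalBasis.repr_symm_single]
    congr 1
    rw [LinearIsometryEquiv.eq_symm_apply, S.α_cocycle, S.α_self]

end LocalSections

/-! ### The connection form in a global frame -/

section ConnectionForm

open Topology Bundle

variable {d : ℕ} {M : Type u} [TopologicalSpace M] [ChartedSpace (EuclideanSpace ℝ (Fin d)) M]
  [IsManifold (𝓡 d) ∞ M]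

/-- Forms are smooth as functions on the tangent bundle, so pulling one back along a local section
requires a smooth tangent map. -/
theorem contMDiffAt_tangentMap {k : ℕ} {N : Type u} [TopologicalSpace N]
    [ChartedSpace (EuclideanSpace ℝ (Fin k)) N] [IsManifold (𝓡 k) ∞ N] {σ : M → N} {U : Set M}
    (hU : IsOpen U) (hσ : ∀ x ∈ U, ContMDiffAt (𝓡 d) (𝓡 k) ∞ σ x) (q : TangentBundle (𝓡 d) M)
    (hq : q.proj ∈ U) :
    ContMDiffAt (𝓡 d).tangent (𝓡 k).tangent ∞ (tangentMap (𝓡 d) (𝓡 k) σ) q := by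
  have h1 : ContMDiffOn (𝓡 d) (𝓡 k) ∞ σ U := fun x hx ↦ (hσ x hx).contMDiffWithinAt
  have h2 := h1.contMDiffOn_tangentMapWithin (m := ∞) le_rfl hU.uniqueMDiffOn
  have hO : IsOpen (π (EuclideanSpace ℝ (Fin d)) (TangentSpace (𝓡 d)) ⁻¹' U : Set (TangentBundle (𝓡 d) M)) :=
    hU.preimage (FiberBundle.continuous_proj _ _)
  refine (h2.contMDiffAt (hO.mem_nhds hq)).congr_of_eventuallyEq ?_
  filter_upwards [hO.mem_nhds hq] with p hp
  exact (tangentMapWithin_eq_tangentMap (hU.uniqueMDiffWithinAt hp)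
    ((hσ _ hp).mdifferentiableAt (by simp))).symm

theorem contMDiffAt_dC {f : M → ℂ} {U : Set M} (hU : IsOpen U)
    (hf : ∀ x ∈ U, ContMDiffAt (𝓡 d) 𝓘(ℝ, ℂ) ∞ f x) (q : TangentBundle (𝓡 d) M) (hq : q.proj ∈ U) :
    ContMDiffAt (𝓡 d).tangent 𝓘(ℝ, ℂ) ∞ (fun q : TangentBundle (𝓡 d) M ↦ dC f q.proj q.snd) q := by
  have h1 : ContMDiffOn (𝓡 d) 𝓘(ℝ, ℂ) ∞ f U := fun x hx ↦ (hf x hx).contMDiffWithinAt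
  have h2 := h1.contMDiffOn_tangentMapWithin (m := ∞) le_rfl hU.uniqueMDiffOn
  have hO : IsOpen (π (EuclideanSpace ℝ (Fin d)) (TangentSpace (𝓡 d)) ⁻¹' U : Set (TangentBundle (𝓡 d) M)) :=
    hU.preimage (FiberBundle.continuous_proj _ _)
  have h3 := (contMDiff_snd_tangentBundle_modelSpace ℂ 𝓘(ℝ, ℂ) (n := ∞)).contMDiffAt.comp q
    (h2.contMDiffAt (hO.mem_nhds hq))
  refine h3.congr_of_eventuallyEq ?_
  filter_upwards [hO.mem_nhds hq] with p hp
  change _ = (tangentMapWithin (𝓡 d) 𝓘(ℝ, ℂ) f U p).snd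
  rw [tangentMapWithin_eq_tangentMap (hU.uniqueMDiffWithinAt hp)
    ((hf _ hp).mdifferentiableAt (by simp))]
  rfl

variable {ρ : ImaginaryTwoForm d M}

/-- A smooth global unitary frame compatible with descent. -/
structure GlobalFrame (S : Sec ρ) where
  n : ℕ
  w : ∀ z, EuclideanSpace ℂ (Fin n) ≃ₗᵢ[ℂ] S.E.fib z
  α_w : ∀ z z' (h : S.ζ z = S.ζ z') e, S.α z z' h (w z e) = w z' e
  smooth : ∀ (σ : LocalSection S), ∀ x ∈ σ.dom, ∀ b a,
    ContMDiffAt (𝓡 d) 𝓘(ℝ, ℂ) ∞ (fun y ↦ frameCoeff S w σ.i (σ.toFun y) b a) x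

namespace GlobalFrame

variable {S : Sec ρ} (W : GlobalFrame S)

/-- The coefficients of a global frame in a local frame. -/
def coeff (i : S.E.ι) (z : S.Z) : Matrix (S.E.idx i) (Fin W.n) ℂ := frameCoeff S W.w i z

theorem conjTranspose_coeff_mul {i : S.E.ι} {z : S.Z} (hz : z ∈ S.E.dom i) :
    (W.coeff i z).conjTranspose * W.coeff i z = 1 := by
  ext a b
  have h1 := (S.E.basisAt i hz).sum_inner_mul_inner (W.w z (EuclideanSpace.single a 1))
    (W.w z (EuclideanSpace.single b 1))
  simp only [HermBundle.basisAt_apply, LinearIsometryEquiv.inner_map_map] at h1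
  simp only [coeff, frameCoeff, Matrix.mul_apply, Matrix.conjTranspose_apply, Matrix.of_apply,
    RCLike.star_def, inner_conj_symm, h1]
  simp [EuclideanSpace.inner_single_left, PiLp.single_apply, Matrix.one_apply]

/-- The coefficient matrix is unitary, but its rows and columns have different index types, so both
inverse identities are computed: this one by expanding in the global frame, the other by expanding
in the local frame. -/
theorem coeff_mul_conjTranspose_mul {i : S.E.ι} {z : S.Z} (hz : z ∈ S.E.dom i) {β : Type}
    (X : Matrix (S.E.idx i) β ℂ) : W.coeff i z * ((W.coeff i z).conjTranspose * X) = X := by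
  classical
  have h1 : W.coeff i z * (W.coeff i z).conjTranspose = 1 := by
    ext a b
    have h1 := ((EuclideanSpace.basisFun (Fin W.n) ℂ).map (W.w z)).sum_inner_mul_inner
      (S.E.frame i z a) (S.E.frame i z b)
    simp only [OrthonormalBasis.map_apply, EuclideanSpace.basisFun_apply,
      ← S.E.basisAt_apply i hz, OrthonormalBasis.inner_eq_ite] at h1
    simp only [coeff, frameCoeff, Matrix.mul_apply, Matrix.conjTranspose_apply, Matrix.of_apply,
      RCLike.star_def, inner_conj_symm, Matrix.one_apply, ← S.E.basisAt_apply i hz, h1]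
  rw [← Matrix.mul_assoc, h1, Matrix.one_mul]

theorem coeff_mul_left_cancel {i : S.E.ι} {z : S.Z} (hz : z ∈ S.E.dom i)
    {X Y : Matrix (Fin W.n) (Fin W.n) ℂ} (h : W.coeff i z * X = W.coeff i z * Y) : X = Y := by
  have := congrArg ((W.coeff i z).conjTranspose * ·) h
  simpa only [← Matrix.mul_assoc, W.conjTranspose_coeff_mul hz, Matrix.one_mul] using this

section Lifts

variable {m : ℕ} {l l' : EuclideanSpace ℝ (Fin m) → S.Z}

/-- `α` carries the global frame to itself, so its coefficients over two points of one fibre differ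
by the matrix of `α`. -/
theorem coeff_eq_mul {i j : S.E.ι} {z z' : S.Z} (h : S.ζ z = S.ζ z') (hz : z ∈ S.E.dom i) :
    W.coeff j z' = (Matrix.of fun b a ↦ inner ℂ (S.E.frame j z' b) (S.α z z' h (S.E.frame i z a))) *
      W.coeff i z := by
  ext b a
  simp only [coeff, frameCoeff, Matrix.mul_apply, Matrix.of_apply]
  rw [← W.α_w z z' h]
  conv_lhs => rw [S.E.expand i hz (W.w z (EuclideanSpace.single a 1))]
  simp [mul_comm]

/-- The covariant derivative of a global frame, expressed in the global frame, does not depend on the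
lift of a plot. -/
theorem matDeriv_coeff_of_lift (hl : ContMDiff 𝓘(ℝ, EuclideanSpace ℝ (Fin m)) (𝓡 S.k) ∞ l)
    (hl' : ContMDiff 𝓘(ℝ, EuclideanSpace ℝ (Fin m)) (𝓡 S.k) ∞ l')
    (h : ∀ s, S.ζ (l s) = S.ζ (l' s)) {t : EuclideanSpace ℝ (Fin m)} {i j : S.E.ι}
    (hi : l t ∈ S.E.dom i) (hj : l' t ∈ S.E.dom j)
    (hC : ∀ b a, ContDiffAt ℝ ∞ (fun s ↦ W.coeff i (l s) b a) t) :
    (∀ b a, ContDiffAt ℝ ∞ (fun s ↦ W.coeff j (l' s) b a) t) ∧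
    ∀ (v) (X : Matrix (Fin W.n) (Fin W.n) ℂ), matDeriv (fun s ↦ W.coeff i (l s)) t v + pullForm S.E l i t v * W.coeff i (l t) =
        W.coeff i (l t) * X →
      matDeriv (fun s ↦ W.coeff j (l' s)) t v + pullForm S.E l' j t v * W.coeff j (l' t) =
        W.coeff j (l' t) * X := by
  -- With `C' = K C` and `dK + ω' K = K ω`, the Leibniz rule gives `dC' + ω' C' = K (dC + ω C)`.
  obtain ⟨hK, eK⟩ := S.α_parallel m l l' hl hl' h t i j hi hj
  set K := GerbeSections.coeff S.E S.E l l' (fun t ↦ (S.α _ _ (h t)).toLinearEquiv.toLinearMap) i j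
  have key : ∀ s, l s ∈ S.E.dom i → W.coeff j (l' s) = K s * W.coeff i (l s) := fun s hs ↦
    W.coeff_eq_mul (h s) hs
  have hev : (fun s ↦ W.coeff j (l' s)) =ᶠ[𝓝 t] fun s ↦ K s * W.coeff i (l s) := by
    filter_upwards [hl.continuous.continuousAt.preimage_mem_nhds
      ((S.E.isOpen_dom i).mem_nhds hi)] with s hs
    exact key s hs
  refine ⟨fun b a ↦ ?_, fun v X hX ↦ ?_⟩
  · refine ContDiffAt.congr_of_eventuallyEq
      (ContDiffAt.sum (s := Finset.univ) fun c _ ↦ (hK b c).mul (hC c a)) ?_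
    exact hev.mono fun s hs ↦ by simp [hs, Matrix.mul_apply]
  · rw [matDeriv_congr hev, matDeriv_mul (fun c b ↦ (hK c b).differentiableAt (by simp))
      (fun c b ↦ (hC c b).differentiableAt (by simp)), key t hi, Matrix.mul_assoc, ← hX,
      Matrix.mul_add, ← Matrix.mul_assoc, ← Matrix.mul_assoc, ← eK v, Matrix.add_mul]
    abel

end Lifts

/-- The connection form of `S` in the global frame, computed along a local section. -/
def secForm (σ : LocalSection S) (a b : Fin W.n) (x : M) : TangentSpace (𝓡 d) x →L[ℝ] ℂ :=
  ∑ c, starRingEnd ℂ (W.coeff σ.i (σ.toFun x) c a) •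
    (dC (fun y ↦ W.coeff σ.i (σ.toFun y) c b) x +
      ∑ e, W.coeff σ.i (σ.toFun x) e b •
        (S.E.form σ.i c e (σ.toFun x)).comp (mfderiv (𝓡 d) (𝓡 S.k) σ.toFun x))

theorem secForm_apply (σ : LocalSection S) (a b : Fin W.n) (x : M) (v : TangentSpace (𝓡 d) x) :
    W.secForm σ a b x v = ∑ c, starRingEnd ℂ (W.coeff σ.i (σ.toFun x) c a) *
      (dC (fun y ↦ W.coeff σ.i (σ.toFun y) c b) x v +
        ∑ e, S.E.form σ.i c e (σ.toFun x) (mfderiv (𝓡 d) (𝓡 S.k) σ.toFun x v) *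
          W.coeff σ.i (σ.toFun x) e b) := by
  simp only [secForm, sum_apply, add_apply, smul_apply, smul_eq_mul]
  refine Finset.sum_congr rfl fun c _ ↦ congrArg (_ * ·) (congrArg (_ + ·) ?_)
  refine Finset.sum_congr rfl fun e _ ↦ ?_
  exact mul_comm _ _

/-- The matrix of `secForm`. -/
def secMat (σ : LocalSection S) (x : M) (v : EuclideanSpace ℝ (Fin d)) :
    Matrix (Fin W.n) (Fin W.n) ℂ :=
  Matrix.of fun a b ↦ W.secForm σ a b x v

/-- The gauge transformation formula `C⁻¹ (dC + ω C)`, where `C⁻¹ = C*`. -/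
theorem secMat_eq (σ : LocalSection S) (x : M) (v : EuclideanSpace ℝ (Fin d)) :
    W.secMat σ x v = (W.coeff σ.i (σ.toFun x)).conjTranspose *
      (UForm.dMat (fun y ↦ W.coeff σ.i (σ.toFun y)) x v +
        (Matrix.of fun c e ↦ S.E.form σ.i c e (σ.toFun x) (mfderiv (𝓡 d) (𝓡 S.k) σ.toFun x v)) *
          W.coeff σ.i (σ.toFun x)) := by
  ext a b
  exact W.secForm_apply σ a b x v

/-- The basic case, for plots of `Z` that factor through a local section: it is the chain rule for
`σ ∘ g`, after `C C*` cancels. -/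
theorem matDeriv_coeff_section (σ : LocalSection S) {m : ℕ} {g : EuclideanSpace ℝ (Fin m) → M}
    (hg : ContMDiff 𝓘(ℝ, EuclideanSpace ℝ (Fin m)) (𝓡 d) ∞ g) (t v : EuclideanSpace ℝ (Fin m))
    (ht : g t ∈ σ.dom) :
    matDeriv (fun s ↦ W.coeff σ.i (σ.toFun (g s))) t v +
        pullForm S.E (fun s ↦ σ.toFun (g s)) σ.i t v * W.coeff σ.i (σ.toFun (g t)) =
      W.coeff σ.i (σ.toFun (g t)) *
        W.secMat σ (g t) (plotDeriv g t v) := by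
  rw [secMat_eq, W.coeff_mul_conjTranspose_mul (σ.mem_dom _ ht)]
  congr 1
  · ext b a
    have h1 := (W.smooth σ (g t) ht b a).mdifferentiableAt (by simp)
    have h2 := (hg t).mdifferentiableAt (by simp)
    have h3 := mfderiv_comp t h1 h2
    have h4 := congrArg (fun L ↦ L v) h3
    rw [mfderiv_eq_fderiv] at h4
    exact h4
  · congr 1
    ext c e
    have h1 := (σ.contMDiffAt _ ht).mdifferentiableAt (by simp)
    have h2 := (hg t).mdifferentiableAt (by simp)
    have h3 := mfderiv_comp t h1 h2
    have h4 := congrArg (fun L ↦ S.E.form σ.i c e (σ.toFun (g t)) (L v)) h3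
    exact h4

/-- The covariant derivative of a global frame along an arbitrary plot. -/
theorem matDeriv_coeff (σ : LocalSection S) {m : ℕ} {l : EuclideanSpace ℝ (Fin m) → S.Z}
    (hl : ContMDiff 𝓘(ℝ, EuclideanSpace ℝ (Fin m)) (𝓡 S.k) ∞ l) (t : EuclideanSpace ℝ (Fin m))
    (ht : S.ζ (l t) ∈ σ.dom) (j : S.E.ι) (hj : l t ∈ S.E.dom j) :
    (∀ b a, ContDiffAt ℝ ∞ (fun s ↦ W.coeff j (l s) b a) t) ∧
    ∀ v, matDeriv (fun s ↦ W.coeff j (l s)) t v + pullForm S.E l j t v * W.coeff j (l t) =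
      W.coeff j (l t) * W.secMat σ (S.ζ (l t))
        (plotDeriv (fun s ↦ S.ζ (l s)) t v) := by
  have hζ : ContMDiff 𝓘(ℝ, EuclideanSpace ℝ (Fin m)) (𝓡 d) ∞ (fun t ↦ S.ζ (l t)) :=
    S.submersion.contMDiff.comp hl
  -- The plots `l` and `σ ∘ ζ ∘ l` lie over the same plot of `M`, so independence of the lift
  -- reduces to the basic case. Plots are defined everywhere, hence `l` is first shrunk into the
  -- preimage of `σ.dom` without changing its germ at `t`.
  obtain ⟨h, hh, hid, hP⟩ := exists_shrink t
    (hζ.continuous.continuousAt.preimage_mem_nhds (σ.isOpen_dom.mem_nhds ht))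
  have hg := hζ.comp hh.contMDiff
  have hlh := hl.comp hh.contMDiff
  have hσ : ContMDiff 𝓘(ℝ, EuclideanSpace ℝ (Fin m)) (𝓡 S.k) ∞
      (fun s ↦ σ.toFun (S.ζ (l (h s)))) := fun s ↦ (σ.contMDiffAt _ (hP s)).comp s (hg s)
  have hlj : l (h t) ∈ S.E.dom j := by rwa [hid.eq_of_nhds]
  obtain ⟨h1, h2⟩ := W.matDeriv_coeff_of_lift (l := fun s ↦ σ.toFun (S.ζ (l (h s))))
    (l' := fun s ↦ l (h s)) hσ hlh (fun s ↦ σ.ζ_toFun _ (hP s)) (σ.mem_dom _ (hP t)) hlj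
    fun b a ↦ (ContMDiffAt.comp (f := fun s ↦ S.ζ (l (h s))) t (W.smooth σ _ (hP t) b a)
      (hg t)).contDiffAt
  have hev : (fun s ↦ l (h s)) =ᶠ[𝓝 t] l := hid.fun_comp l
  refine ⟨fun b a ↦ (h1 b a).congr_of_eventuallyEq ?_, fun v ↦ ?_⟩
  · filter_upwards [hev] with s hs
    rw [hs]
  · have h3 := h2 v _ (W.matDeriv_coeff_section σ hg t v (hP t))
    have e1 : pullForm S.E (fun s ↦ l (h s)) j t v = pullForm S.E l j t v := by
      ext a b
      simp only [pullForm, Matrix.of_apply, hev.mfderiv_eq]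
      rw [hid.eq_of_nhds]
      rfl
    have e2 : plotDeriv (d := d) ((fun s ↦ S.ζ (l s)) ∘ h) t v = plotDeriv (fun s ↦ S.ζ (l s)) t v :=
      plotDeriv_congr (hid.fun_comp fun s ↦ S.ζ (l s)) v
    have e3 : matDeriv (fun s ↦ W.coeff j (l (h s))) t v = matDeriv (fun s ↦ W.coeff j (l s)) t v :=
      matDeriv_congr (hid.fun_comp fun s ↦ W.coeff j (l s)) v
    have e4 : h t = t := hid.eq_of_nhds
    rw [e1, e3] at h3
    rw [e2, e4, Function.comp_apply, e4] at h3
    exact h3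

/-- Both forms express the covariant derivative of the frame along the same plot `σ ∘ g`, and the
unitary coefficient matrix cancels. -/
theorem secMat_congr (σ τ : LocalSection S) {x : M} (hσ : x ∈ σ.dom) (hτ : x ∈ τ.dom)
    (v : EuclideanSpace ℝ (Fin d)) : W.secMat σ x v = W.secMat τ x v := by
  have hO : σ.dom ∩ τ.dom ∈ 𝓝 x := (σ.isOpen_dom.inter τ.isOpen_dom).mem_nhds ⟨hσ, hτ⟩
  obtain ⟨g, c, hg, hgO, hgx, hc⟩ := exists_plot (d := d) hO
  have hl : ContMDiff 𝓘(ℝ, EuclideanSpace ℝ (Fin d)) (𝓡 S.k) ∞ (fun s ↦ σ.toFun (g s)) :=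
    fun s ↦ (σ.contMDiffAt _ (hgO s).1).comp s (hg s)
  have hζ : (fun s ↦ S.ζ (σ.toFun (g s))) = g := funext fun s ↦ σ.ζ_toFun _ (hgO s).1
  have hmem := σ.mem_dom _ (hgO (c x)).1
  have h1 := fun v ↦ W.matDeriv_coeff_section σ hg (c x) v (hgO _).1
  have h2 := (W.matDeriv_coeff τ hl (c x) (by rw [σ.ζ_toFun _ (hgO _).1]; exact (hgO _).2) σ.i hmem).2
  have h3 : ∀ v', W.secMat σ (g (c x)) (plotDeriv g (c x) v') =
      W.secMat τ (g (c x)) (plotDeriv g (c x) v') := fun v' ↦ by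
    have h4 := W.coeff_mul_left_cancel hmem ((h1 v').symm.trans (h2 v'))
    rw [h4, hζ, σ.ζ_toFun _ (hgO _).1]
  have h4 := plotDeriv_mfderiv hg hc v
  have h5 := h3 (mfderiv (𝓡 d) 𝓘(ℝ, EuclideanSpace ℝ (Fin d)) c x v)
  rwa [h4, hgx] at h5

theorem contMDiffAt_secForm (σ : LocalSection S) (a b : Fin W.n) (q : TangentBundle (𝓡 d) M)
    (hq : q.proj ∈ σ.dom) : ContMDiffAt (𝓡 d).tangent 𝓘(ℝ, ℂ) ∞
      (fun q : TangentBundle (𝓡 d) M ↦ W.secForm σ a b q.proj q.snd) q := by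
  have hproj : ContMDiffAt (𝓡 d).tangent (𝓡 d) ∞ (fun q : TangentBundle (𝓡 d) M ↦ q.proj) q :=
    contMDiffAt_proj _
  have hC : ∀ c a, ContMDiffAt (𝓡 d).tangent 𝓘(ℝ, ℂ) ∞
      (fun q : TangentBundle (𝓡 d) M ↦ W.coeff σ.i (σ.toFun q.proj) c a) q := fun c a ↦
    ContMDiffAt.comp (f := fun q : TangentBundle (𝓡 d) M ↦ q.proj) q (W.smooth σ _ hq c a) hproj
  simp only [secForm_apply]
  refine ContMDiffAt.sum fun c _ ↦ cmMul ?_ (ContMDiffAt.add ?_ (ContMDiffAt.sum fun e _ ↦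
    cmMul ?_ (hC e b)))
  · exact Complex.conjCLE.contDiff.contMDiff.contMDiffAt.comp q (hC c a)
  · exact contMDiffAt_dC σ.isOpen_dom (fun x hx ↦ W.smooth σ x hx c b) q hq
  · exact ContMDiffAt.comp (f := tangentMap (𝓡 d) (𝓡 S.k) σ.toFun) q
      (S.E.smooth_form σ.i c e _ (σ.mem_dom _ hq))
      (contMDiffAt_tangentMap σ.isOpen_dom σ.contMDiffAt q hq)

/-- Differentiating `C* C = 1` shows that `C* dC` is skew-hermitian; `C* ω C` is so because `ω` is.
-/
theorem secForm_skew (σ : LocalSection S) (a b : Fin W.n) {x : M} (hx : x ∈ σ.dom)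
    (v : TangentSpace (𝓡 d) x) :
    W.secForm σ a b x v = - (starRingEnd ℂ) (W.secForm σ b a x v) := by
  set C := fun y c a ↦ W.coeff σ.i (σ.toFun y) c a with hCdef
  have hC : ∀ c a, ContMDiffAt (𝓡 d) 𝓘(ℝ, ℂ) ∞ (fun y ↦ C y c a) x := W.smooth σ x hx
  set κ := fun c e ↦ S.E.form σ.i c e (σ.toFun x) (mfderiv (𝓡 d) (𝓡 S.k) σ.toFun x v) with hκ
  have hskew : ∀ c e, κ c e = - starRingEnd ℂ (κ e c) := fun c e ↦
    S.E.skew σ.i c e _ (σ.mem_dom x hx) _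
  have h1 : dC (fun y ↦ ∑ c, starRingEnd ℂ (C y c a) * C y c b) x v = 0 := by
    have h2 : (fun y ↦ ∑ c, starRingEnd ℂ (C y c a) * C y c b) =ᶠ[𝓝 x]
        fun _ ↦ (1 : Matrix (Fin W.n) (Fin W.n) ℂ) a b := by
      filter_upwards [σ.isOpen_dom.mem_nhds hx] with y hy
      rw [← W.conjTranspose_coeff_mul (σ.mem_dom y hy)]
      rfl
    rw [dC, h2.mfderiv_eq]
    simp
    rfl
  have h2 : dC (fun y ↦ ∑ c, starRingEnd ℂ (C y c a) * C y c b) x v =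
      ∑ c, (starRingEnd ℂ (dC (fun y ↦ C y c a) x v) * C x c b +
        starRingEnd ℂ (C x c a) * dC (fun y ↦ C y c b) x v) := by
    rw [dC_sum fun c ↦ cmMul (contMDiffAt_conj (hC c a)) (hC c b)]
    refine Finset.sum_congr rfl fun c _ ↦ ?_
    rw [dC_mul (contMDiffAt_conj (hC c a)) (hC c b), dC_conj (hC c a)]
  rw [secForm_apply, secForm_apply]
  change ∑ c, starRingEnd ℂ (C x c a) * (dC (fun y ↦ C y c b) x v + ∑ e, κ c e * C x e b) =
    - starRingEnd ℂ (∑ c, starRingEnd ℂ (C x c b) * (dC (fun y ↦ C y c a) x v + ∑ e, κ c e * C x e a))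
  have h3 : ∑ c, ∑ e, starRingEnd ℂ (C x c a) * (κ c e * C x e b) =
      - ∑ c, ∑ e, C x c b * (starRingEnd ℂ (κ c e) * starRingEnd ℂ (C x e a)) := by
    rw [Finset.sum_comm, ← Finset.sum_neg_distrib]
    refine Finset.sum_congr rfl fun c _ ↦ ?_
    rw [← Finset.sum_neg_distrib]
    refine Finset.sum_congr rfl fun e _ ↦ ?_
    rw [hskew e c]
    ring
  rw [h2, Finset.sum_add_distrib] at h1
  simp only [map_sum, map_mul, map_add, Complex.conj_conj, mul_add, Finset.sum_add_distrib,
    Finset.mul_sum, h3]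
  have h4 : ∑ c, C x c b * starRingEnd ℂ (dC (fun y ↦ C y c a) x v) =
      ∑ c, starRingEnd ℂ (dC (fun y ↦ C y c a) x v) * C x c b :=
    Finset.sum_congr rfl fun c _ ↦ mul_comm _ _
  rw [h4]
  linear_combination h1

/-- The global connection form. -/
def uform : UForm d M where
  n := W.n
  -- The sign appears because `UForm.bundle` carries `d - A`. The local section varies with `x`, but
  -- by `secMat_congr` it may be held fixed near each point.
  form := Matrix.of fun a b x ↦ - W.secForm (S.locSec x) a b x
  smooth a b q := by
    refine ((W.contMDiffAt_secForm (S.locSec q.proj) a b q (S.mem_locSec _)).neg).congr_of_eventuallyEq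
      ?_
    have hO : IsOpen (π (EuclideanSpace ℝ (Fin d)) (TangentSpace (𝓡 d)) ⁻¹' (S.locSec q.proj).dom :
        Set (TangentBundle (𝓡 d) M)) :=
      (S.locSec q.proj).isOpen_dom.preimage (FiberBundle.continuous_proj _ _)
    filter_upwards [hO.mem_nhds (S.mem_locSec _)] with p hp
    have := congrFun (congrFun (W.secMat_congr (S.locSec p.proj) (S.locSec q.proj)
      (S.mem_locSec _) hp p.snd) a) b
    exact congrArg Neg.neg this
  skew a b x v := by
    have := W.secForm_skew (S.locSec x) a b (S.mem_locSec x) v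
    simp [this]

/-- The formula for the covariant derivative of the frame is literally the condition that the frame
intertwines `d - A` with the connection of `E`. -/
theorem isParallelAt {m : ℕ} {l : EuclideanSpace ℝ (Fin m) → S.Z}
    (hl : ContMDiff 𝓘(ℝ, EuclideanSpace ℝ (Fin m)) (𝓡 S.k) ∞ l) (t : EuclideanSpace ℝ (Fin m)) :
    IsParallelAt W.uform.bundle S.E (fun s ↦ S.ζ (l s)) l
      (fun s ↦ (W.w (l s)).toLinearEquiv.toLinearMap) t := by
  intro i j _ hj
  obtain ⟨h1, h2⟩ := W.matDeriv_coeff (S.locSec (S.ζ (l t))) hl t (S.mem_locSec _) j hj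
  refine ⟨h1, fun v ↦ (h2 v).trans (congrArg (W.coeff j (l t) * ·) ?_)⟩
  ext a b
  exact (neg_neg _).symm

end GlobalFrame

end ConnectionForm

/-! ### Adjoints of parallel bundle maps -/

section Adjoint

variable {k₀ k₁ : ℕ} {N₀ N₁ : Type u}
  [TopologicalSpace N₀] [ChartedSpace (EuclideanSpace ℝ (Fin k₀)) N₀] [IsManifold (𝓡 k₀) ∞ N₀]
  [TopologicalSpace N₁] [ChartedSpace (EuclideanSpace ℝ (Fin k₁)) N₁] [IsManifold (𝓡 k₁) ∞ N₁]
  {m : ℕ}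

theorem pullForm_conjTranspose (E : HermBundle k₀ N₀) (g : EuclideanSpace ℝ (Fin m) → N₀) (i : E.ι)
    (t v : EuclideanSpace ℝ (Fin m)) (h : g t ∈ E.dom i) :
    (pullForm E g i t v).conjTranspose = - pullForm E g i t v := by
  ext a b
  have := E.skew i a b (g t) h (mfderiv 𝓘(ℝ, EuclideanSpace ℝ (Fin m)) (𝓡 k₀) g t v)
  simp only [pullForm, Matrix.conjTranspose_apply, Matrix.neg_apply, Matrix.of_apply]
  rw [this, neg_neg]
  rfl

theorem matDeriv_conjTranspose {α β : Type} {P : EuclideanSpace ℝ (Fin m) → Matrix β α ℂ}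
    {t : EuclideanSpace ℝ (Fin m)} (hP : ∀ b a, DifferentiableAt ℝ (fun s ↦ P s b a) t)
    (v : EuclideanSpace ℝ (Fin m)) :
    matDeriv (fun s ↦ (P s).conjTranspose) t v = (matDeriv P t v).conjTranspose := by
  ext a b
  have h1 := (hP b a).hasFDerivAt
  have h2 := Complex.conjCLE.hasFDerivAt.comp t h1
  exact congrArg (fun L ↦ L v) h2.fderiv

/-- The pointwise adjoint of a parallel bundle map is parallel. -/
theorem IsParallelAt.adjoint {E₀ : HermBundle k₀ N₀} {E₁ : HermBundle k₁ N₁}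
    {g₀ : EuclideanSpace ℝ (Fin m) → N₀} {g₁ : EuclideanSpace ℝ (Fin m) → N₁}
    {φ : ∀ t, E₀.fib (g₀ t) →ₗ[ℂ] E₁.fib (g₁ t)} {t : EuclideanSpace ℝ (Fin m)}
    (hφ : IsParallelAt E₀ E₁ g₀ g₁ φ t) :
    IsParallelAt E₁ E₀ g₁ g₀ (fun t ↦ LinearMap.adjoint (φ t)) t := by
  intro j i hj hi
  obtain ⟨h1, e1⟩ := hφ i j hi hj
  have key : coeff E₁ E₀ g₁ g₀ (fun t ↦ LinearMap.adjoint (φ t)) j i =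
      fun s ↦ (coeff E₀ E₁ g₀ g₁ φ i j s).conjTranspose := by
    ext s a b
    simp only [coeff, Matrix.of_apply, Matrix.conjTranspose_apply, RCLike.star_def,
      inner_conj_symm, LinearMap.adjoint_inner_right]
  refine ⟨fun a b ↦ ?_, fun v ↦ ?_⟩
  · rw [key]
    exact Complex.conjCLE.contDiff.contDiffAt.comp t (h1 b a)
  · rw [key, matDeriv_conjTranspose (fun b a ↦ (h1 b a).differentiableAt (by simp))]
    -- The conjugate transpose of `dc + ω₁ c = c ω₀` is the equation for `c*`, since both forms are
    -- skew-hermitian.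
    have h2 := congrArg Matrix.conjTranspose (e1 v)
    rw [Matrix.conjTranspose_add, Matrix.conjTranspose_mul, Matrix.conjTranspose_mul,
      pullForm_conjTranspose _ _ _ _ _ hj, pullForm_conjTranspose _ _ _ _ _ hi, Matrix.mul_neg,
      Matrix.neg_mul, add_neg_eq_iff_eq_add] at h2
    rw [h2]
    abel

end Adjoint

/-! ### The equivalence of categories -/

section Equivalence

open Topology

variable {d : ℕ} {M : Type u} [TopologicalSpace M] [ChartedSpace (EuclideanSpace ℝ (Fin d)) M]
  [IsManifold (𝓡 d) ∞ M] {ρ : ImaginaryTwoForm d M}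

/-- The adjoint of a 2-morphism. -/
def Sec.adjointHom {S S' : Sec ρ} (ψ : S ⟶ S') : S' ⟶ S :=
  ⟨fun p ↦ LinearMap.adjoint (Sec.Hom.app ψ p.1.2 p.1.1 p.2.symm),
    fun m g g' hg hg' h t ↦ (ψ.2.1 m g' g hg' hg (fun t ↦ (h t).symm) t).adjoint,
    fun z₀ z₁ z₀' z₁' h h' h₀ h₁ e ↦ by
      refine ext_inner_left ℂ fun f ↦ ?_
      -- With the test vector written as a value of the isometry `α`, compatibility of the adjoint
      -- becomes that of `ψ`.
      obtain ⟨f, rfl⟩ := (S.α z₀' z₁' h').surjective f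
      have key := ψ.2.2 z₀' z₁' z₀ z₁ h' h h₀.symm h₁.symm f
      rw [LinearIsometryEquiv.inner_map_map, LinearMap.adjoint_inner_right,
        LinearMap.adjoint_inner_right]
      refine ((S'.α z₀ z₁ h).inner_map_map _ _).symm.trans ?_
      exact congrArg (fun w ↦ inner ℂ w (S'.α z₀ z₁ h e)) key⟩

/-- A function on a connected manifold whose differential vanishes is constant. -/
theorem eq_of_dC_eq_zero [PreconnectedSpace M] {f : M → ℂ}
    (hf : ContMDiff (𝓡 d) 𝓘(ℝ, ℂ) ∞ f) (h0 : ∀ x (v : TangentSpace (𝓡 d) x), dC f x v = 0) (x y : M) :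
    f x = f y := by
  refine IsLocallyConstant.apply_eq_of_preconnectedSpace ?_ x y
  rw [IsLocallyConstant.iff_eventually_eq]
  intro x
  obtain ⟨g, c, hg, -, hgx, hc⟩ := exists_plot (d := d) (x := x) Filter.univ_mem
  have h1 : ∀ s t, f (g s) = f (g t) := by
    have h2 : ContDiff ℝ ∞ fun s ↦ f (g s) := (hf.comp hg).contDiff
    refine is_const_of_fderiv_eq_zero (𝕜 := ℝ) (h2.differentiable (by simp)) fun s ↦ ?_
    ext v
    have h3 := mfderiv_comp s ((hf (g s)).mdifferentiableAt (by simp))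
      ((hg s).mdifferentiableAt (by simp))
    have h4 := congrArg (fun L ↦ L v) h3
    rw [mfderiv_eq_fderiv] at h4
    exact h4.trans (h0 _ _)
  filter_upwards [hc] with y hy
  rw [← hy.2, ← hgx]
  exact (h1 _ _).trans (by rw [hgx])

namespace UForm

theorem mat_conjTranspose (A : UForm d M) (x : M) (v : TangentSpace (𝓡 d) x) :
    (A.mat x v).conjTranspose = - A.mat x v := by
  ext a b
  have := A.skew a b x v
  simp only [mat, Matrix.conjTranspose_apply, Matrix.neg_apply, Matrix.map_apply]
  rw [this, neg_neg]
  rfl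

theorem smoothMat_conjTranspose {α β : Type} {f : M → Matrix α β ℂ} (hf : SmoothMat d f) :
    SmoothMat d fun x ↦ (f x).conjTranspose := fun i j x ↦ contMDiffAt_conj (hf j i x)

theorem dMat_conjTranspose {α β : Type} {f : M → Matrix α β ℂ} (hf : SmoothMat d f) (x : M)
    (v : TangentSpace (𝓡 d) x) :
    dMat (fun y ↦ (f y).conjTranspose) x v = (dMat f x v).conjTranspose := by
  ext i j
  exact dC_conj (hf j i x) v

/-- The pointwise adjoint of a morphism. -/
def adjointHom {A B : UForm d M} (f : A ⟶ B) : B ⟶ A :=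
  ⟨fun x ↦ (Hom.fn f x).conjTranspose, smoothMat_conjTranspose f.2.1, fun x v ↦ by
    have h1 := congrArg Matrix.conjTranspose (f.2.2 x v)
    rw [Matrix.conjTranspose_add, Matrix.conjTranspose_mul, Matrix.conjTranspose_mul,
      mat_conjTranspose, mat_conjTranspose, Matrix.mul_neg, Matrix.neg_mul] at h1
    have h2 : A.mat x v * (Hom.fn f x).conjTranspose =
        (Hom.fn f x).conjTranspose * B.mat x v + (dMat (Hom.fn f) x v).conjTranspose := by
      have h3 : -((Hom.fn f x).conjTranspose * B.mat x v) =
        -(A.mat x v * (Hom.fn f x).conjTranspose) + (dMat (Hom.fn f) x v).conjTranspose := h1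
      rw [← sub_eq_zero] at h3 ⊢
      rw [← h3]
      abel
    exact h2.trans (congrArg (_ + ·) (dMat_conjTranspose f.2.1 x v).symm)⟩

theorem dMat_fn {A B : UForm d M} (f : A ⟶ B) (x : M) (v : TangentSpace (𝓡 d) x) :
    dMat (Hom.fn f) x v = B.mat x v * Hom.fn f x - Hom.fn f x * A.mat x v :=
  (sub_eq_of_eq_add' (f.2.2 x v)).symm

/-- `c = f* g` is an endomorphism of `A`, so `dc = A c - c A`, a commutator, whose trace vanishes.
-/
theorem pairing_const [PreconnectedSpace M] {A B : UForm d M} (f g : A ⟶ B) (x y : M) :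
    pairing f g x = pairing f g y := by
  let c : A ⟶ A := g ≫ adjointHom f
  have hc : ∀ x, pairing f g x = ∑ a, Hom.fn c x a a := fun x ↦ rfl
  have hs : ∀ a x, ContMDiffAt (𝓡 d) 𝓘(ℝ, ℂ) ∞ (fun x ↦ Hom.fn c x a a) x := fun a x ↦ c.2.1 a a x
  have h1 : pairing f g = fun x ↦ ∑ a, Hom.fn c x a a := funext hc
  rw [h1]
  refine eq_of_dC_eq_zero (d := d) (fun x ↦ ContMDiffAt.sum fun a _ ↦ hs a x) (fun x v ↦ ?_) x y
  rw [dC_sum fun a ↦ hs a x]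
  change Matrix.trace (dMat (Hom.fn c) x v) = 0
  rw [dMat_fn, Matrix.trace_sub, Matrix.trace_mul_comm, sub_self]

/-- A family of matrices which is parallel along plots is a morphism. -/
def homOfParallel {A B : UForm d M} (f : M → Matrix (Fin B.n) (Fin A.n) ℂ)
    (hf : ∀ (g : EuclideanSpace ℝ (Fin d) → M),
      ContMDiff 𝓘(ℝ, EuclideanSpace ℝ (Fin d)) (𝓡 d) ∞ g → ∀ t,
      IsParallelAt A.bundle B.bundle g g (fun s ↦ Matrix.toEuclideanLin (f (g s))) t) : A ⟶ B := by
  have key : ∀ g, coeff A.bundle B.bundle g g (fun s ↦ Matrix.toEuclideanLin (f (g s)))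
      PUnit.unit PUnit.unit = fun s : EuclideanSpace ℝ (Fin d) ↦ f (g s) := by
    intro g
    ext s b a
    exact toEuclideanLin_coeff _ b a
  have hs : SmoothMat d f := by
    intro b a x
    obtain ⟨g, c, hg, -, hgx, hc⟩ := exists_plot (d := d) (x := x) Filter.univ_mem
    have h1 := (hf g hg (c x) PUnit.unit PUnit.unit trivial trivial).1 b a
    rw [key] at h1
    refine (h1.contMDiffAt.comp x hc.self_of_nhds.1).congr_of_eventuallyEq ?_
    filter_upwards [hc] with y hy
    simp only [Function.comp_apply, hy.2]
  refine ⟨f, hs, fun x v ↦ ?_⟩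
  obtain ⟨g, c, hg, -, hgx, hc⟩ := exists_plot (d := d) (x := x) Filter.univ_mem
  have h1 := (hf g hg (c x) PUnit.unit PUnit.unit trivial trivial).2
  rw [key] at h1
  have h2 : ∀ v', B.mat (g (c x)) (plotDeriv (d := d) g (c x) v') * f (g (c x)) =
      f (g (c x)) * A.mat (g (c x)) (plotDeriv (d := d) g (c x) v') +
        dMat (d := d) f (g (c x)) (plotDeriv (d := d) g (c x) v') := by
    intro v'
    have hd : matDeriv (fun s ↦ f (g s)) (c x) v' = dMat (d := d) f (g (c x)) (plotDeriv (d := d) g (c x) v') := by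
      ext b a
      have h3 := mfderiv_comp (c x) ((hs b a (g (c x))).mdifferentiableAt (by simp))
        ((hg (c x)).mdifferentiableAt (by simp))
      have h4 := congrArg (fun L ↦ L v') h3
      rw [mfderiv_eq_fderiv] at h4
      exact h4
    have h3 : dMat (d := d) f (g (c x)) (plotDeriv (d := d) g (c x) v') +
        (- B.mat (g (c x)) (plotDeriv (d := d) g (c x) v')) * f (g (c x)) =
        f (g (c x)) * (- A.mat (g (c x)) (plotDeriv (d := d) g (c x) v')) := by
      rw [← hd]
      exact h1 v'
    rw [Matrix.neg_mul, Matrix.mul_neg, add_neg_eq_iff_eq_add] at h3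
    rw [h3]
    abel
  have h4 := plotDeriv_mfderiv hg hc v
  have h5 := h2 (mfderiv (𝓡 d) 𝓘(ℝ, EuclideanSpace ℝ (Fin d)) c x v)
  rw [h4] at h5
  -- The equation holds at `g (c x)`; treating that point as a variable avoids rewriting in
  -- dependent tangent spaces.
  have h6 : ∀ (y : M) (w : EuclideanSpace ℝ (Fin d)), y = x →
      (B.mat y w * f y = f y * A.mat y w + dMat f y w) →
      B.mat x w * f x = f x * A.mat x w + dMat f x w := by
    rintro _ w rfl h
    exact h
  exact h6 _ _ hgx h5

end UForm

variable [T2Space M] [SecondCountableTopology M]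

/-- For identity covers the fibre product is the diagonal, so the matrices of `ψ` at the points `(x,
x)` determine it, and they form a morphism by `UForm.homOfParallel`. -/
instance conn_full (ρ : ImaginaryTwoForm d M) : (conn ρ).Full where
  map_surjective {A B} ψ := by
    have hψ : ∀ x : M, Matrix.toEuclideanLin (Matrix.toEuclideanLin.symm (Sec.Hom.app ψ x x rfl)) =
        Sec.Hom.app ψ x x rfl := fun x ↦ LinearEquiv.apply_symm_apply _ _
    refine ⟨UForm.homOfParallel (fun x ↦ Matrix.toEuclideanLin.symm (Sec.Hom.app ψ x x rfl))
      fun g hg t ↦ ?_, ?_⟩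
    · simp only [hψ]
      exact ψ.2.1 d g g hg hg (fun _ ↦ rfl) t
    · apply Sec.Hom.ext
      intro z z' h e
      have h : z = z' := h
      subst h
      exact congrArg (fun L ↦ L e) (hψ z)

instance conn_faithful (ρ : ImaginaryTwoForm d M) : (conn ρ).Faithful where
  map_injective {A B f g} h := by
    apply UForm.Hom.ext
    intro x
    exact Matrix.toEuclideanLin.injective
      (congrArg (fun ψ : connObj ρ A ⟶ connObj ρ B ↦ Sec.Hom.app ψ x x rfl) h)

/-- The unitary isomorphism from the trivial bundle to a section with a global frame. -/
def GlobalFrame.hom {S : Sec ρ} (W : GlobalFrame S) : connObj ρ W.uform ⟶ S :=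
  ⟨fun p ↦ (W.w p.1.2).toLinearEquiv.toLinearMap,
    fun m g g' hg hg' h t ↦ by
      obtain rfl : g = fun s ↦ S.ζ (g' s) := funext h
      exact W.isParallelAt hg' t,
    fun z₀ z₁ z₀' z₁' h h' h₀ h₁ e ↦ W.α_w z₀' z₁' h' e⟩

/-- The adjoint of a unitary map is its inverse; parallelism and descent of the inverse 2-morphism
then come from `Sec.adjointHom`. -/
theorem GlobalFrame.adjoint_hom_app {S : Sec ρ} (W : GlobalFrame S) (x : M) (z : S.Z)
    (h : S.ζ z = x) (e : S.E.fib z) :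
    Sec.Hom.app (Sec.adjointHom W.hom) z x h e = (W.w z).symm e := by
  refine ext_inner_left ℂ fun f ↦ ?_
  refine (LinearMap.adjoint_inner_right _ _ _).trans ?_
  have h1 := (W.w z).inner_map_map f ((W.w z).symm e)
  rw [LinearIsometryEquiv.apply_symm_apply] at h1
  exact h1

/-- The functor `conn` reaches every section with a global frame. -/
def GlobalFrame.iso {S : Sec ρ} (W : GlobalFrame S) : (conn ρ).obj W.uform ≅ S where
  hom := W.hom
  inv := Sec.adjointHom W.hom
  hom_inv_id := by
    apply Sec.Hom.ext
    intro x x' h e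
    have h : x = x' := h
    subst h
    refine (Sec.comp_app W.hom (Sec.adjointHom W.hom) rfl (S.lift x) (S.ζ_lift x).symm e).trans ?_
    exact (W.adjoint_hom_app _ _ _ _).trans ((W.w _).symm_apply_apply e)
  inv_hom_id := by
    apply Sec.Hom.ext
    intro z z' h e
    refine (Sec.comp_app (Sec.adjointHom W.hom) W.hom h (S.ζ z) rfl e).trans ?_
    rw [W.adjoint_hom_app]
    change W.w z' ((W.w z).symm e) = S.α z z' h e
    rw [← W.α_w z z' h, LinearIsometryEquiv.apply_symm_apply]

variable [ContractibleSpace M]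

theorem nonempty_globalFrame (S : Sec ρ) : Nonempty (GlobalFrame S) := by
  -- Together with second countability this gives the sigma-compactness needed for partitions of
  -- unity.
  have : LocallyCompactSpace M := ChartedSpace.locallyCompactSpace (EuclideanSpace ℝ (Fin d)) M
  obtain ⟨n, w, h1, h2⟩ := exists_frame S
  exact ⟨⟨n, w, h1, h2⟩⟩

instance conn_essSurj (ρ : ImaginaryTwoForm d M) : (conn ρ).EssSurj where
  mem_essImage S := by
    obtain ⟨W⟩ := nonempty_globalFrame S
    exact ⟨W.uform, ⟨W.iso⟩⟩

theorem conn_isEquivalence (ρ : ImaginaryTwoForm d M) : (conn ρ).IsEquivalence where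

end Equivalence

/-! ### Hilbert space structures on the spaces of morphisms -/

section InnerProduct

variable {d : ℕ} {M : Type u} [TopologicalSpace M] [ChartedSpace (EuclideanSpace ℝ (Fin d)) M]
  [IsManifold (𝓡 d) ∞ M] {ρ : ImaginaryTwoForm d M}

open scoped ComplexOrder in
-- The squared norm `tr(f* f)` is constant, so its vanishing at one point forces `f` to vanish
-- everywhere.
theorem UForm.pairing_self_eq_zero {A B : UForm d M} [PreconnectedSpace M] (f : A ⟶ B) (x : M)
    (h : UForm.pairing f f x = 0) : f = 0 := by
  apply UForm.Hom.ext
  intro y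
  rw [UForm.pairing_const f f x y] at h
  exact Matrix.trace_conjTranspose_mul_self_eq_zero_iff.1 h

theorem UForm.pairing_eq_sum {A B : UForm d M} (f g : A ⟶ B) (x : M) :
    UForm.pairing f g x = ∑ i, inner ℂ
      (Matrix.toEuclideanLin (Hom.fn f x) (EuclideanSpace.single i (1 : ℂ)))
      (Matrix.toEuclideanLin (Hom.fn g x) (EuclideanSpace.single i (1 : ℂ))) := by
  simp [UForm.pairing, Matrix.trace, Matrix.mul_apply, PiLp.inner_apply, Matrix.toEuclideanLin,
    mul_comm]

/-- Evaluation at one point is injective, since a morphism of constant norm that vanishes there is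
zero. -/
instance UForm.finiteDimensional_hom [PreconnectedSpace M] [Nonempty M] (A B : UForm d M) :
    FiniteDimensional ℂ (A ⟶ B) := by
  obtain ⟨x₀⟩ := ‹Nonempty M›
  let ev : (A ⟶ B) →ₗ[ℂ] Matrix (Fin B.n) (Fin A.n) ℂ :=
    { toFun := fun f ↦ Hom.fn f x₀
      map_add' := fun f g ↦ rfl
      map_smul' := fun r f ↦ rfl }
  refine Module.Finite.of_injective ev ((injective_iff_map_eq_zero ev).2 fun f hf ↦ ?_)
  refine UForm.pairing_self_eq_zero f x₀ ?_
  have : Hom.fn f x₀ = 0 := hf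
  simp [UForm.pairing, this]

/-- The pairing at a point as an inner product. -/
@[reducible] def UForm.innerCore [PreconnectedSpace M] (A B : UForm d M) (x : M) :
    InnerProductSpace.Core ℂ (A ⟶ B) where
  inner f g := UForm.pairing f g x
  conj_inner_symm f g := by
    simp [UForm.pairing_eq_sum]
  re_inner_nonneg f := by
    rw [UForm.pairing_eq_sum, map_sum]
    exact Finset.sum_nonneg fun i _ ↦ inner_self_nonneg
  add_left f g h := by
    change Matrix.trace ((Hom.fn f x + Hom.fn g x).conjTranspose * _) = _
    rw [Matrix.conjTranspose_add, Matrix.add_mul, Matrix.trace_add]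
    rfl
  smul_left f g r := by
    change Matrix.trace ((r • Hom.fn f x).conjTranspose * _) = _
    rw [Matrix.conjTranspose_smul, Matrix.smul_mul, Matrix.trace_smul]
    rfl
  definite f h := UForm.pairing_self_eq_zero f x h

theorem Sec.pairing_eq_sum {S S' : Sec ρ} (ψ φ : S ⟶ S') (z : S.Z) (z' : S'.Z) (h : S.ζ z = S'.ζ z')
    {ι : Type} [Fintype ι] (u : OrthonormalBasis ι ℂ (S.E.fib z)) :
    Sec.pairing ψ φ z z' h =
      ∑ i, inner ℂ (Sec.Hom.app ψ z z' h (u i)) (Sec.Hom.app φ z z' h (u i)) := by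
  rw [Sec.pairing, LinearMap.trace_eq_sum_inner _ u]
  simp [LinearMap.adjoint_inner_right]

variable [T2Space M] [SecondCountableTopology M]

theorem pairing_conn [PreconnectedSpace M] {A B : UForm d M} (f g : A ⟶ B) (x : M)
    (z : ((conn ρ).obj A).Z) (z' : ((conn ρ).obj B).Z)
    (h : ((conn ρ).obj A).ζ z = ((conn ρ).obj B).ζ z') :
    Sec.pairing ((conn ρ).map f) ((conn ρ).map g) z z' h = UForm.pairing f g x := by
  refine Eq.trans ?_ (UForm.pairing_const f g z x)
  refine (Sec.pairing_eq_sum (S := connObj ρ A) (S' := connObj ρ B) (connMap ρ f) (connMap ρ g)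
    z z' h (EuclideanSpace.basisFun (Fin A.n) ℂ)).trans ?_
  refine Eq.trans ?_ (UForm.pairing_eq_sum f g z).symm
  simp only [EuclideanSpace.basisFun_apply]
  rfl

/-- The linear isomorphism between morphisms of sections with global frames and morphisms of their
connection forms. -/
def GlobalFrame.homEquiv {S S' : Sec ρ} (W : GlobalFrame S) (W' : GlobalFrame S') :
    (S ⟶ S') ≃ₗ[ℂ] (W.uform ⟶ W'.uform) where
  toFun ψ := (conn ρ).preimage (W.iso.hom ≫ ψ ≫ W'.iso.inv)
  invFun f := W.iso.inv ≫ (conn ρ).map f ≫ W'.iso.hom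
  map_add' ψ φ := (conn ρ).map_injective (by simp)
  map_smul' r ψ := (conn ρ).map_injective (by simp)
  left_inv ψ := by simp
  right_inv f := by simp

/-- In global frames a 2-morphism acts as a matrix-valued function on `M`, evaluated at the image of
the point of `Z`. -/
theorem GlobalFrame.homEquiv_apply {S S' : Sec ρ} (W : GlobalFrame S) (W' : GlobalFrame S')
    (ψ : S ⟶ S') (z : S.Z) (z' : S'.Z) (h : S.ζ z = S'.ζ z') (e : EuclideanSpace ℂ (Fin W.n)) :
    Sec.Hom.app ψ z z' h (W.w z e) =
      W'.w z' (Matrix.toEuclideanLin (UForm.Hom.fn (W.homEquiv W' ψ) (S.ζ z)) e) := by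
  have h1 : W.iso.hom ≫ ψ = (conn ρ).map (W.homEquiv W' ψ) ≫ W'.iso.hom := by
    have h2 : (conn ρ).map (W.homEquiv W' ψ) = W.iso.hom ≫ ψ ≫ W'.iso.inv :=
      (conn ρ).map_preimage _
    rw [h2]
    simp
  have h2 := congrArg (fun χ : connObj ρ W.uform ⟶ S' ↦ Sec.Hom.app χ (S.ζ z) z' h e) h1
  have h3 := (Sec.comp_app W.hom ψ (z := S.ζ z) h z rfl e).symm.trans h2
  refine h3.trans ((Sec.comp_app ((conn ρ).map (W.homEquiv W' ψ)) W'.hom (z := S.ζ z) h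
    (S.ζ z) rfl e).trans ?_)
  rfl

/-- Both frames are unitary: `W` supplies an orthonormal basis for the trace, and `W'` preserves the
inner products of the images. -/
theorem GlobalFrame.pairing_eq {S S' : Sec ρ} (W : GlobalFrame S) (W' : GlobalFrame S')
    (ψ φ : S ⟶ S') (z : S.Z) (z' : S'.Z) (h : S.ζ z = S'.ζ z') :
    Sec.pairing ψ φ z z' h = UForm.pairing (W.homEquiv W' ψ) (W.homEquiv W' φ) (S.ζ z) := by
  rw [UForm.pairing_eq_sum,
    Sec.pairing_eq_sum _ _ _ _ _ ((EuclideanSpace.basisFun (Fin W.n) ℂ).map (W.w z))]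
  simp only [OrthonormalBasis.map_apply, EuclideanSpace.basisFun_apply, W.homEquiv_apply W']
  exact Finset.sum_congr rfl fun i _ ↦ (W'.w z').inner_map_map _ _

/-- The pairing of sections as an inner product. -/
@[reducible] def GlobalFrame.innerCore [PreconnectedSpace M] {S S' : Sec ρ} (W : GlobalFrame S)
    (W' : GlobalFrame S') (x : M) : InnerProductSpace.Core ℂ (S ⟶ S') :=
  let c := UForm.innerCore W.uform W'.uform x
  { inner := fun ψ φ ↦ UForm.pairing (W.homEquiv W' ψ) (W.homEquiv W' φ) x
    conj_inner_symm := fun ψ φ ↦ c.conj_inner_symm _ _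
    re_inner_nonneg := fun ψ ↦ c.re_inner_nonneg _
    add_left := fun ψ φ χ ↦ by rw [map_add]; exact c.add_left _ _ _
    smul_left := fun ψ φ r ↦ by rw [map_smul]; exact c.smul_left _ _ _
    definite := fun ψ h ↦ (W.homEquiv W').map_eq_zero_iff.1 (c.definite _ h) }

end InnerProduct

/-! ### The functor and the action of Hilbert spaces -/

section Tensor

open scoped Kronecker

variable {d : ℕ} {M : Type u} [TopologicalSpace M] [ChartedSpace (EuclideanSpace ℝ (Fin d)) M]
  [IsManifold (𝓡 d) ∞ M] {ρ : ImaginaryTwoForm d M}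

/-- The orthonormal basis of `ℂⁿ ⊗ V` in which `UForm.tensor` is written. -/
def tensorBasis (n : ℕ) (V : FdHilb) :
    OrthonormalBasis (Fin (n * V.dim)) ℂ (EuclideanSpace ℂ (Fin n) ⊗[ℂ] V) :=
  ((EuclideanSpace.basisFun (Fin n) ℂ).tensorProduct V.basis).reindex finProdFinEquiv

theorem tensorBasis_apply (n : ℕ) (V : FdHilb) (a : Fin (n * V.dim)) :
    tensorBasis n V a = EuclideanSpace.single (finProdFinEquiv.symm a).1 (1 : ℂ) ⊗ₜ[ℂ]
      V.basis (finProdFinEquiv.symm a).2 := by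
  rw [tensorBasis, OrthonormalBasis.reindex_apply, OrthonormalBasis.tensorProduct_apply',
    EuclideanSpace.basisFun_apply]

theorem tensorBasis_repr_tmul (n : ℕ) (V : FdHilb) (e : EuclideanSpace ℂ (Fin n)) (v : V)
    (a : Fin (n * V.dim)) :
    (tensorBasis n V).repr (e ⊗ₜ v) a =
      inner ℂ (EuclideanSpace.single (finProdFinEquiv.symm a).1 (1 : ℂ)) e *
        inner ℂ (V.basis (finProdFinEquiv.symm a).2) v := by
  rw [OrthonormalBasis.repr_apply_apply, tensorBasis_apply, TensorProduct.inner_tmul]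

theorem tensorBasis_repr_symm_vecMat (n : ℕ) (V : FdHilb) (v : V) (e : EuclideanSpace ℂ (Fin n)) :
    (tensorBasis n V).repr.symm (Matrix.toEuclideanLin (UForm.vecMat n V v) e) = e ⊗ₜ v := by
  rw [LinearIsometryEquiv.symm_apply_eq]
  ext a
  rw [tensorBasis_repr_tmul, EuclideanSpace.inner_single_left, map_one, one_mul]
  simp [Matrix.toEuclideanLin, UForm.vecMat, Matrix.mulVec, dotProduct, mul_comm]

theorem tensorBasis_repr_symm_kronecker {n n' : ℕ} {V W : FdHilb}
    (f : Matrix (Fin n') (Fin n) ℂ) (T : V →ₗ[ℂ] W) (e : EuclideanSpace ℂ (Fin (n * V.dim))) :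
    (tensorBasis n' W).repr.symm (Matrix.toEuclideanLin
      ((f ⊗ₖ FdHilb.matrix T).submatrix finProdFinEquiv.symm finProdFinEquiv.symm) e) =
    TensorProduct.map (Matrix.toEuclideanLin f) T ((tensorBasis n V).repr.symm e) := by
  have key : (tensorBasis n' W).repr.symm.toLinearEquiv.toLinearMap ∘ₗ Matrix.toEuclideanLin
      ((f ⊗ₖ FdHilb.matrix T).submatrix finProdFinEquiv.symm finProdFinEquiv.symm) =
      TensorProduct.map (Matrix.toEuclideanLin f) T ∘ₗ
        (tensorBasis n V).repr.symm.toLinearEquiv.toLinearMap := by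
    refine (EuclideanSpace.basisFun _ ℂ).toBasis.ext fun a ↦ ?_
    rw [OrthonormalBasis.coe_toBasis, EuclideanSpace.basisFun_apply]
    change (tensorBasis n' W).repr.symm _ = TensorProduct.map _ T ((tensorBasis n V).repr.symm _)
    rw [OrthonormalBasis.repr_symm_single, tensorBasis_apply, TensorProduct.map_tmul,
      LinearIsometryEquiv.symm_apply_eq]
    ext b
    rw [tensorBasis_repr_tmul, UForm.toEuclideanLin_coeff]
    have h := UForm.toEuclideanLin_coeff ((f ⊗ₖ FdHilb.matrix T).submatrix finProdFinEquiv.symm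
      finProdFinEquiv.symm) b a
    rw [EuclideanSpace.inner_single_left, map_one, one_mul] at h
    exact h
  exact congrArg (fun L ↦ L e) key

/-- The permutation matrix of `finProdFinEquiv`. -/
def prodFinMatrix (n p : ℕ) : Matrix (Fin n × Fin p) (Fin (n * p)) ℂ :=
  (1 : Matrix (Fin n × Fin p) (Fin n × Fin p) ℂ).submatrix _root_.id finProdFinEquiv.symm

theorem mul_prodFinMatrix {n p : ℕ} (K : Matrix (Fin n × Fin p) (Fin n × Fin p) ℂ) :
    K * prodFinMatrix n p =
      prodFinMatrix n p * K.submatrix finProdFinEquiv.symm finProdFinEquiv.symm := by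
  rw [prodFinMatrix, Matrix.submatrix_mul_equiv, Matrix.one_mul]
  ext a b
  simp [Matrix.mul_apply, Matrix.one_apply, -finProdFinEquiv_symm_apply]

/-- In local frames `tensorBasis` is a constant permutation matrix: its derivative is zero, and
conjugation by it only reindexes the form `A ⊗ 1`. -/
theorem isParallelAt_tensorBasis (A : UForm d M) (V : FdHilb) {m : ℕ}
    {g g' : EuclideanSpace ℝ (Fin m) → M} (h : g = g') (t : EuclideanSpace ℝ (Fin m)) :
    IsParallelAt (A.tensor V).bundle (A.bundle.tensor V) g g'
      (fun _ ↦ (tensorBasis A.n V).repr.symm.toLinearEquiv.toLinearMap) t := by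
  subst h
  intro i j _ _
  have key : coeff (A.tensor V).bundle (A.bundle.tensor V) g g
      (fun _ ↦ (tensorBasis A.n V).repr.symm.toLinearEquiv.toLinearMap) i j =
      fun _ ↦ prodFinMatrix A.n V.dim := by
    funext s
    ext b a
    refine (congrArg (inner ℂ (EuclideanSpace.single b.1 (1 : ℂ) ⊗ₜ[ℂ] V.basis b.2))
      ((OrthonormalBasis.repr_symm_single (tensorBasis A.n V) a).trans
        (tensorBasis_apply A.n V a))).trans ?_
    rw [TensorProduct.inner_tmul, EuclideanSpace.inner_single_left, PiLp.single_apply,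
      V.basis.inner_eq_ite]
    simp only [prodFinMatrix, Matrix.submatrix_apply, Matrix.one_apply, Prod.ext_iff, id_eq]
    split_ifs <;> simp_all
  have hp : ∀ v, pullForm (A.tensor V).bundle g i t v =
      (pullForm A.bundle g i t v ⊗ₖ (1 : Matrix (Fin V.dim) (Fin V.dim) ℂ)).submatrix
        finProdFinEquiv.symm finProdFinEquiv.symm := by
    intro v
    have h1 : pullForm (A.tensor V).bundle g i t v = - (A.tensor V).mat (g t)
      (mfderiv 𝓘(ℝ, EuclideanSpace ℝ (Fin m)) (𝓡 d) g t v) := rfl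
    have h2 : pullForm A.bundle g i t v = - A.mat (g t)
      (mfderiv 𝓘(ℝ, EuclideanSpace ℝ (Fin m)) (𝓡 d) g t v) := rfl
    rw [h1, h2, UForm.tensor_mat]
    ext a b
    exact (neg_mul _ _).symm
  refine ⟨fun b a ↦ ?_, fun v ↦ ?_⟩
  · rw [key]
    exact contDiffAt_const
  · have h0 : matDeriv (fun _ : EuclideanSpace ℝ (Fin m) ↦ prodFinMatrix A.n V.dim) t v = 0 := by
      ext b a
      simp [matDeriv]
    rw [key, pullForm_tensor]
    refine Eq.trans ?_ (congrArg (prodFinMatrix A.n V.dim * ·) (hp v).symm)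
    refine (congrArg (· + _) h0).trans ((zero_add _).trans ?_)
    exact mul_prodFinMatrix _

variable [T2Space M] [SecondCountableTopology M]

/-- The 2-morphism identifying the image of `A ⊗ 1` with the tensor product of the image. -/
def connTensorHom (ρ : ImaginaryTwoForm d M) (A : UForm d M) (V : FdHilb) :
    connObj ρ (A.tensor V) ⟶ (connObj ρ A).tensor V :=
  ⟨fun _ ↦ (tensorBasis A.n V).repr.symm.toLinearEquiv.toLinearMap,
    fun m g g' hg hg' h t ↦ isParallelAt_tensorBasis A V (funext h) t,
    fun z₀ z₁ z₀' z₁' h h' h₀ h₁ e ↦ by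
      change TensorProduct.map LinearMap.id LinearMap.id _ = _
      rw [TensorProduct.map_id]
      rfl⟩

theorem adjoint_connTensorHom_app (A : UForm d M) (V : FdHilb) (x x' : M) (h : x = x')
    (e : EuclideanSpace ℂ (Fin A.n) ⊗[ℂ] V) :
    Sec.Hom.app (Sec.adjointHom (connTensorHom ρ A V)) x x' h e = (tensorBasis A.n V).repr e := by
  refine ext_inner_left ℂ fun f ↦ ?_
  refine (LinearMap.adjoint_inner_right _ _ _).trans ?_
  have h1 := (tensorBasis A.n V).repr.symm.inner_map_map f ((tensorBasis A.n V).repr e)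
  rw [LinearIsometryEquiv.symm_apply_apply] at h1
  exact h1

/-- The functor `conn` commutes with the action of Hilbert spaces. -/
def connTensorIso (ρ : ImaginaryTwoForm d M) (A : UForm d M) (V : FdHilb) :
    (conn ρ).obj (A.tensor V) ≅ ((conn ρ).obj A).tensor V where
  hom := connTensorHom ρ A V
  inv := Sec.adjointHom (connTensorHom ρ A V)
  hom_inv_id := by
    apply Sec.Hom.ext
    intro x x' h e
    refine (Sec.comp_app (connTensorHom ρ A V) (Sec.adjointHom (connTensorHom ρ A V)) h
      (x : M) rfl e).trans ?_
    exact (adjoint_connTensorHom_app (ρ := ρ) A V _ _ _ _).trans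
      ((tensorBasis A.n V).repr.apply_symm_apply e)
  inv_hom_id := by
    apply Sec.Hom.ext
    intro x x' h e
    refine (Sec.comp_app (Sec.adjointHom (connTensorHom ρ A V)) (connTensorHom ρ A V) h
      (x : M) rfl e).trans ?_
    refine (congrArg (tensorBasis A.n V).repr.symm
      (adjoint_connTensorHom_app (ρ := ρ) A V _ _ _ _)).trans ?_
    refine ((tensorBasis A.n V).repr.symm_apply_apply e).trans ?_
    -- The identity 2-morphism of a tensor product is its descent isomorphism, which here is `id ⊗
    -- id`.
    change e = TensorProduct.map LinearMap.id LinearMap.id e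
    rw [TensorProduct.map_id]
    rfl

theorem inner_connTensorIso (A : UForm d M) (V : FdHilb) (z : ((conn ρ).obj (A.tensor V)).Z)
    (z' : (((conn ρ).obj A).tensor V).Z) (h) (e e') :
    inner ℂ (Sec.Hom.app (connTensorIso ρ A V).hom z z' h e)
      (Sec.Hom.app (connTensorIso ρ A V).hom z z' h e') = inner ℂ e e' :=
  (tensorBasis A.n V).repr.symm.inner_map_map e e'

theorem map_tensorVec_connTensorIso (A : UForm d M) (V : FdHilb) (v : V) :
    (conn ρ).map (A.tensorVec V v) ≫ (connTensorIso ρ A V).hom =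
      ((conn ρ).obj A).tensorVec V v := by
  apply Sec.Hom.ext
  intro x x' h e
  refine (Sec.comp_app (connMap ρ (A.tensorVec V v)) (connTensorHom ρ A V) h
    (x : M) rfl e).trans ?_
  exact tensorBasis_repr_symm_vecMat A.n V v e

theorem map_tensorMap_connTensorIso {A B : UForm d M} (f : A ⟶ B) {V W : FdHilb}
    (T : V →ₗ[ℂ] W) :
    (conn ρ).map (UForm.tensorMap f T) ≫ (connTensorIso ρ B W).hom =
      (connTensorIso ρ A V).hom ≫ Sec.tensorMap ((conn ρ).map f) T := by
  apply Sec.Hom.ext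
  intro x x' h e
  have h : x = x' := h
  subst h
  refine (Sec.comp_app (connMap ρ (UForm.tensorMap f T)) (connTensorHom ρ B W) rfl
    (x : M) rfl e).trans ?_
  refine Eq.trans ?_ (Sec.comp_app (connTensorHom ρ A V) (Sec.tensorMap (connMap ρ f) T) rfl
    (x : M) rfl e).symm
  exact tensorBasis_repr_symm_kronecker (UForm.Hom.fn f x) T e

end Tensor

/-! ### Universal properties of tensor products and block sums -/

namespace UForm

open scoped Kronecker

variable {d : ℕ} {M : Type u} [TopologicalSpace M] [ChartedSpace (EuclideanSpace ℝ (Fin d)) M]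
  [IsManifold (𝓡 d) ∞ M]

theorem mul_vecMat_apply {n n' : ℕ} {V : FdHilb} (h : Matrix (Fin n') (Fin (n * V.dim)) ℂ) (v : V)
    (b : Fin n') (i : Fin n) :
    (h * vecMat n V v) b i = ∑ c, h b (finProdFinEquiv (i, c)) * inner ℂ (V.basis c) v := by
  rw [Matrix.mul_apply, ← finProdFinEquiv.sum_comp, Fintype.sum_prod_type]
  simp [vecMat, -finProdFinEquiv_symm_apply]

/-- The morphism `h : A ⊗ 1_V ⟶ B` with `h (e ⊗ v) = T v e`. -/
def tensorLift {A B : UForm d M} {V : FdHilb} (T : V →ₗ[ℂ] (A ⟶ B)) : A.tensor V ⟶ B :=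
  ⟨fun x ↦ Matrix.of fun b a ↦ Hom.fn (T (V.basis (finProdFinEquiv.symm a).2)) x b
      (finProdFinEquiv.symm a).1,
    fun b a ↦ (T (V.basis (finProdFinEquiv.symm a).2)).2.1 b (finProdFinEquiv.symm a).1,
    fun x v ↦ by
      ext b a
      have h := congrFun (congrFun ((T (V.basis (finProdFinEquiv.symm a).2)).2.2 x v) b)
        (finProdFinEquiv.symm a).1
      refine Eq.trans h (congrArg (· + dC (fun y ↦ Hom.fn (T (V.basis
        (finProdFinEquiv.symm a).2)) y b (finProdFinEquiv.symm a).1) x v) ?_)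
      rw [tensor_mat, Matrix.mul_apply, Matrix.mul_apply, ← finProdFinEquiv.sum_comp,
        Fintype.sum_prod_type]
      simp [Matrix.kroneckerMap_apply, Matrix.one_apply, -finProdFinEquiv_symm_apply, Hom.fn]⟩

theorem tensorVec_tensorLift {A B : UForm d M} {V : FdHilb} (T : V →ₗ[ℂ] (A ⟶ B)) (v : V) :
    A.tensorVec V v ≫ tensorLift T = T v := by
  apply Hom.ext
  intro x
  ext b i
  let ev : (A ⟶ B) →ₗ[ℂ] ℂ :=
    { toFun := fun f ↦ Hom.fn f x b i
      map_add' := fun f g ↦ rfl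
      map_smul' := fun r f ↦ rfl }
  refine (mul_vecMat_apply _ v b i).trans ?_
  change _ = ev (T v)
  conv_rhs => rw [← V.basis.sum_repr' v]
  simp only [map_sum, map_smul, smul_eq_mul]
  refine Finset.sum_congr rfl fun c _ ↦ ?_
  rw [mul_comm]
  simp [tensorLift, ev, Hom.fn, -finProdFinEquiv_symm_apply]

/-- The columns of `h` with second index `c` form the composite of `h` with `e ↦ e ⊗ V.basis c`, so
`h` is determined by its values on the basis of `V`. -/
theorem existsUnique_tensor_desc {A B : UForm d M} {V : FdHilb} (T : V →ₗ[ℂ] (A ⟶ B)) :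
    ∃! h : A.tensor V ⟶ B, ∀ v : V, A.tensorVec V v ≫ h = T v := by
  have key : ∀ (h : A.tensor V ⟶ B) x b i c,
      Hom.fn h x b (finProdFinEquiv (i, c)) =
        Hom.fn (A.tensorVec V (V.basis c) ≫ h) x b i := by
    intro h x b i c
    refine Eq.trans ?_ (mul_vecMat_apply (Hom.fn h x) (V.basis c) b i).symm
    simp [V.basis.inner_eq_ite]
  refine ⟨tensorLift T, tensorVec_tensorLift T, fun h hh ↦ ?_⟩
  apply Hom.ext
  intro x
  ext b a
  obtain ⟨⟨i, c⟩, rfl⟩ := finProdFinEquiv.surjective a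
  rw [key, key, hh, tensorVec_tensorLift]

theorem isZero_zeroForm : Limits.IsZero (zeroForm d M) := by
  rw [Limits.IsZero.iff_id_eq_zero]
  apply Hom.ext
  intro x
  ext a
  exact a.elim0

theorem blockInl_mul_blockFst_add (n n' : ℕ) :
    blockInl n n' * blockFst n n' + blockInr n n' * blockSnd n n' = 1 := by
  ext a b
  obtain ⟨a, rfl⟩ := finSumFinEquiv.surjective a
  obtain ⟨b, rfl⟩ := finSumFinEquiv.surjective b
  rw [Matrix.add_apply, Matrix.mul_apply, Matrix.mul_apply, Matrix.one_apply]
  simp only [finSumFinEquiv.injective.eq_iff, blockInl, blockFst, blockInr, blockSnd, Matrix.submatrix_apply,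
    Equiv.symm_apply_apply]
  rcases a with a | a <;> rcases b with b | b <;> simp [Matrix.one_apply]

/-- In a preadditive category this identity makes a bicone a biproduct, and additive functors
preserve it. -/
theorem sumBicone_total (A B : UForm d M) :
    (sumBicone A B).fst ≫ (sumBicone A B).inl + (sumBicone A B).snd ≫ (sumBicone A B).inr =
      𝟙 (sumBicone A B).pt :=
  Hom.ext fun _ ↦ blockInl_mul_blockFst_add A.n B.n

end UForm

end GerbeSections

end

/-! ### Assembly of the theorem -/

theorem mainTheorem6 {d : ℕ} {M : Type u} [TopologicalSpace M]
    [ChartedSpace (EuclideanSpace ℝ (Fin d)) M] [IsManifold (𝓡 d) ∞ M] [T2Space M]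
    [SecondCountableTopology M] [ContractibleSpace M] (ρ : ImaginaryTwoForm d M) :
    -- each `⟨A, A'⟩` is a finite-dimensional Hilbert space; `tr(f* g)` is constant on `M`
    (∀ A A' : UForm d M, FiniteDimensional ℂ (A ⟶ A') ∧
      ∃ c : InnerProductSpace.Core ℂ (A ⟶ A'), ∀ (f g : A ⟶ A') (x : M),
        c.inner f g = UForm.pairing f g x) ∧
    -- each `⟨S, S'⟩` is a finite-dimensional Hilbert space
    (∀ S S' : Sec ρ, FiniteDimensional ℂ (S ⟶ S') ∧
      ∃ c : InnerProductSpace.Core ℂ (S ⟶ S'), ∀ (ψ φ : S ⟶ S') (z : S.Z) (z' : S'.Z)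
        (h : S.ζ z = S'.ζ z'), c.inner ψ φ = Sec.pairing ψ φ z z' h) ∧
    -- the functor `A ↦ (M × ℂⁿ, d - A)`, which is additive and `ℂ`-linear, is an equivalence
    (conn ρ).IsEquivalence ∧
    -- it preserves the inner products
    (∀ (A A' : UForm d M) (f g : A ⟶ A') (x : M)
      (z : ((conn ρ).obj A).Z) (z' : ((conn ρ).obj A').Z)
      (h : ((conn ρ).obj A).ζ z = ((conn ρ).obj A').ζ z'),
      Sec.pairing ((conn ρ).map f) ((conn ρ).map g) z z' h
        = UForm.pairing f g x) ∧
    -- the conjugate symmetry `⟨A, A'⟩ ≅ conj ⟨A', A⟩`, `f ↦ f*`, exists on both sides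
    -- and is preserved
    (∀ (S S' : Sec ρ) (ψ : S ⟶ S'), ∃ ψ' : S' ⟶ S,
      ∀ (z : S.Z) (z' : S'.Z) (h : S.ζ z = S'.ζ z'),
        Sec.Hom.app ψ' z' z h.symm =
          LinearMap.adjoint (Sec.Hom.app ψ z z' h)) ∧
    (∀ (A A' : UForm d M) (f : A ⟶ A'), ∃ f' : A' ⟶ A,
      (∀ x : M, UForm.Hom.fn f' x =
        (UForm.Hom.fn f x).conjTranspose) ∧
      ∀ (z : ((conn ρ).obj A).Z) (z' : ((conn ρ).obj A').Z)
        (h : ((conn ρ).obj A).ζ z = ((conn ρ).obj A').ζ z'),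
        Sec.Hom.app ((conn ρ).map f') z' z h.symm =
          LinearMap.adjoint (Sec.Hom.app ((conn ρ).map f) z z' h)) ∧
    -- the direct sums: zero objects and block sums
    (Limits.IsZero (UForm.zeroForm d M) ∧
      Limits.IsZero ((conn ρ).obj (UForm.zeroForm d M))) ∧
    (∀ A B : UForm d M,
      Nonempty (UForm.sumBicone A B).IsBilimit ∧
      Nonempty ((conn ρ).mapBinaryBicone
        (UForm.sumBicone A B)).IsBilimit) ∧
    -- the actions of finite-dimensional Hilbert spaces
    (∃ θ : ∀ (A : UForm d M) (V : FdHilb),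
      (conn ρ).obj (A.tensor V) ≅ ((conn ρ).obj A).tensor V,
      (∀ (A : UForm d M) (V : FdHilb) z z' h e e', inner ℂ (Sec.Hom.app (θ A V).hom z z' h e)
        (Sec.Hom.app (θ A V).hom z z' h e') = inner ℂ e e') ∧
      (∀ (A : UForm d M) (V : FdHilb) (v : V), (conn ρ).map (A.tensorVec V v) ≫ (θ A V).hom =
        ((conn ρ).obj A).tensorVec V v) ∧
      (∀ (A B : UForm d M) (f : A ⟶ B) (V W : FdHilb) (T : V →ₗ[ℂ] W),
        (conn ρ).map (UForm.tensorMap f T) ≫ (θ B W).hom =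
          (θ A V).hom ≫ Sec.tensorMap ((conn ρ).map f) T)) ∧
    -- `A ⊗ V` represents the linear maps from `V` to the inner product space `⟨A, B⟩`
    (∀ (A B : UForm d M) (V : FdHilb) (T : V →ₗ[ℂ] (A ⟶ B)),
      ∃! h : A.tensor V ⟶ B, ∀ v : V, A.tensorVec V v ≫ h = T v) := by
  have : PathConnectedSpace M := inferInstance
  -- The inner products are evaluated at this point; constancy of the pairings makes the choice
  -- immaterial.
  obtain ⟨x₀⟩ : Nonempty M := inferInstance
  refine ⟨fun A A' ↦ ⟨inferInstance, UForm.innerCore A A' x₀, fun f g x ↦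
    UForm.pairing_const f g x₀ x⟩, fun S S' ↦ ?_, conn_isEquivalence ρ,
    fun A A' f g x z z' h ↦ pairing_conn f g x z z' h,
    fun S S' ψ ↦ ⟨Sec.adjointHom ψ, fun z z' h ↦ rfl⟩,
    fun A A' f ↦ ⟨UForm.adjointHom f, fun x ↦ rfl, fun z z' h ↦ ?_⟩,
    ⟨UForm.isZero_zeroForm, (conn ρ).map_isZero UForm.isZero_zeroForm⟩,
    fun A B ↦ ⟨⟨Limits.isBinaryBilimitOfTotal _ (UForm.sumBicone_total A B)⟩,
      ⟨Limits.isBinaryBilimitOfTotal _ ?_⟩⟩,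
    ⟨connTensorIso ρ, fun A V z z' h e e' ↦ inner_connTensorIso A V z z' h e e',
      map_tensorVec_connTensorIso, fun A B f V W T ↦ map_tensorMap_connTensorIso f T⟩,
    fun A B V T ↦ UForm.existsUnique_tensor_desc T⟩
  · obtain ⟨W⟩ := nonempty_globalFrame S
    obtain ⟨W'⟩ := nonempty_globalFrame S'
    refine ⟨(W.homEquiv W').symm.finiteDimensional, W.innerCore W' x₀, fun ψ φ z z' h ↦ ?_⟩
    exact (UForm.pairing_const _ _ _ _).trans (W.pairing_eq W' ψ φ z z' h).symm
  · have h : z = z' := h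
    subst h
    exact Matrix.toEuclideanLin_conjTranspose_eq_adjoint (UForm.Hom.fn f z)
  · have h := congrArg (conn ρ).map (UForm.sumBicone_total A B)
    rw [Functor.map_add, Functor.map_comp, Functor.map_comp, CategoryTheory.Functor.map_id] at h
    exact h
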